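/- **Setting.** Let $N\cong\mathbb Z^n$ be a lattice, $M=\mathrm{Hom}(N,\mathbb Z)$, and let $\Delta$ be a smooth fan in $N_{\mathbb R}=N\otimes\mathbb R$: a finite nonempty set of cones, each spanned by part of a $\mathbb Z$-basis of $N$, that contains the faces of its cones and in which the intersection of two cones is a face of both. Let $v_1,\dots,v_d$ be the primitive lattice vectors along the edges of $\Delta$. For $\sigma\in\Delta$ let $S_\sigma=\{u\in M:\langle u,v\rangle\ge 0\ \forall v\in\sigma\}$ and let $U_\sigma$ be the space of semigroup homomorphisms $S_\sigma\to(\mathbb R,\cdot)$ with $0\mapsto 1$ (topology of pointwise convergence). The real toric variety $X$ is the union of the $U_\sigma$, glued along the inclusions $U_\tau\subseteq U_\sigma$ for faces $\tau$ of $\sigma$; $X_+\subseteq X$ is the subspace of points given by homomorphisms with values in $[0,\infty)$. The groups $T_2=\mathrm{Hom}(M,\{\pm1\})\cong\mathbb Z_2^n$ and $T_+=\mathrm{Hom}(M,\mathbb R_{>0})$ act on $X$ by multiplication. For $\tau\in\Delta$ let $x_\tau\in U_\tau$ be the point with $x_\tau(u)=1$ for $u\in\tau^\perp$ and $x_\tau(u)=0$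 otherwise, $(O_\tau)_+=T_+x_\tau$, $V(\tau)_+=\overline{(O_\tau)_+}$, and $G_\tau=\mathrm{Stab}_{T_2}(x_\tau)$. The space $X_+$ is stratified by the $V(\tau)_+$, and the groups $G_\tau$ with the inclusions $G_\tau\subseteq G_\sigma$ ($\tau$ a face of $\sigma$) form a simple complex of groups $G(\Delta)$ over it. Let $W=W(\Delta)$ be the group generated by $s_1,\dots,s_d$ with relations $s_j^2=1$, and $(s_is_j)^2=1$ whenever $v_i,v_j$ span a cone of $\Delta$. Let $t_j\in T_2$ be $t_j(u)=(-1)^{\langle u,v_j\rangle}$. Let $\varphi:G(\Delta)\to T_2$ be the simple morphism given by the inclusions $G_\tau\subseteq T_2$, and $\iota:G(\Delta)\to W$ the simple morphism with $\iota_\tau(t_j)=s_j$ whenever $v_j\in\tau$. A simple morphism $\beta:G(\Delta)\to G$ induces $\widehat\beta:W\to G$, where $\widehat\beta(s_j)$ is the value of $\beta$ at $t_j$. For $\beta$ injective on the local groups, put $G\times X_+/{\sim}$ where $(g,x)\sim(g',x')$ iff $x=x'$ and $g^{-1}g'\in\beta_\tau(G_\tau)$ for the cone $\tau$ with $x\in(O_\tau)_+$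 (quotient topology, $G$ discrete). The development $D(X_+,\beta)$ is the set of pairs $(g,x)$ modulo the analogous relation in which $\tau$ is the index of the smallest stratum containing $x$, with the weak topology with respect to its strata $gV(\tau)_+$, which are indexed by the pairs $(\tau,g\beta_\tau(G_\tau))$. **Theorem.** 1. The morphisms $\varphi$ and $\iota$ are injective on the local groups. There are homeomorphisms $D(X_+,\varphi)\cong T_2\times X_+/{\sim}\cong X$, given by $[t,x]\mapsto[t,x]\mapsto t\cdot x$, and $D(X_+,\iota)\cong W\times X_+/{\sim}=:\widetilde X$, given by $[w,x]\mapsto[w,x]$. The spaces $D(X_+,\iota)$ and $D(X_+,\varphi)$ are stratified by the sets $gV(\tau)_+$, and left multiplication gives strata-preserving actions of $W$ and of $T_2$ on them, with strict fundamental domain $X_+$ (embedded as $x\mapsto[1,x]$). 2. $X$ is connected if and only if the $v_j\otimes 1$ span $N\otimes_{\mathbb Z}\mathbb Z_2$. In particular, $X$ is connected whenever $\{v_1,\dots,v_d\}$ contains a $\mathbb Z$-basis of $N$. 3. $\widetilde X$ is simply connected, and $[w,x]\mapsto\widehat\varphi(w)\cdot x$ is a covering map $\widetilde X\to X$ (fibres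 may be empty), which is surjective if $X$ is connected; so $\widetilde X$ is then the universal cover of $X$. For every base point, $\pi_1(X)\cong\ker(\widehat\varphi:W\to T_2)$. 4. Let $h:W\to\mathbb Z_2^d$ send $s_j$ to the $j$-th basis vector. Then $h$ is surjective with kernel $[W,W]$, that is, $h$ is the abelianisation of $W$. The simple morphism $\alpha=h\circ\iota:G(\Delta)\to\mathbb Z_2^d$ is injective on the local groups and $\widehat\alpha=h$. The space $D(X_+,\alpha)\cong\mathbb Z_2^d\times X_+/{\sim}$ is connected, with $\pi_1(D(X_+,\alpha))\cong[W,W]$, and $[h(w),x]\mapsto\widehat\varphi(w)\cdot x$ is a well-defined covering map $D(X_+,\alpha)\to X$ (fibres may be empty). If $X$ is connected, then $n\le d$, this covering map is surjective, its group of deck transformations is isomorphic to $\mathbb Z_2^{d-n}$, and this group acts transitively on the fibres. -/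

import Mathlib

open scoped TensorProduct

noncomputable section

namespace RealToric

/-! ## Stratified spaces, simple complexes of groups and developments -/

section Development

/-- A simple complex of groups over a poset: a group `grp q` for every `q` and, functorially,
an injective homomorphism `grp p → grp q` whenever `p ≤ q`. -/
structure SimpleComplexOfGroups (Q : Type*) [PartialOrder Q] where
  grp : Q → Type*
  [group : ∀ q, Group (grp q)]
  map : ∀ {p q : Q}, p ≤ q → (grp p →* grp q)
  map_injective : ∀ {p q : Q} (h : p ≤ q), Function.Injective (map h)
  map_refl : ∀ (q : Q) (g : grp q), map (le_refl q) g = g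
  map_trans : ∀ {p q r : Q} (h : p ≤ q) (h' : q ≤ r) (g : grp p),
    map h' (map h g) = map (h.trans h') g

attribute [instance] SimpleComplexOfGroups.group

/-- A simple morphism from a simple complex of groups to a group. -/
structure SimpleMorphism {Q : Type*} [PartialOrder Q] (𝒢 : SimpleComplexOfGroups Q)
    (H : Type*) [Group H] where
  hom : ∀ q, 𝒢.grp q →* H
  compat : ∀ {p q : Q} (h : p ≤ q) (g : 𝒢.grp p), hom q (𝒢.map h g) = hom p g

variable {Q : Type*} [PartialOrder Q] {𝒢 : SimpleComplexOfGroups Q} {H : Type*} [Group H]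

/-- A simple morphism that is injective on the local groups. -/
def SimpleMorphism.IsInjective (β : SimpleMorphism 𝒢 H) : Prop :=
  ∀ q, Function.Injective (β.hom q)

/-- Composition of a simple morphism with a homomorphism of groups. -/
def SimpleMorphism.comp {K : Type*} [Group K] (f : H →* K) (β : SimpleMorphism 𝒢 H) :
    SimpleMorphism 𝒢 K where
  hom q := f.comp (β.hom q)
  compat h g := by simp [β.compat h g]

/-- A topological space `Y` is stratified by the closed subsets `S q`. -/
structure IsStratification {P : Type*} {Y : Type*} [TopologicalSpace Y] (S : P → Set Y) :
    Prop where
  isClosed : ∀ p, IsClosed (S p)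
  cover : ⋃ p, S p = Set.univ
  injective : Function.Injective S
  inter : ∀ p q, ∀ y ∈ S p ∩ S q, ∃ r, y ∈ S r ∧ S r ⊆ S p ∩ S q
  support : ∀ y, ∃! p, S p = ⋂ q ∈ {q | y ∈ S q}, S q
  coherent : ∀ A : Set Y, (∀ p, IsClosed (A ∩ S p)) → IsClosed A

/-- A strata-preserving (continuous) action of a group on a stratified space. -/
structure IsStrataPreserving (G : Type*) [Group G] {P : Type*} {Y : Type*} [TopologicalSpace Y]
    [MulAction G Y] (S : P → Set Y) : Prop where
  continuous_smul : ∀ g : G, Continuous fun y : Y => g • y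
  image_stratum : ∀ (g : G) (p : P), ∃ q, (fun y => g • y) '' S p = S q

/-- `F` is a strict fundamental domain for a strata-preserving action: it contains exactly one
point of every orbit, and every stratum has exactly one translate that is a stratum inside `F`. -/
structure IsStrictFundamentalDomain (G : Type*) [Group G] {P : Type*} {Y : Type*}
    [MulAction G Y] (S : P → Set Y) (F : Set Y) : Prop where
  exists_unique_point : ∀ y : Y, ∃! z, z ∈ F ∧ z ∈ MulAction.orbit G y
  exists_unique_stratum : ∀ p : P, ∃! q, S q ⊆ F ∧ ∃ g : G, (fun y => g • y) '' S p = S q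

variable {Y : Type*} (S : Q → Set Y) (β : SimpleMorphism 𝒢 H)

/-- `(g, y) ∼ (g', y')` iff `y = y'` and `g⁻¹ g'` lies in the image of the local group at the
smallest stratum containing `y`. -/
def developmentSetoid : Setoid (H × Y) where
  r a b := a.2 = b.2 ∧ ∀ q, (S q = ⋂ p ∈ {p | a.2 ∈ S p}, S p) → a.1⁻¹ * b.1 ∈ (β.hom q).range
  iseqv :=
    { refl := fun a => ⟨rfl, fun q _ => by simp [one_mem]⟩
      symm := by
        rintro ⟨g, y⟩ ⟨g', y'⟩ ⟨h, hq⟩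
        dsimp only at h hq ⊢
        subst h
        exact ⟨rfl, fun q hs => by simpa using inv_mem (hq q hs)⟩
      trans := by
        rintro ⟨g, y⟩ ⟨g', y'⟩ ⟨g'', y''⟩ ⟨h, hq⟩ ⟨h', hq'⟩
        dsimp only at h hq h' hq' ⊢
        subst h
        subst h'
        exact ⟨rfl, fun q hs => by
          simpa [mul_assoc] using mul_mem (hq q hs) (hq' q hs)⟩ }

/-- The development `D(Y, β)` of a stratified space `Y` with respect to a simple morphism `β`. -/
def Development : Type _ := Quotient (developmentSetoid S β)

/-- The point `[g, y]` of the development. -/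
def Development.mk (g : H) (y : Y) : Development S β := Quotient.mk (developmentSetoid S β) (g, y)

/-- The development carries the weak topology: a set is closed (open) iff its preimage under
`y ↦ [g, y]` in each stratum `S q` is closed (open), for all `g`. -/
instance [TopologicalSpace Y] : TopologicalSpace (Development S β) :=
  ⨆ g : H, ⨆ q : Q, TopologicalSpace.coinduced
    (fun y : S q => Development.mk S β g (y : Y)) inferInstance

/-- The action `g • [g', y] = [g g', y]`. -/
instance : MulAction H (Development S β) where
  smul g := Quotient.map (fun a => (g * a.1, a.2)) (by
    rintro ⟨g₁, y⟩ ⟨g₂, y'⟩ ⟨h, hq⟩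
    exact ⟨h, fun q hs => by simpa [mul_assoc] using hq q hs⟩)
  one_smul := by
    rintro ⟨g, y⟩
    exact congrArg (Quotient.mk (developmentSetoid S β)) (by simp)
  mul_smul := by
    rintro g g' ⟨g₁, y⟩
    exact congrArg (Quotient.mk (developmentSetoid S β)) (by simp [mul_assoc])

/-- The strata `g S(q)` of the development, indexed by the pairs `(q, g β(grp q))`. -/
def Development.stratum (c : Σ q : Q, H ⧸ (β.hom q).range) : Set (Development S β) :=
  {z | ∃ (g : H) (y : Y), (QuotientGroup.mk g : H ⧸ (β.hom c.1).range) = c.2 ∧ y ∈ S c.1 ∧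
    z = Development.mk S β g y}

end Development

/-- The group of deck transformations of a map `p : E → B`. -/
def deckGroup {E B : Type*} [TopologicalSpace E] (p : E → B) : Subgroup (E ≃ₜ E) where
  carrier := {f | ∀ e, p (f e) = p e}
  one_mem' := fun _ => rfl
  mul_mem' := by
    intro f g hf hg e
    exact (hf (g e)).trans (hg e)
  inv_mem' := by
    intro f hf e
    have h := hf (f⁻¹ e)
    have h' : f (f⁻¹ e) = e := f.apply_symm_apply e
    rw [h'] at h
    exact h.symm

/-! ## Smooth fans -/

variable (N : Type*) [AddCommGroup N]

/-- The dual lattice `M = Hom(N, ℤ)`. -/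
abbrev M : Type _ := Module.Dual ℤ N

/-- The real vector space `N ⊗ ℝ`. -/
abbrev NR : Type _ := ℝ ⊗[ℤ] N

variable {N}

/-- The real extension `N ⊗ ℝ → ℝ` of `u ∈ M`. -/
def pair (u : M N) : NR N →ₗ[ℝ] ℝ :=
  (TensorProduct.AlgebraTensorModule.rid ℤ ℝ ℝ).toLinearMap ∘ₗ LinearMap.baseChange ℝ u

@[simp] lemma pair_tmul (u : M N) (r : ℝ) (v : N) : pair u (r ⊗ₜ[ℤ] v) = (u v : ℝ) * r := by
  simp [pair]

/-- The cone spanned by a set of lattice vectors. -/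
def coneOf (s : Set N) : PointedCone ℝ (NR N) :=
  PointedCone.hull ℝ ((fun v : N => (1 : ℝ) ⊗ₜ[ℤ] v) '' s)

/-- `τ` is a face of `σ`: it is cut out of `σ` by a linear form that is nonnegative on `σ`. -/
def IsFace (τ σ : PointedCone ℝ (NR N)) : Prop :=
  ∃ u : NR N →ₗ[ℝ] ℝ, (∀ v ∈ σ, 0 ≤ u v) ∧ ∀ v, v ∈ τ ↔ v ∈ σ ∧ u v = 0

/-- `v` is primitive: it is not a proper multiple of a lattice vector. -/
def IsPrimitive (v : N) : Prop := ∀ (k : ℤ) (w : N), v = k • w → IsUnit k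

variable (N) in
/-- A smooth fan in `N ⊗ ℝ`. -/
structure SmoothFan where
  cones : Set (PointedCone ℝ (NR N))
  finite : cones.Finite
  nonempty : cones.Nonempty
  /-- every cone is spanned by a part of a `ℤ`-basis of `N` -/
  smooth : ∀ σ ∈ cones, ∃ (b : Module.Basis (Fin (Module.finrank ℤ N)) ℤ N)
    (s : Set (Fin (Module.finrank ℤ N))), σ = coneOf (b '' s)
  face_mem : ∀ σ ∈ cones, ∀ τ, IsFace τ σ → τ ∈ cones
  inter_face : ∀ σ ∈ cones, ∀ τ ∈ cones, IsFace (σ ⊓ τ) σ ∧ IsFace (σ ⊓ τ) τ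

namespace SmoothFan

variable (Δ : SmoothFan N)

/-- The cones of the fan, ordered by inclusion; in a fan, `τ ≤ σ` iff `τ` is a face of `σ`. -/
abbrev Cone : Type _ := {σ : PointedCone ℝ (NR N) // σ ∈ Δ.cones}

/-- The edges of the fan, given by the primitive lattice vectors along them. -/
abbrev Edge : Type _ := {v : N // IsPrimitive v ∧ coneOf {v} ∈ Δ.cones}

end SmoothFan

/-! ### Facts about smooth cones -/

section Facts

variable {ι : Type*} (b : Module.Basis ι ℤ N)

lemma mem_coneOf_basis [Finite ι] (s : Set ι) (x : NR N) :
    x ∈ coneOf (b '' s) ↔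
      ∀ i, 0 ≤ (b.baseChange ℝ).repr x i ∧ (i ∉ s → (b.baseChange ℝ).repr x i = 0) := by
  classical
  have := Fintype.ofFinite ι
  constructor
  · intro hx
    induction hx using Submodule.span_induction with
    | mem x hx =>
      obtain ⟨_, ⟨j, hj, rfl⟩, rfl⟩ := hx
      intro i
      simp only [Module.Basis.baseChange_repr_tmul, Module.Basis.repr_self, Finsupp.single_apply]
      refine ⟨by split_ifs <;> simp, fun hi => ?_⟩
      rw [if_neg (by rintro rfl; exact hi hj)]
      simp
    | zero => simp
    | add x y _ _ hx hy =>
      intro i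
      simp only [map_add, Finsupp.add_apply]
      exact ⟨add_nonneg (hx i).1 (hy i).1, fun h => by rw [(hx i).2 h, (hy i).2 h, add_zero]⟩
    | smul a x _ hx =>
      intro i
      have e : (b.baseChange ℝ).repr (a • x) i = (a : ℝ) * (b.baseChange ℝ).repr x i := by
        change (b.baseChange ℝ).repr ((a : ℝ) • x) i = _
        rw [map_smul, Finsupp.smul_apply, smul_eq_mul]
      rw [e]
      exact ⟨mul_nonneg a.2 (hx i).1, fun h => by rw [(hx i).2 h, mul_zero]⟩
  · intro h
    rw [← (b.baseChange ℝ).sum_repr x]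
    refine Submodule.sum_mem _ fun i _ => ?_
    by_cases hi : i ∈ s
    · have hm : (1 : ℝ) ⊗ₜ[ℤ] b i ∈ coneOf (b '' s) :=
        Submodule.subset_span ⟨b i, ⟨i, hi, rfl⟩, rfl⟩
      rw [Module.Basis.baseChange_apply]
      exact Submodule.smul_mem _ (⟨_, (h i).1⟩ : {c : ℝ // 0 ≤ c}) hm
    · rw [(h i).2 hi, zero_smul]
      exact zero_mem _

lemma isFace_basis [Finite ι] {s' s : Set ι} (h : s' ⊆ s) :
    IsFace (coneOf (b '' s')) (coneOf (b '' s)) := by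
  classical
  have := Fintype.ofFinite ι
  refine ⟨∑ i ∈ Finset.univ.filter (fun i => i ∉ s'), (b.baseChange ℝ).coord i, ?_, ?_⟩
  · intro v hv
    rw [mem_coneOf_basis] at hv
    simp only [LinearMap.sum_apply, Module.Basis.coord_apply]
    exact Finset.sum_nonneg fun i _ => (hv i).1
  · intro v
    simp only [mem_coneOf_basis, LinearMap.sum_apply, Module.Basis.coord_apply]
    constructor
    · intro hv
      refine ⟨fun i => ⟨(hv i).1, fun hi => (hv i).2 fun hi' => hi (h hi')⟩, ?_⟩
      refine Finset.sum_eq_zero fun i hi => (hv i).2 ?_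
      simpa using hi
    · rintro ⟨hv, h0⟩ i
      refine ⟨(hv i).1, fun hi => ?_⟩
      rw [Finset.sum_eq_zero_iff_of_nonneg fun i _ => (hv i).1] at h0
      exact h0 i (by simpa using hi)

lemma isPrimitive_basis (i : ι) : IsPrimitive (b i) := by
  intro k w h
  have h1 := congrArg (fun x => b.repr x i) h
  simp only [Module.Basis.repr_self, Finsupp.single_eq_same, map_smul, Finsupp.smul_apply,
    smul_eq_mul] at h1
  exact IsUnit.of_mul_eq_one _ h1.symm

lemma exists_eq_basis [Finite ι] {v : N} (hv : IsPrimitive v) {s : Set ι}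
    (hf : IsFace (coneOf {v}) (coneOf (b '' s))) : ∃ i ∈ s, v = b i := by
  classical
  have := Fintype.ofFinite ι
  obtain ⟨u, hu, hface⟩ := hf
  have hv1 : (1 : ℝ) ⊗ₜ[ℤ] v ∈ coneOf {v} := Submodule.subset_span ⟨v, rfl, rfl⟩
  obtain ⟨hvσ, huv⟩ := (hface _).1 hv1
  rw [mem_coneOf_basis] at hvσ
  simp only [Module.Basis.baseChange_repr_tmul] at hvσ
  have hne : ∃ i, b.repr v i ≠ 0 := by
    by_contra! hcon
    have h0 : v = 0 := b.repr.injective (by ext i; simpa using hcon i)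
    have := hv 0 0 (by simp [h0])
    simp at this
  obtain ⟨i, hi⟩ := hne
  have his : i ∈ s := by
    by_contra his
    have := (hvσ i).2 his
    simp [hi] at this
  have hbσ : ∀ j ∈ s, (1 : ℝ) ⊗ₜ[ℤ] b j ∈ coneOf (b '' s) := fun j hj =>
    Submodule.subset_span ⟨b j, ⟨j, hj, rfl⟩, rfl⟩
  have hsum : u ((1 : ℝ) ⊗ₜ[ℤ] v) = ∑ j, (b.repr v j : ℝ) * u ((1 : ℝ) ⊗ₜ[ℤ] b j) := by
    conv_lhs => rw [← (b.baseChange ℝ).sum_repr ((1 : ℝ) ⊗ₜ[ℤ] v)]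
    simp [Module.Basis.baseChange_repr_tmul]
  rw [hsum, Finset.sum_eq_zero_iff_of_nonneg] at huv
  swap
  · intro j _
    have hj := hvσ j
    simp only [zsmul_eq_mul, mul_one] at hj
    by_cases hjs : j ∈ s
    · exact mul_nonneg hj.1 (hu _ (hbσ j hjs))
    · rw [hj.2 hjs, zero_mul]
  have hub : u ((1 : ℝ) ⊗ₜ[ℤ] b i) = 0 := by
    have := huv i (Finset.mem_univ _)
    rcases mul_eq_zero.1 this with h | h
    · exact absurd (by exact_mod_cast h) hi
    · exact h
  have hbv : (1 : ℝ) ⊗ₜ[ℤ] b i ∈ coneOf {v} := (hface _).2 ⟨hbσ i his, hub⟩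
  simp only [coneOf, Set.image_singleton] at hbv
  obtain ⟨c, hc⟩ := Submodule.mem_span_singleton.1 hbv
  have hc' : ∀ j, (c : ℝ) * (b.repr v j : ℝ) = (b.repr (b i) j : ℝ) := by
    intro j
    have h := congrArg (fun x => (b.baseChange ℝ).repr x j) hc
    have e : (b.baseChange ℝ).repr (c • ((1 : ℝ) ⊗ₜ[ℤ] v)) j
        = (c : ℝ) * (b.baseChange ℝ).repr ((1 : ℝ) ⊗ₜ[ℤ] v) j := by
      change (b.baseChange ℝ).repr ((c : ℝ) • ((1 : ℝ) ⊗ₜ[ℤ] v)) j = _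
      rw [map_smul, Finsupp.smul_apply, smul_eq_mul]
    simp only [e, Module.Basis.baseChange_repr_tmul, zsmul_eq_mul, mul_one] at h
    exact h
  have hci := hc' i
  simp only [Module.Basis.repr_self, Finsupp.single_eq_same, Int.cast_one] at hci
  have hc0 : (c : ℝ) ≠ 0 := by
    intro h
    simp [h] at hci
  have hvk : v = (b.repr v i) • b i := by
    apply b.repr.injective
    ext j
    by_cases hij : j = i
    · subst hij
      simp
    · have := hc' j
      rw [Module.Basis.repr_self, Finsupp.single_eq_of_ne hij, Int.cast_zero] at this
      have h0 : (b.repr v j : ℝ) = 0 := (mul_eq_zero.1 this).resolve_left hc0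
      have h0' : b.repr v j = 0 := by exact_mod_cast h0
      simp [h0', hij]
  have hk : 0 ≤ b.repr v i := by
    have := (hvσ i).1
    simpa using this
  have hunit := hv _ _ hvk
  have h1 : b.repr v i = 1 := by
    rcases Int.isUnit_iff.1 hunit with h | h
    · exact h
    · omega
  exact ⟨i, his, by rw [hvk, h1, one_smul]⟩

end Facts

/-! ## Tori and affine charts -/

variable (N) in
/-- `T_ℝ = Hom(M, ℝ*)`. -/
abbrev TR : Type _ := Multiplicative (M N) →* ℝˣ

variable (N) in
/-- `T₂ = Hom(M, ℤ₂)`, with `ℤ₂ = {±1}`. -/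
abbrev T2 : Type _ := Multiplicative (M N) →* ℤˣ

variable (N) in
/-- `T₊ = Hom(M, ℝ⁺)`, as a subgroup of `T_ℝ`. -/
def TPos : Subgroup (TR N) where
  carrier := {t | ∀ u, 0 < (t u : ℝ)}
  one_mem' := by intro u; simp
  mul_mem' := by intro s t hs ht u; simpa using mul_pos (hs u) (ht u)
  inv_mem' := by intro s hs u; simpa using hs u

variable (N) in
/-- The inclusion `T₂ → T_ℝ` induced by `{±1} ⊆ ℝ*`. -/
def T2.toTR : T2 N →* TR N where
  toFun t := (Units.map (Int.castRingHom ℝ : ℤ →* ℝ)).comp t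
  map_one' := by ext; simp
  map_mul' := by intro s t; ext; simp

/-- The semigroup `S_σ = σ^∨ ∩ M`. -/
def dualSemigroup (σ : PointedCone ℝ (NR N)) : AddSubmonoid (M N) where
  carrier := {u | ∀ v ∈ σ, 0 ≤ pair u v}
  zero_mem' := by
    intro v _
    simp [pair]
  add_mem' := by
    intro u u' h h' v hv
    have e : pair (u + u') v = pair u v + pair u' v := by
      simp [pair, LinearMap.baseChange_add]
    rw [e]
    exact add_nonneg (h v hv) (h' v hv)

/-- `U_σ = Hom_sg(S_σ, ℝ)`, the semigroup homomorphisms to `(ℝ, ·)` that send `0` to `1`, with the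
topology of pointwise convergence. -/
abbrev Chart (σ : PointedCone ℝ (NR N)) : Type _ :=
  {x : dualSemigroup σ → ℝ // x 0 = 1 ∧ ∀ u v, x (u + v) = x u * x v}

/-- The inclusion `U_τ → U_σ` for `τ ⊆ σ`, i.e. restriction from `S_τ` to `S_σ`. -/
def Chart.res {τ σ : PointedCone ℝ (NR N)} (h : τ ≤ σ) (x : Chart τ) : Chart σ :=
  ⟨fun u => x.1 ⟨u.1, fun v hv => u.2 v (h hv)⟩, x.2.1, fun u v =>
    x.2.2 ⟨u.1, fun w hw => u.2 w (h hw)⟩ ⟨v.1, fun w hw => v.2 w (h hw)⟩⟩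

/-- The action of `T_ℝ` on `U_σ` by multiplication. -/
instance (σ : PointedCone ℝ (NR N)) : MulAction (TR N) (Chart σ) where
  smul t x := ⟨fun u => (t (Multiplicative.ofAdd u.1) : ℝ) * x.1 u, by simp [x.2.1], by
    intro u v
    dsimp only
    rw [x.2.2, AddSubmonoid.coe_add, ofAdd_add, map_mul, Units.val_mul]
    ring⟩
  one_smul x := Subtype.ext (funext fun u => one_mul _)
  mul_smul s t x := Subtype.ext (funext fun u => by
    change ((s * t) (Multiplicative.ofAdd u.1) : ℝ) * x.1 u = _ * (_ * _)
    rw [MonoidHom.mul_apply, Units.val_mul, mul_assoc])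

instance (σ : PointedCone ℝ (NR N)) : MulAction (T2 N) (Chart σ) :=
  MulAction.compHom _ (T2.toTR N)

open Classical in
/-- The distinguished point `x_σ ∈ U_σ`: `x_σ(u) = 1` if `u ∈ σ^⊥` and `0` otherwise. -/
def distinguished (σ : PointedCone ℝ (NR N)) : Chart σ :=
  ⟨fun u => if ∀ v ∈ σ, pair u.1 v = 0 then 1 else 0, by simp [pair], by
    intro u u'
    have e : ∀ v, pair (u + u').1 v = pair u.1 v + pair u'.1 v := by
      intro v
      simp [pair, LinearMap.baseChange_add]
    dsimp only
    by_cases h : ∀ v ∈ σ, pair u.1 v = 0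
    · by_cases h' : ∀ v ∈ σ, pair u'.1 v = 0
      · rw [if_pos h, if_pos h', if_pos fun v hv => by rw [e, h v hv, h' v hv, add_zero], mul_one]
      · rw [if_pos h, if_neg h', if_neg, mul_zero]
        intro hs
        refine h' fun v hv => ?_
        have := hs v hv
        rwa [e, h v hv, zero_add] at this
    · rw [if_neg h, if_neg, zero_mul]
      intro hs
      refine h fun v hv => ?_
      have h1 := hs v hv
      rw [e] at h1
      have h2 : 0 ≤ pair u.1 v := u.2 v hv
      have h3 : 0 ≤ pair u'.1 v := u'.2 v hv
      linarith⟩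

lemma mem_stabilizer_distinguished (σ : PointedCone ℝ (NR N)) (t : T2 N) :
    t ∈ MulAction.stabilizer (T2 N) (distinguished σ) ↔
      ∀ u : M N, (∀ v ∈ σ, pair u v = 0) → t (Multiplicative.ofAdd u) = 1 := by
  have key : ∀ (u : dualSemigroup σ), (t • distinguished σ).1 u =
      ((t (Multiplicative.ofAdd u.1) : ℤ) : ℝ) * (distinguished σ).1 u := fun u => rfl
  rw [MulAction.mem_stabilizer_iff]
  constructor
  · intro h u hu
    have hx : (distinguished σ).1 ⟨u, fun v hv => (hu v hv).ge⟩ = 1 := if_pos hu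
    have h1 := key ⟨u, fun v hv => (hu v hv).ge⟩
    rw [h, hx, mul_one] at h1
    have h2 : ((t (Multiplicative.ofAdd u) : ℤ) : ℝ) = 1 := h1.symm
    have h3 : (t (Multiplicative.ofAdd u) : ℤ) = 1 := Int.cast_injective (α := ℝ) (by simpa using h2)
    exact Units.ext h3
  · intro h
    apply Subtype.ext
    funext u
    rw [key]
    by_cases hu : ∀ v ∈ σ, pair u.1 v = 0
    · rw [h u.1 hu]
      simp
    · have hx : (distinguished σ).1 u = 0 := if_neg hu
      rw [hx, mul_zero]

namespace SmoothFan

variable (Δ : SmoothFan N)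

/-! ## The real toric variety -/

/-- `X`: the union of the charts `U_σ`, glued along the inclusions `U_τ → U_σ` for `τ` a face
of `σ`, with the quotient topology. -/
def X : Type _ :=
  Quot fun a b : Σ σ : Δ.Cone, Chart σ.1 => ∃ h : a.1 ≤ b.1, b.2 = Chart.res h a.2

instance : TopologicalSpace Δ.X :=
  inferInstanceAs (TopologicalSpace (Quot fun a b : Σ σ : Δ.Cone, Chart σ.1 =>
    ∃ h : a.1 ≤ b.1, b.2 = Chart.res h a.2))

/-- The point of `X` given by a point of the chart `U_σ`. -/
def toX (σ : Δ.Cone) (x : Chart σ.1) : Δ.X := Quot.mk _ ⟨σ, x⟩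

/-- The action of `T_ℝ` on `X`. -/
instance : MulAction (TR N) Δ.X where
  smul t := Quot.map (fun a => ⟨a.1, t • a.2⟩) (by
    rintro ⟨τ, x⟩ ⟨σ, y⟩ ⟨h, hy⟩
    dsimp only at h hy
    subst hy
    exact ⟨h, Subtype.ext rfl⟩)
  one_smul := by
    rintro ⟨σ, x⟩
    exact congrArg (Δ.toX σ) (one_smul (TR N) x)
  mul_smul := by
    rintro s t ⟨σ, x⟩
    exact congrArg (Δ.toX σ) (mul_smul s t x)

instance : MulAction (T2 N) Δ.X := MulAction.compHom _ (T2.toTR N)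

/-- The nonnegative part `X₊`: the union of the `(U_σ)₊ = Hom_sg(S_σ, ℝ₊)`. -/
def XPos : Set Δ.X := {p | ∃ (σ : Δ.Cone) (x : Chart σ.1), (∀ u, 0 ≤ x.1 u) ∧ p = Δ.toX σ x}

/-- `(O_τ)₊`: the orbit of `x_τ` under `T₊`. -/
def orbitPos (τ : Δ.Cone) : Set Δ.X := MulAction.orbit (TPos N) (Δ.toX τ (distinguished τ.1))

/-- The stratum `V(τ)₊`, the closure of `(O_τ)₊`, as a subset of `X₊`. -/
def VPos (τ : Δ.Cone) : Set Δ.XPos := Subtype.val ⁻¹' closure (Δ.orbitPos τ)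

/-! ## The complex of groups -/

/-- The simple complex of groups `G(Δ)`: the local group at `τ` is the stabilizer of `x_τ` in `T₂`,
and the maps are the inclusions. -/
def cplx : SimpleComplexOfGroups Δ.Cone where
  grp τ := MulAction.stabilizer (T2 N) (distinguished τ.1)
  map {τ σ} h := Subgroup.inclusion (by
    intro t ht
    rw [mem_stabilizer_distinguished] at ht ⊢
    exact fun u hu => ht u fun v hv => hu v (h hv))
  map_injective h := Subgroup.inclusion_injective _
  map_refl _ _ := rfl
  map_trans _ _ _ := rfl

/-- The simple morphism `φ : G(Δ) → T₂` given by the inclusions. -/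
def phi : SimpleMorphism Δ.cplx (T2 N) where
  hom τ := (MulAction.stabilizer (T2 N) (distinguished τ.1)).subtype
  compat _ _ := rfl

/-- The right-angled Coxeter group `W(Δ)`. -/
abbrev W : Type _ :=
  PresentedGroup ({r | ∃ v : Δ.Edge, r = FreeGroup.of v ^ 2} ∪
    {r | ∃ v w : Δ.Edge, coneOf {v.1, w.1} ∈ Δ.cones ∧ r = (FreeGroup.of v * FreeGroup.of w) ^ 2} :
    Set (FreeGroup Δ.Edge))

/-- The generator `s_v` of `W(Δ)`. -/
def s (v : Δ.Edge) : Δ.W := PresentedGroup.of v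

lemma s_sq (v : Δ.Edge) : Δ.s v * Δ.s v = 1 := by
  have h := PresentedGroup.one_of_mem (rels := ({r | ∃ v : Δ.Edge, r = FreeGroup.of v ^ 2} ∪
    {r | ∃ v w : Δ.Edge, coneOf {v.1, w.1} ∈ Δ.cones ∧ r = (FreeGroup.of v * FreeGroup.of w) ^ 2} :
    Set (FreeGroup Δ.Edge))) (x := FreeGroup.of v ^ 2) (Or.inl ⟨v, rfl⟩)
  rw [map_pow, sq] at h
  exact h

lemma s_comm {v w : Δ.Edge} (h : coneOf {v.1, w.1} ∈ Δ.cones) : Commute (Δ.s v) (Δ.s w) := by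
  have h := PresentedGroup.one_of_mem (rels := ({r | ∃ v : Δ.Edge, r = FreeGroup.of v ^ 2} ∪
    {r | ∃ v w : Δ.Edge, coneOf {v.1, w.1} ∈ Δ.cones ∧ r = (FreeGroup.of v * FreeGroup.of w) ^ 2} :
    Set (FreeGroup Δ.Edge))) (x := (FreeGroup.of v * FreeGroup.of w) ^ 2) (Or.inr ⟨v, w, h, rfl⟩)
  rw [map_pow, map_mul, sq] at h
  have h' : Δ.s v * Δ.s w * (Δ.s v * Δ.s w) = 1 := h
  have hv : (Δ.s v)⁻¹ = Δ.s v := inv_eq_of_mul_eq_one_left (Δ.s_sq v)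
  have hw : (Δ.s w)⁻¹ = Δ.s w := inv_eq_of_mul_eq_one_left (Δ.s_sq w)
  have h2 := eq_inv_of_mul_eq_one_left h'
  rw [mul_inv_rev, hv, hw] at h2
  exact h2

end SmoothFan

/-- The element `t_v ∈ T₂` given by `t_v(u) = (-1)^⟨u, v⟩`. -/
def tElt (v : N) : T2 N where
  toFun u := (-1) ^ (Multiplicative.toAdd u) v
  map_one' := by simp
  map_mul' u u' := by simp [zpow_add]

lemma tElt_mem {σ : PointedCone ℝ (NR N)} {v : N} (hv : (1 : ℝ) ⊗ₜ[ℤ] v ∈ σ) :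
    tElt v ∈ MulAction.stabilizer (T2 N) (distinguished σ) := by
  rw [mem_stabilizer_distinguished]
  intro u hu
  have h := hu _ hv
  rw [pair_tmul, mul_one] at h
  have h' : u v = 0 := by exact_mod_cast h
  simp [tElt, h']

/-- The homomorphism `{±1} → G` that sends `-1` to an involution `g`. -/
def involutionHom {G : Type*} [Group G] (g : G) (hg : g * g = 1) : ℤˣ →* G where
  toFun a := if a = 1 then 1 else g
  map_one' := by simp
  map_mul' a b := by
    have hn : (-1 : ℤˣ) ≠ 1 := by decide
    rcases Int.units_eq_one_or a with rfl | rfl <;> rcases Int.units_eq_one_or b with rfl | rfl <;>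
      simp [hg, hn]

lemma involutionHom_neg_one {G : Type*} [Group G] (g : G) (hg : g * g = 1) :
    involutionHom g hg (-1) = g := rfl

lemma involutionHom_commute {G : Type*} [Group G] {g g' : G} (hg : g * g = 1) (hg' : g' * g' = 1)
    (h : Commute g g') (x y : ℤˣ) : Commute (involutionHom g hg x) (involutionHom g' hg' y) := by
  rcases Int.units_eq_one_or x with rfl | rfl
  · rw [map_one]
    exact Commute.one_left _
  · rcases Int.units_eq_one_or y with rfl | rfl
    · rw [map_one]
      exact Commute.one_right _
    · exact h

section LocalGroup

variable {ι : Type*} (b : Module.Basis ι ℤ N) (s : Set ι)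

lemma basis_mem (i : s) : (1 : ℝ) ⊗ₜ[ℤ] b i ∈ coneOf (b '' s) :=
  Submodule.subset_span ⟨b i, ⟨i, i.2, rfl⟩, rfl⟩

/-- The coordinates of an element of the stabilizer of the distinguished point. -/
def stabCoord : MulAction.stabilizer (T2 N) (distinguished (coneOf (b '' s))) →* (s → ℤˣ) :=
  MonoidHom.pi fun i => (MonoidHom.eval (Multiplicative.ofAdd (b.coord i))).comp
    (MulAction.stabilizer (T2 N) (distinguished (coneOf (b '' s)))).subtype

lemma stabCoord_apply (t : MulAction.stabilizer (T2 N) (distinguished (coneOf (b '' s)))) (i : s) :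
    stabCoord b s t i = t.1 (Multiplicative.ofAdd (b.coord i)) := rfl

open Classical in
lemma stabCoord_tElt (i : s) :
    stabCoord b s ⟨tElt (b i), tElt_mem (basis_mem b s i)⟩ = Pi.mulSingle i (-1) := by
  funext j
  rw [stabCoord_apply]
  change (-1 : ℤˣ) ^ (b.coord j (b i)) = _
  rw [Module.Basis.coord_apply, Module.Basis.repr_self, Finsupp.single_apply, Pi.mulSingle_apply]
  by_cases h : i = j
  · simp [h]
  · rw [if_neg (fun h' => h (Subtype.ext h')), if_neg (fun h' => h h'.symm), zpow_zero]

lemma stabCoord_injective [Finite ι] : Function.Injective (stabCoord b s) := by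
  classical
  rw [injective_iff_map_eq_one]
  rintro ⟨t, ht⟩ h
  apply Subtype.ext
  have ht' := (mem_stabilizer_distinguished (coneOf (b '' s)) t).1 ht
  have hall : ∀ i, t (Multiplicative.ofAdd (b.coord i)) = 1 := by
    intro i
    by_cases hi : i ∈ s
    · exact congrFun h ⟨i, hi⟩
    · refine ht' _ fun x hx => ?_
      have hp : pair (b.coord i) = (b.baseChange ℝ).coord i := by
        refine (b.baseChange ℝ).ext fun j => ?_
        rw [Module.Basis.coord_apply, Module.Basis.repr_self, Module.Basis.baseChange_apply,
          pair_tmul, Module.Basis.coord_apply, Module.Basis.repr_self, Finsupp.single_apply,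
          Finsupp.single_apply]
        split_ifs <;> simp
      rw [mem_coneOf_basis] at hx
      rw [hp, Module.Basis.coord_apply, (hx i).2 hi]
  have hA : (MonoidHom.toAdditiveRight t).toIntLinearMap = 0 := by
    refine b.dualBasis.ext fun i => ?_
    rw [b.coe_dualBasis]
    exact hall i
  refine MonoidHom.ext fun u => ?_
  exact DFunLike.congr_fun hA (Multiplicative.toAdd u)

lemma exists_stabHom [Finite ι] {G : Type*} [Group G] (w : s → G) (hw : ∀ i, w i * w i = 1)
    (hc : ∀ i j, Commute (w i) (w j)) :
    ∃ f : MulAction.stabilizer (T2 N) (distinguished (coneOf (b '' s))) →* G,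
      ∀ i : s, f ⟨tElt (b i), tElt_mem (basis_mem b s i)⟩ = w i := by
  classical
  have := Fintype.ofFinite s
  have hp : Pairwise fun i j : s => ∀ x y : ℤˣ,
      Commute (involutionHom (w i) (hw i) x) (involutionHom (w j) (hw j) y) :=
    fun i j _ x y => involutionHom_commute _ _ (hc i j) x y
  refine ⟨(MonoidHom.noncommPiCoprod (fun i : s => involutionHom (w i) (hw i)) hp).comp
    (stabCoord b s), fun i => ?_⟩
  rw [MonoidHom.comp_apply, stabCoord_tElt]
  exact (MonoidHom.noncommPiCoprod_mulSingle _ (hcomm := hp) i (-1)).trans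
    (involutionHom_neg_one _ _)

lemma stabHom_ext [Finite ι] {G : Type*} [Group G]
    {f f' : MulAction.stabilizer (T2 N) (distinguished (coneOf (b '' s))) →* G}
    (h : ∀ i : s, f ⟨tElt (b i), tElt_mem (basis_mem b s i)⟩ =
      f' ⟨tElt (b i), tElt_mem (basis_mem b s i)⟩) : f = f' := by
  classical
  have := Fintype.ofFinite s
  refine MonoidHom.ext fun t => ?_
  have hgen : t = ∏ i : s, if stabCoord b s t i = 1 then 1 else
      ⟨tElt (b i), tElt_mem (basis_mem b s i)⟩ := by
    apply stabCoord_injective b s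
    rw [map_prod]
    funext j
    rw [Finset.prod_apply, Finset.prod_eq_single j]
    · rcases Int.units_eq_one_or (stabCoord b s t j) with h | h
      · rw [if_pos h, map_one, Pi.one_apply, h]
      · rw [if_neg (by rw [h]; decide), stabCoord_tElt, Pi.mulSingle_eq_same, h]
    · intro i _ hij
      split_ifs
      · rw [map_one, Pi.one_apply]
      · rw [stabCoord_tElt, Pi.mulSingle_eq_of_ne hij.symm]
    · intro hj
      exact absurd (Finset.mem_univ j) hj
  have hmem : t ∈ MonoidHom.eqLocus f f' := by
    rw [hgen]
    refine Subgroup.prod_mem _ fun i _ => ?_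
    split_ifs
    · exact one_mem _
    · exact h i
  exact hmem

end LocalGroup

namespace SmoothFan

variable (Δ : SmoothFan N)

/-- The element `t_v` of the local group at a cone containing `v`. -/
def tLoc (σ : Δ.Cone) (v : N) (hv : (1 : ℝ) ⊗ₜ[ℤ] v ∈ σ.1) : Δ.cplx.grp σ := ⟨tElt v, tElt_mem hv⟩

/-- The local group at `τ` is generated by the `t_v`, and `t_v ↦ s_v` (for the edges `v` of `τ`)
defines a homomorphism to `W(Δ)`. -/
theorem existsUnique_iota (τ : Δ.Cone) : ∃! f : Δ.cplx.grp τ →* Δ.W,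
    ∀ (v : Δ.Edge) (hv : (1 : ℝ) ⊗ₜ[ℤ] v.1 ∈ τ.1), f (Δ.tLoc τ v.1 hv) = Δ.s v := by
  classical
  obtain ⟨τ, hτ⟩ := τ
  obtain ⟨b, s, rfl⟩ := Δ.smooth τ hτ
  have hedge : ∀ i ∈ s, coneOf {b i} ∈ Δ.cones := fun i hi => by
    refine Δ.face_mem _ hτ _ ?_
    have := isFace_basis b (s' := {i}) (s := s) (by simpa using hi)
    rwa [Set.image_singleton] at this
  have hedge2 : ∀ i ∈ s, ∀ j ∈ s, coneOf {b i, b j} ∈ Δ.cones := fun i hi j hj => by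
    refine Δ.face_mem _ hτ _ ?_
    have := isFace_basis b (s' := {i, j}) (s := s) (by
      rintro k (rfl | rfl)
      · exact hi
      · exact hj)
    rwa [Set.image_pair] at this
  let e : s → Δ.Edge := fun i => ⟨b i, isPrimitive_basis b i, hedge i i.2⟩
  have hedges : ∀ v : Δ.Edge, (1 : ℝ) ⊗ₜ[ℤ] v.1 ∈ coneOf (b '' s) → ∃ i : s, v = e i := by
    intro v hv
    have hf := (Δ.inter_face _ v.2.2 _ hτ).2
    have hle : coneOf {v.1} ≤ coneOf (b '' s) := by
      refine Submodule.span_le.2 ?_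
      rintro _ ⟨w, rfl, rfl⟩
      exact hv
    rw [inf_eq_left.2 hle] at hf
    obtain ⟨i, hi, h⟩ := exists_eq_basis b v.2.1 hf
    exact ⟨⟨i, hi⟩, Subtype.ext h⟩
  obtain ⟨f, hf⟩ := exists_stabHom b s (fun i => Δ.s (e i)) (fun i => Δ.s_sq (e i))
    (fun i j => Δ.s_comm (hedge2 i i.2 j j.2))
  refine ⟨f, ?_, ?_⟩
  · intro v hv
    obtain ⟨i, rfl⟩ := hedges v hv
    exact hf i
  · intro f' hf'
    refine stabHom_ext b s fun i => ?_
    exact (hf' (e i) (basis_mem b s i)).trans (hf i).symm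

/-- The canonical simple morphism `ι : G(Δ) → W(Δ)`, which sends `t_v` to `s_v`. -/
def iota : SimpleMorphism Δ.cplx Δ.W where
  hom τ := (Δ.existsUnique_iota τ).choose
  compat {τ σ} h g := by
    have h1 := (Δ.existsUnique_iota τ).choose_spec.2
      ((Δ.existsUnique_iota σ).choose.comp (Δ.cplx.map h))
      (fun v hv => (Δ.existsUnique_iota σ).choose_spec.1 v (h hv))
    exact DFunLike.congr_fun h1 g

/-- The homomorphism `β̂ : W(Δ) → G` induced by a simple morphism `β : G(Δ) → G`: it sends `s_v` to
the value of `β` at `t_v`. -/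
def hat {G : Type*} [Group G] (β : SimpleMorphism Δ.cplx G) : Δ.W →* G :=
  PresentedGroup.toGroup (f := fun v : Δ.Edge => β.hom ⟨coneOf {v.1}, v.2.2⟩
    (Δ.tLoc ⟨coneOf {v.1}, v.2.2⟩ v.1 (Submodule.subset_span ⟨v.1, rfl, rfl⟩))) (by
    have hsq : ∀ (σ : Δ.Cone) (t : Δ.cplx.grp σ), t * t = 1 := by
      intro σ t
      apply Subtype.ext
      exact MonoidHom.ext fun u => Int.units_mul_self _
    rintro r (⟨v, rfl⟩ | ⟨v, w, hvw, rfl⟩)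
    · rw [map_pow, FreeGroup.lift_apply_of, sq, ← map_mul, hsq, map_one]
    · have hv : coneOf {v.1} ≤ coneOf {v.1, w.1} :=
        Submodule.span_mono (Set.image_mono (by simp))
      have hw : coneOf {w.1} ≤ coneOf {v.1, w.1} :=
        Submodule.span_mono (Set.image_mono (by simp))
      rw [map_pow, map_mul, FreeGroup.lift_apply_of, FreeGroup.lift_apply_of, sq]
      rw [← β.compat (p := ⟨coneOf {v.1}, v.2.2⟩) (q := ⟨_, hvw⟩) hv,
        ← β.compat (p := ⟨coneOf {w.1}, w.2.2⟩) (q := ⟨_, hvw⟩) hw, ← map_mul, ← map_mul, hsq,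
        map_one])

open Classical in
/-- The homomorphism `h : W(Δ) → ℤ₂^d` that sends `s_v` to the basis vector of `v`. -/
def h : Δ.W →* (Δ.Edge → ℤˣ) :=
  PresentedGroup.toGroup (f := fun v : Δ.Edge => Pi.mulSingle v (-1)) (by
    have hsq : ∀ x : Δ.Edge → ℤˣ, x ^ 2 = 1 := fun x => by
      ext v
      simp [sq]
    rintro r (⟨v, rfl⟩ | ⟨v, w, hvw, rfl⟩)
    · rw [map_pow, hsq]
    · rw [map_pow, hsq])

/-- The simple morphism `α = h ∘ ι : G(Δ) → ℤ₂^d`. -/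
def alpha : SimpleMorphism Δ.cplx (Δ.Edge → ℤˣ) := Δ.iota.comp Δ.h

/-! ## The spaces `G × X₊ / ∼` -/

/-- `(g, x) ∼ (g', x')` iff `x = x'` and `g⁻¹ g' ∈ G_τ`, where `τ` is the cone with
`x ∈ (O_τ)₊`. -/
def glueSetoid {G : Type*} [Group G] (β : SimpleMorphism Δ.cplx G) : Setoid (G × Δ.XPos) where
  r a b := a.2 = b.2 ∧ ∀ τ, (a.2 : Δ.X) ∈ Δ.orbitPos τ → a.1⁻¹ * b.1 ∈ (β.hom τ).range
  iseqv :=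
    { refl := fun a => ⟨rfl, fun q _ => by simp [one_mem]⟩
      symm := by
        rintro ⟨g, y⟩ ⟨g', y'⟩ ⟨h, hq⟩
        dsimp only at h hq ⊢
        subst h
        exact ⟨rfl, fun q hs => by simpa using inv_mem (hq q hs)⟩
      trans := by
        rintro ⟨g, y⟩ ⟨g', y'⟩ ⟨g'', y''⟩ ⟨h, hq⟩ ⟨h', hq'⟩
        dsimp only at h hq h' hq' ⊢
        subst h
        subst h'
        exact ⟨rfl, fun q hs => by
          simpa [mul_assoc] using mul_mem (hq q hs) (hq' q hs)⟩ }

/-- The space `G × X₊ / ∼`. -/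
def Glue {G : Type*} [Group G] (β : SimpleMorphism Δ.cplx G) : Type _ := Quotient (Δ.glueSetoid β)

/-- The class of `(g, x)` in `G × X₊ / ∼`. -/
def Glue.mk {G : Type*} [Group G] (β : SimpleMorphism Δ.cplx G) (g : G) (x : Δ.XPos) : Δ.Glue β :=
  Quotient.mk (Δ.glueSetoid β) (g, x)

/-- The quotient topology of `G × X₊`, where `G` is discrete. -/
instance {G : Type*} [Group G] (β : SimpleMorphism Δ.cplx G) : TopologicalSpace (Δ.Glue β) :=
  letI : TopologicalSpace G := ⊥
  inferInstanceAs (TopologicalSpace (Quotient (Δ.glueSetoid β)))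

/-- The development `D(X₊, β)`. -/
abbrev D {G : Type*} [Group G] (β : SimpleMorphism Δ.cplx G) : Type _ := Development Δ.VPos β

/-- `X̃ = W × X₊ / ∼`. -/
abbrev XTilde : Type _ := Δ.Glue Δ.iota

end SmoothFan

end RealToric

end

open RealToric

/-!
The proof works in coordinates for a basis of the lattice `N` that contains the generators of a
cone `σ`: the chart `U_σ` becomes `ℝˢ × (ℝ*)ⁿ⁻ˢ` (`chartHomeo`), the points of `(O_τ)₊` are the
nonnegative ones whose vanishing coordinates are those of `τ`, and `V(τ)₊` is the union of the
`(O_σ)₊` with `τ ≤ σ` (`SmoothFan.mem_VPos_iff`). Every point of `X` is a sign change of exactly one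
point of `X₊`, and its stabilizer in `T₂` is the local group of its cone. This gives
`T₂ × X₊/∼ ≅ X` (`SmoothFan.gluePhi`). Since `V({0})₊ = X₊`, the developments carry the quotient
topology of `G × X₊` (`SmoothFan.Development.homeoGlue`).

A homomorphism `f : G → K` that carries a simple morphism `β` to `β'` induces a map
`G × X₊/∼ → K × X₊/∼` whose fibres are the orbits of `ker f`. If `β'` is injective on the local
groups, this action is free and properly discontinuous, and the image is open and closed, so that
the map is a covering map (`SmoothFan.Glue.isQuotientCoveringMap_map`,
`SmoothFan.Glue.isCoveringMap_map`). Every simple morphism `β` factors through `ι` by `β̂`, so that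
`X̃` covers a union of components of every such development, with group `ker β̂`.

The space `X̃` is simply connected (`SmoothFan.simplyConnectedSpace_XTilde`). It is covered by the
translates of the sets `W_σ (U_σ)₊`, which are homeomorphic to convex sets and contain the base
point `[1, 1]`. Choosing in them paths from the base point to its images under the generators
`s_v`, one obtains an action of `W` on the homotopy classes of paths that start at the base point:
the relations of `W` hold since they can be checked inside the simply connected sets
`W_σ (U_σ)₊`. Translating the radial paths by this action gives a choice of a class of
paths to every point, compatible with all short paths, and such a choice forces simple
connectedness (`simplyConnectedSpace_of_section`).

Hence `π₁ = ker β̂` for every development (`SmoothFan.Glue.nonempty_fundamentalGroup_mulEquiv`),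
and a development is connected iff `β̂` is surjective (`SmoothFan.Glue.connectedSpace_iff`). For
`φ` the latter is a statement about the span of the `v ⊗ 1` in `N ⊗ ℤ₂ ≅ T₂`. Since `T₂` is
abelian, `φ` factors through the abelianisation `h` of `W` by some `f : ℤ₂^d → T₂`, whose kernel is
the group of deck transformations of `D(X₊, α) → X` (`nonempty_mulEquiv_deckGroup`).
-/

noncomputable section

namespace RealToric

open Topology

variable {N : Type*} [AddCommGroup N]

/-! ### Smooth cones and their charts in coordinates -/

section Coordinates

variable {ι : Type*} [Fintype ι] (b : Module.Basis ι ℤ N) {s s' : Set ι}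

lemma pair_eq_sum (u : M N) (x : NR N) :
    pair u x = ∑ i, (b.baseChange ℝ).repr x i * (u (b i) : ℝ) := by
  conv_lhs => rw [← (b.baseChange ℝ).sum_repr x]
  simp [Module.Basis.baseChange_apply, pair_tmul]

lemma mem_dualSemigroup_iff (u : M N) :
    u ∈ dualSemigroup (coneOf (b '' s)) ↔ ∀ i ∈ s, 0 ≤ u (b i) := by
  constructor
  · intro h i hi
    have := h _ (basis_mem b s ⟨i, hi⟩)
    rw [pair_tmul, mul_one] at this
    exact_mod_cast this
  · intro h x hx
    rw [mem_coneOf_basis] at hx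
    rw [pair_eq_sum b]
    refine Finset.sum_nonneg fun i _ => ?_
    by_cases hi : i ∈ s
    · exact mul_nonneg (hx i).1 (by exact_mod_cast h i hi)
    · rw [(hx i).2 hi, zero_mul]

lemma pair_eq_zero_iff (u : M N) :
    (∀ v ∈ coneOf (b '' s), pair u v = 0) ↔ ∀ i ∈ s, u (b i) = 0 := by
  constructor
  · intro h i hi
    have := h _ (basis_mem b s ⟨i, hi⟩)
    rw [pair_tmul, mul_one] at this
    exact_mod_cast this
  · intro h x hx
    rw [mem_coneOf_basis] at hx
    rw [pair_eq_sum b]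
    refine Finset.sum_eq_zero fun i _ => ?_
    by_cases hi : i ∈ s
    · rw [h i hi, Int.cast_zero, mul_zero]
    · rw [(hx i).2 hi, zero_mul]

lemma coneOf_le_iff : coneOf (b '' s') ≤ coneOf (b '' s) ↔ s' ⊆ s := by
  constructor
  · intro h i hi
    by_contra his
    have h1 := ((mem_coneOf_basis b s _).1 (h (basis_mem b s' ⟨i, hi⟩)) i).2 his
    simp [Module.Basis.baseChange_repr_tmul] at h1
  · intro h
    exact Submodule.span_mono (Set.image_mono (Set.image_mono h))

lemma coneOf_inf : coneOf (b '' s) ⊓ coneOf (b '' s') = coneOf (b '' (s ∩ s')) := by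
  ext x
  simp only [Submodule.mem_inf, mem_coneOf_basis, Set.mem_inter_iff, not_and_or]
  constructor
  · rintro ⟨h, h'⟩ i
    exact ⟨(h i).1, fun hi => hi.elim (h i).2 (h' i).2⟩
  · intro h
    exact ⟨fun i => ⟨(h i).1, fun hi => (h i).2 (Or.inl hi)⟩,
      fun i => ⟨(h i).1, fun hi => (h i).2 (Or.inr hi)⟩⟩

/-- The faces of a smooth cone are spanned by subsets of its generators. -/
lemma exists_subset_of_isFace {τ : PointedCone ℝ (NR N)} (h : IsFace τ (coneOf (b '' s))) :
    ∃ s' ⊆ s, τ = coneOf (b '' s') := by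
  obtain ⟨u, hu, hτ⟩ := h
  refine ⟨{i ∈ s | u ((1 : ℝ) ⊗ₜ[ℤ] b i) = 0}, fun i hi => hi.1, ?_⟩
  ext x
  rw [hτ]
  have hsum : u x = ∑ i, (b.baseChange ℝ).repr x i * u ((1 : ℝ) ⊗ₜ[ℤ] b i) := by
    conv_lhs => rw [← (b.baseChange ℝ).sum_repr x]
    simp [Module.Basis.baseChange_apply]
  have hpos : x ∈ coneOf (b '' s) →
      ∀ i ∈ Finset.univ, 0 ≤ (b.baseChange ℝ).repr x i * u ((1 : ℝ) ⊗ₜ[ℤ] b i) := by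
    intro hx i _
    rw [mem_coneOf_basis] at hx
    by_cases hi : i ∈ s
    · exact mul_nonneg (hx i).1 (hu _ (basis_mem b s ⟨i, hi⟩))
    · rw [(hx i).2 hi, zero_mul]
  constructor
  · rintro ⟨hx, h0⟩
    rw [hsum, Finset.sum_eq_zero_iff_of_nonneg (hpos hx)] at h0
    rw [mem_coneOf_basis] at hx ⊢
    refine fun i => ⟨(hx i).1, fun hi => ?_⟩
    by_cases his : i ∈ s
    · exact (mul_eq_zero.1 (h0 i (Finset.mem_univ i))).resolve_right fun h => hi ⟨his, h⟩
    · exact (hx i).2 his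
  · intro hx
    refine ⟨(coneOf_le_iff b).2 (fun i hi => hi.1) hx, ?_⟩
    rw [mem_coneOf_basis] at hx
    rw [hsum]
    refine Finset.sum_eq_zero fun i _ => ?_
    by_cases hi : i ∈ s ∧ u ((1 : ℝ) ⊗ₜ[ℤ] b i) = 0
    · rw [hi.2, mul_zero]
    · rw [(hx i).2 hi, zero_mul]

lemma coord_mem_dualSemigroup (i : ι) : b.coord i ∈ dualSemigroup (coneOf (b '' s)) := by
  classical
  rw [mem_dualSemigroup_iff]
  intro j _
  rw [Module.Basis.coord_apply, Module.Basis.repr_self, Finsupp.single_apply]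
  split_ifs <;> simp

/-- The `i`-th coordinate `x(bᵢ*)` of a point of the chart of a smooth cone. -/
def Chart.coord (x : Chart (coneOf (b '' s))) (i : ι) : ℝ :=
  x.1 ⟨b.coord i, coord_mem_dualSemigroup b i⟩

lemma Chart.map_neg_mul {σ : PointedCone ℝ (NR N)} (x : Chart σ) {u : M N}
    (h : u ∈ dualSemigroup σ) (h' : -u ∈ dualSemigroup σ) : x.1 ⟨-u, h'⟩ * x.1 ⟨u, h⟩ = 1 := by
  rw [← x.2.2]
  exact (congrArg x.1 (Subtype.ext (neg_add_cancel u))).trans x.2.1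

/-- A point of a chart, as a homomorphism of monoids. -/
def Chart.toMonoidHom {σ : PointedCone ℝ (NR N)} (x : Chart σ) :
    Multiplicative (dualSemigroup σ) →* ℝ where
  toFun u := x.1 u.toAdd
  map_one' := x.2.1
  map_mul' u v := x.2.2 u.toAdd v.toAdd

lemma Chart.coord_ne_zero (x : Chart (coneOf (b '' s))) {i : ι} (hi : i ∉ s) :
    x.coord b i ≠ 0 := by
  classical
  have h' : -b.coord i ∈ dualSemigroup (coneOf (b '' s)) := by
    rw [mem_dualSemigroup_iff]
    intro j hj
    have hij : j ≠ i := by rintro rfl; exact hi hj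
    simp [hij]
  exact right_ne_zero_of_mul_eq_one (x.map_neg_mul (coord_mem_dualSemigroup b i) h')

/-- A point of a chart is determined by its coordinates: `x(u) = ∏ᵢ zᵢ ^ ⟨u, bᵢ⟩`. -/
lemma Chart.apply_eq_prod (x : Chart (coneOf (b '' s))) (u : dualSemigroup (coneOf (b '' s))) :
    x.1 u = ∏ i, x.coord b i ^ (u.1 (b i)) := by
  classical
  have hu := (mem_dualSemigroup_iff b u.1).1 u.2
  have hmem : ∀ i, u.1 (b i) • b.coord i ∈ dualSemigroup (coneOf (b '' s)) := by
    intro i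
    rw [mem_dualSemigroup_iff]
    intro j hj
    rw [LinearMap.smul_apply, Module.Basis.coord_apply, Module.Basis.repr_self,
      Finsupp.single_apply]
    split_ifs with h
    · simpa [← h] using hu j hj
    · simp
  have hterm : ∀ i, x.1 ⟨_, hmem i⟩ = x.coord b i ^ (u.1 (b i)) := by
    intro i
    have hnat : ∀ (n : ℕ) (h : (n : ℤ) • b.coord i ∈ dualSemigroup (coneOf (b '' s))),
        x.1 ⟨(n : ℤ) • b.coord i, h⟩ = x.coord b i ^ n := by
      intro n h
      have := map_pow x.toMonoidHom
        (Multiplicative.ofAdd ⟨b.coord i, coord_mem_dualSemigroup b i⟩) n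
      refine Eq.trans ?_ this
      exact congrArg x.1 (Subtype.ext (by simp [← ofAdd_nsmul]))
    have key : ∀ (k : ℤ) (h : k • b.coord i ∈ dualSemigroup (coneOf (b '' s)))
        (hk : i ∈ s → 0 ≤ k), x.1 ⟨k • b.coord i, h⟩ = x.coord b i ^ k := by
      intro k h hk
      obtain ⟨n, rfl | rfl⟩ := k.eq_nat_or_neg
      · rw [hnat, zpow_natCast]
      · by_cases hi : i ∈ s
        · have := hk hi
          have hn : n = 0 := by omega
          subst hn
          simpa using hnat 0 (by simp)
        · have h2 : (n : ℤ) • b.coord i ∈ dualSemigroup (coneOf (b '' s)) :=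
            by simpa using nsmul_mem (coord_mem_dualSemigroup b (s := s) i) n
          have h3 : -((n : ℤ) • b.coord i) ∈ dualSemigroup (coneOf (b '' s)) := by
            simpa using h
          have h4 := x.map_neg_mul h2 h3
          rw [hnat] at h4
          rw [zpow_neg, zpow_natCast]
          refine Eq.trans ?_ (eq_inv_of_mul_eq_one_left h4)
          exact congrArg x.1 (Subtype.ext (by simp))
    exact key _ _ (fun hi => hu i hi)
  have hsum : u = ∑ i, (⟨_, hmem i⟩ : dualSemigroup (coneOf (b '' s))) := by
    apply Subtype.ext
    rw [AddSubmonoid.coe_finsetSum]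
    refine b.ext fun j => ?_
    simp
  have hprod := map_prod x.toMonoidHom
    (fun i => Multiplicative.ofAdd (⟨_, hmem i⟩ : dualSemigroup (coneOf (b '' s)))) Finset.univ
  rw [← Finset.prod_congr rfl fun i _ => hterm i]
  refine Eq.trans ?_ hprod
  conv_lhs => rw [hsum]
  exact congrArg x.1 (by rw [← ofAdd_sum]; rfl)

lemma Chart.ext_coord {x y : Chart (coneOf (b '' s))} (h : ∀ i, x.coord b i = y.coord b i) :
    x = y := by
  refine Subtype.ext (funext fun u => ?_)
  rw [x.apply_eq_prod b, y.apply_eq_prod b]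
  simp only [h]

/-- The point of the chart of a smooth cone with given coordinates. -/
def Chart.ofCoord (z : ι → ℝ) (hz : ∀ i ∉ s, z i ≠ 0) : Chart (coneOf (b '' s)) :=
  ⟨fun u => ∏ i, z i ^ (u.1 (b i)), by simp, by
    intro u v
    rw [← Finset.prod_mul_distrib]
    refine Finset.prod_congr rfl fun i _ => ?_
    rw [AddSubmonoid.coe_add, LinearMap.add_apply]
    refine zpow_add' ?_
    by_cases hi : i ∈ s
    · have h1 := (mem_dualSemigroup_iff b u.1).1 u.2 i hi
      have h2 := (mem_dualSemigroup_iff b v.1).1 v.2 i hi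
      right
      omega
    · exact Or.inl (hz i hi)⟩

@[simp] lemma Chart.coord_ofCoord (z : ι → ℝ) (hz : ∀ i ∉ s, z i ≠ 0) (i : ι) :
    (Chart.ofCoord b z hz).coord b i = z i := by
  classical
  change ∏ j, z j ^ (b.coord i (b j)) = z i
  rw [Finset.prod_eq_single i]
  · simp
  · intro j _ hij
    simp [hij]
  · simp

lemma Chart.continuous_coord (i : ι) :
    Continuous fun x : Chart (coneOf (b '' s)) => x.coord b i :=
  (continuous_apply _).comp continuous_subtype_val

/-- The chart of a smooth cone is `ℝˢ × (ℝ*)ⁿ⁻ˢ`. -/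
def chartHomeo (s : Set ι) : Chart (coneOf (b '' s)) ≃ₜ {z : ι → ℝ // ∀ i ∉ s, z i ≠ 0} where
  toFun x := ⟨x.coord b, fun _ hi => x.coord_ne_zero b hi⟩
  invFun z := Chart.ofCoord b z.1 z.2
  left_inv x := Chart.ext_coord b fun i => by simp
  right_inv z := Subtype.ext (funext fun i => by simp)
  continuous_toFun := Continuous.subtype_mk
    (continuous_pi fun i => Chart.continuous_coord b i) _
  continuous_invFun := by
    refine Continuous.subtype_mk (continuous_pi fun u => continuous_finsetProd _ fun i _ => ?_) _
    have hc : Continuous fun z : {z : ι → ℝ // ∀ i ∉ s, z i ≠ 0} => z.1 i :=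
      (continuous_apply i).comp continuous_subtype_val
    refine continuous_iff_continuousAt.2 fun z => hc.continuousAt.zpow₀ _ ?_
    by_cases hi : i ∈ s
    · exact Or.inr ((mem_dualSemigroup_iff b u.1).1 u.2 i hi)
    · exact Or.inl (z.2 i hi)

@[simp] lemma chartHomeo_apply (x : Chart (coneOf (b '' s))) (i : ι) :
    (chartHomeo b s x).1 i = x.coord b i := rfl

lemma Chart.nonneg_iff (x : Chart (coneOf (b '' s))) :
    (∀ u, 0 ≤ x.1 u) ↔ ∀ i, 0 ≤ x.coord b i := by
  refine ⟨fun h i => h _, fun h u => ?_⟩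
  rw [x.apply_eq_prod b]
  exact Finset.prod_nonneg fun i _ => zpow_nonneg (h i) _

lemma Chart.pos_iff (x : Chart (coneOf (b '' s))) :
    (∀ u : dualSemigroup (coneOf (b '' s)), (∀ v ∈ coneOf (b '' s), pair u.1 v = 0) → 0 < x.1 u) ↔
      ∀ i ∉ s, 0 < x.coord b i := by
  classical
  constructor
  · intro h i hi
    refine h _ ((pair_eq_zero_iff b _).2 fun j hj => ?_)
    have hij : j ≠ i := by rintro rfl; exact hi hj
    simp [hij]
  · intro h u hu
    rw [pair_eq_zero_iff] at hu
    rw [x.apply_eq_prod b]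
    refine Finset.prod_pos fun i _ => ?_
    by_cases hi : i ∈ s
    · simp [hu i hi]
    · exact zpow_pos (h i hi) _

/-- The points of the orbit of the distinguished point are those with `zᵢ = 0` for the generators
of the cone. -/
lemma Chart.apply_of_coord_eq_zero (x : Chart (coneOf (b '' s))) (hx : ∀ i ∈ s, x.coord b i = 0)
    (u : dualSemigroup (coneOf (b '' s))) :
    x.1 u ≠ 0 ↔ ∀ v ∈ coneOf (b '' s), pair u.1 v = 0 := by
  rw [pair_eq_zero_iff, x.apply_eq_prod b, Finset.prod_ne_zero_iff]
  constructor
  · intro h i hi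
    by_contra h0
    exact h i (Finset.mem_univ i) (by rw [hx i hi, zero_zpow _ h0])
  · intro h i _
    by_cases hi : i ∈ s
    · simp [h i hi]
    · exact zpow_ne_zero _ (x.coord_ne_zero b hi)

@[simp] lemma Chart.coord_res (h : coneOf (b '' s') ≤ coneOf (b '' s))
    (x : Chart (coneOf (b '' s'))) (i : ι) : (Chart.res h x).coord b i = x.coord b i := rfl

@[simp] lemma Chart.coord_smul (t : TR N) (x : Chart (coneOf (b '' s))) (i : ι) :
    (t • x).coord b i = t (Multiplicative.ofAdd (b.coord i)) * x.coord b i := rfl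

lemma Chart.mem_range_res (h : coneOf (b '' s') ≤ coneOf (b '' s)) (x : Chart (coneOf (b '' s))) :
    x ∈ Set.range (Chart.res h) ↔ ∀ i ∉ s', x.coord b i ≠ 0 := by
  constructor
  · rintro ⟨y, rfl⟩ i hi
    exact y.coord_ne_zero b hi
  · intro hx
    exact ⟨Chart.ofCoord b (x.coord b) hx, Chart.ext_coord b fun i => by simp⟩

lemma Chart.continuous_res {τ σ : PointedCone ℝ (NR N)} (h : τ ≤ σ) :
    Continuous (Chart.res h) := by
  refine continuous_induced_rng.2 (continuous_pi fun u => ?_)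
  exact (continuous_apply (⟨u.1, fun v hv => u.2 v (h hv)⟩ : dualSemigroup τ)).comp
    continuous_subtype_val

lemma Chart.isOpenMap_res (h : coneOf (b '' s') ≤ coneOf (b '' s)) :
    IsOpenMap (Chart.res h) := by
  have hs : s' ⊆ s := (coneOf_le_iff b).1 h
  have hsub : {z : ι → ℝ | ∀ i ∉ s, z i ≠ 0} ⊇ {z : ι → ℝ | ∀ i ∉ s', z i ≠ 0} :=
    fun z hz i hi => hz i fun hi' => hi (hs hi')
  have hopen : IsOpen {z : ι → ℝ | ∀ i ∉ s', z i ≠ 0} := by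
    simp only [Set.ofPred_forall]
    exact isOpen_iInter_of_finite fun i => isOpen_iInter_of_finite fun _ =>
      isOpen_ne_fun (continuous_apply i) continuous_const
  have e : Chart.res h = (chartHomeo b s).symm ∘ Set.inclusion hsub ∘ chartHomeo b s' := by
    funext x
    rw [Function.comp_apply, ← (chartHomeo b s).eq_symm_apply.symm]
    rfl
  rw [e]
  exact (chartHomeo b s).symm.isOpenMap.comp
    ((hopen.isOpenMap_inclusion hsub).comp (chartHomeo b s').isOpenMap)

/-- The element of `Hom(M, G)` with given values on the dual basis. -/
def homOfCoord {G : Type*} [CommGroup G] (g : ι → G) : Multiplicative (M N) →* G where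
  toFun u := ∏ i, g i ^ (u.toAdd (b i))
  map_one' := by simp
  map_mul' u v := by simp [zpow_add, Finset.prod_mul_distrib]

lemma homOfCoord_apply {G : Type*} [CommGroup G] (g : ι → G) (u : M N) :
    homOfCoord b g (Multiplicative.ofAdd u) = ∏ i, g i ^ (u (b i)) := rfl

@[simp] lemma homOfCoord_coord {G : Type*} [CommGroup G] (g : ι → G) (i : ι) :
    homOfCoord b g (Multiplicative.ofAdd (b.coord i)) = g i := by
  classical
  change ∏ j, g j ^ (b.coord i (b j)) = g i
  rw [Finset.prod_eq_single i]
  · simp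
  · intro j _ hij
    simp [hij]
  · simp

/-- The coordinates `T₂ ≅ {±1}^n` for a basis of the lattice. -/
def T2.coordEquiv : T2 N ≃* (ι → ℤˣ) where
  toFun t i := t (Multiplicative.ofAdd (b.coord i))
  invFun := homOfCoord b
  left_inv t := by
    classical
    have e : (MonoidHom.toAdditiveRight (homOfCoord b fun i =>
        t (Multiplicative.ofAdd (b.coord i)))).toIntLinearMap =
        (MonoidHom.toAdditiveRight t).toIntLinearMap := by
      refine b.dualBasis.ext fun i => ?_
      rw [b.coe_dualBasis]
      exact homOfCoord_coord b (fun i => t (Multiplicative.ofAdd (b.coord i))) i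
    exact MonoidHom.ext fun u => DFunLike.congr_fun e u.toAdd
  right_inv g := funext fun i => homOfCoord_coord b g i
  map_mul' _ _ := rfl

end Coordinates

/-! ### Cones of the fan -/

namespace SmoothFan

variable (Δ : SmoothFan N)

instance : Finite Δ.Cone := Δ.finite

/-- The intersection of two cones of the fan. -/
def inf (σ τ : Δ.Cone) : Δ.Cone := ⟨σ.1 ⊓ τ.1, Δ.face_mem _ σ.2 _ (Δ.inter_face _ σ.2 _ τ.2).1⟩

lemma inf_le_left (σ τ : Δ.Cone) : Δ.inf σ τ ≤ σ := fun _ h => h.1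

lemma inf_le_right (σ τ : Δ.Cone) : Δ.inf σ τ ≤ τ := fun _ h => h.2

variable {Δ}

lemma exists_subset_of_le {ι : Type*} [Fintype ι] {b : Module.Basis ι ℤ N} {s : Set ι}
    (hσ : coneOf (b '' s) ∈ Δ.cones) {τ : PointedCone ℝ (NR N)} (hτ : τ ∈ Δ.cones)
    (h : τ ≤ coneOf (b '' s)) : ∃ s' ⊆ s, τ = coneOf (b '' s') := by
  have := (Δ.inter_face _ hσ _ hτ).1
  rw [inf_eq_right.2 h] at this
  exact exists_subset_of_isFace b this

variable (Δ) in
lemma exists_coneOf_empty_mem : coneOf (∅ : Set N) ∈ Δ.cones := by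
  obtain ⟨σ, hσ⟩ := Δ.nonempty
  obtain ⟨b, s, rfl⟩ := Δ.smooth σ hσ
  have := isFace_basis b (Set.empty_subset s)
  rw [Set.image_empty] at this
  exact Δ.face_mem _ hσ _ this

lemma coneOf_empty_le (σ : PointedCone ℝ (NR N)) : coneOf (∅ : Set N) ≤ σ := by
  simp [coneOf]

/-! ### The charts of the real toric variety -/

lemma toX_res {τ σ : Δ.Cone} (h : τ ≤ σ) (x : Chart τ.1) :
    Δ.toX σ (Chart.res h x) = Δ.toX τ x :=
  (Quot.sound ⟨h, rfl⟩).symm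

/-- Two chart points are glued iff they come from a common smaller chart. This relation is
transitive because the charts of two faces `τ`, `τ'` of a cone meet in the chart of `τ ∩ τ'`. -/
lemma toX_eq_iff {σ σ' : Δ.Cone} {x : Chart σ.1} {x' : Chart σ'.1} :
    Δ.toX σ x = Δ.toX σ' x' ↔ ∃ (τ : Δ.Cone) (h : τ ≤ σ) (h' : τ ≤ σ') (y : Chart τ.1),
      Chart.res h y = x ∧ Chart.res h' y = x' := by
  constructor
  · intro h
    have h := Quot.eqvGen_exact h
    suffices H : ∀ a c : Σ σ : Δ.Cone, Chart σ.1, Relation.EqvGen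
        (fun a b : Σ σ : Δ.Cone, Chart σ.1 => ∃ h : a.1 ≤ b.1, b.2 = Chart.res h a.2) a c →
        ∃ (τ : Δ.Cone) (h : τ ≤ a.1) (h' : τ ≤ c.1) (y : Chart τ.1),
          Chart.res h y = a.2 ∧ Chart.res h' y = c.2 from H ⟨σ, x⟩ ⟨σ', x'⟩ h
    intro a c hac
    induction hac with
    | rel a c h =>
      obtain ⟨h, e⟩ := h
      exact ⟨a.1, le_rfl, h, a.2, rfl, e.symm⟩
    | refl a => exact ⟨a.1, le_rfl, le_rfl, a.2, rfl, rfl⟩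
    | symm a c _ ih =>
      obtain ⟨τ, h, h', y, e, e'⟩ := ih
      exact ⟨τ, h', h, y, e', e⟩
    | trans a c d _ _ ih ih' =>
      obtain ⟨τ, h₁, h₂, y, e₁, e₂⟩ := ih
      obtain ⟨τ', h₁', h₂', y', e₁', e₂'⟩ := ih'
      suffices H : ∃ z : Chart (Δ.inf τ τ').1, Chart.res (Δ.inf_le_left τ τ') z = y ∧
          Chart.res (Δ.inf_le_right τ τ') z = y' by
        obtain ⟨z, rfl, rfl⟩ := H
        exact ⟨Δ.inf τ τ', (Δ.inf_le_left τ τ').trans h₁, (Δ.inf_le_right τ τ').trans h₂', z,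
          e₁, e₂'⟩
      have e := e₂.trans e₁'.symm
      clear e₁ e₂ e₁' e₂'
      obtain ⟨⟨σ, hσ⟩, w⟩ := c
      obtain ⟨τ, hτ⟩ := τ
      obtain ⟨τ', hτ'⟩ := τ'
      obtain ⟨b, s, rfl⟩ := Δ.smooth σ hσ
      obtain ⟨s₁, hs₁, rfl⟩ := exists_subset_of_le hσ hτ h₂
      obtain ⟨s₂, hs₂, rfl⟩ := exists_subset_of_le hσ hτ' h₁'
      have hc : ∀ i, y.coord b i = y'.coord b i := fun i => congrArg (fun w => w.coord b i) e
      have hinf : coneOf (b '' s₁) ⊓ coneOf (b '' s₂) = coneOf (b '' (s₁ ∩ s₂)) := coneOf_inf b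
      have hz : ∃ z : Chart (coneOf (b '' s₁) ⊓ coneOf (b '' s₂)),
          ∀ (h₁ : coneOf (b '' s₁) ⊓ coneOf (b '' s₂) ≤ coneOf (b '' s₁))
            (h₂ : coneOf (b '' s₁) ⊓ coneOf (b '' s₂) ≤ coneOf (b '' s₂)),
            Chart.res h₁ z = y ∧ Chart.res h₂ z = y' := by
        rw [hinf]
        refine ⟨Chart.ofCoord b (y.coord b) fun i hi => ?_, fun h₁ h₂ => ⟨?_, ?_⟩⟩
        · by_cases h : i ∈ s₁
          · rw [hc]
            exact y'.coord_ne_zero b fun h' => hi ⟨h, h'⟩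
          · exact y.coord_ne_zero b h
        · exact Chart.ext_coord b fun i => by simp
        · exact Chart.ext_coord b fun i => by simp [hc]
      obtain ⟨z, hz⟩ := hz
      exact ⟨z, hz _ _⟩
  · rintro ⟨τ, h, h', y, rfl, rfl⟩
    rw [toX_res, toX_res]

lemma toX_injective (σ : Δ.Cone) : Function.Injective (Δ.toX σ) := by
  intro x x' h
  obtain ⟨τ, h, h', y, rfl, rfl⟩ := toX_eq_iff.1 h
  rfl

lemma exists_toX (p : Δ.X) : ∃ (σ : Δ.Cone) (x : Chart σ.1), p = Δ.toX σ x := by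
  obtain ⟨σ, x⟩ := p
  exact ⟨σ, x, rfl⟩

lemma continuous_toX (σ : Δ.Cone) : Continuous (Δ.toX σ) :=
  continuous_quot_mk.comp continuous_sigmaMk

lemma isOpen_X_iff {A : Set Δ.X} : IsOpen A ↔ ∀ σ, IsOpen (Δ.toX σ ⁻¹' A) := by
  refine ⟨fun h σ => h.preimage (continuous_toX σ), fun h => ?_⟩
  exact isOpen_coinduced.2 (isOpen_sigma_iff.2 h)

lemma isClosed_X_iff {A : Set Δ.X} : IsClosed A ↔ ∀ σ, IsClosed (Δ.toX σ ⁻¹' A) := by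
  simp only [← isOpen_compl_iff, isOpen_X_iff, Set.preimage_compl]

lemma continuous_X_iff {Z : Type*} [TopologicalSpace Z] {f : Δ.X → Z} :
    Continuous f ↔ ∀ σ, Continuous (f ∘ Δ.toX σ) := by
  refine ⟨fun h σ => h.comp (continuous_toX σ), fun h => ⟨fun A hA => isOpen_X_iff.2 fun σ => ?_⟩⟩
  exact hA.preimage (h σ)

lemma isOpenMap_res {τ σ : Δ.Cone} (h : τ ≤ σ) : IsOpenMap (Chart.res h) := by
  obtain ⟨σ, hσ⟩ := σ
  obtain ⟨τ, hτ⟩ := τ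
  obtain ⟨b, s, rfl⟩ := Δ.smooth σ hσ
  obtain ⟨s₁, hs₁, rfl⟩ := exists_subset_of_le hσ hτ h
  exact Chart.isOpenMap_res b h

lemma isOpenMap_toX (σ : Δ.Cone) : IsOpenMap (Δ.toX σ) := by
  intro V hV
  refine isOpen_X_iff.2 fun σ' => ?_
  have e : Δ.toX σ' ⁻¹' (Δ.toX σ '' V) = ⋃ (τ : Δ.Cone) (h : τ ≤ σ) (h' : τ ≤ σ'),
      Chart.res h' '' (Chart.res h ⁻¹' V) := by
    ext x
    simp only [Set.mem_preimage, Set.mem_image, Set.mem_iUnion]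
    constructor
    · rintro ⟨y, hy, hxy⟩
      obtain ⟨τ, h, h', z, rfl, rfl⟩ := toX_eq_iff.1 hxy
      exact ⟨τ, h, h', z, hy, rfl⟩
    · rintro ⟨τ, h, h', z, hz, rfl⟩
      exact ⟨_, hz, by rw [toX_res, toX_res]⟩
  rw [e]
  exact isOpen_iUnion fun τ => isOpen_iUnion fun h => isOpen_iUnion fun h' =>
    isOpenMap_res h' _ (hV.preimage (Chart.continuous_res h))

lemma isOpenEmbedding_toX (σ : Δ.Cone) : Topology.IsOpenEmbedding (Δ.toX σ) :=
  .of_continuous_injective_isOpenMap (continuous_toX σ) (toX_injective σ) (isOpenMap_toX σ)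

lemma range_toX_mono {τ σ : Δ.Cone} (h : τ ≤ σ) : Set.range (Δ.toX τ) ⊆ Set.range (Δ.toX σ) := by
  rintro _ ⟨x, rfl⟩
  exact ⟨Chart.res h x, toX_res h x⟩

/-- A minimal chart around `p` is the least one, because charts are glued along smaller charts. -/
lemma exists_least_chart (p : Δ.X) :
    ∃ τ : Δ.Cone, ∀ σ : Δ.Cone, p ∈ Set.range (Δ.toX σ) ↔ τ ≤ σ := by
  obtain ⟨σ₀, x₀, h₀⟩ := exists_toX p
  obtain ⟨τ, hτ⟩ := (Set.toFinite {σ : Δ.Cone | p ∈ Set.range (Δ.toX σ)}).exists_minimal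
    ⟨σ₀, x₀, h₀.symm⟩
  refine ⟨τ, fun σ => ⟨?_, fun h => range_toX_mono h hτ.1⟩⟩
  rintro ⟨x, hx⟩
  obtain ⟨y, hy⟩ := hτ.1
  obtain ⟨ρ, h, h', z, rfl, rfl⟩ := toX_eq_iff.1 (hx.trans hy.symm)
  exact (hτ.2 (y := ρ) ⟨z, by rw [← hx, toX_res]⟩ h').trans h

/-- The smallest cone whose chart contains `p`, i.e. the cone `τ` with `p ∈ O_τ`. -/
def suppCone (p : Δ.X) : Δ.Cone := (exists_least_chart p).choose

lemma mem_range_toX_iff {p : Δ.X} {σ : Δ.Cone} : p ∈ Set.range (Δ.toX σ) ↔ suppCone p ≤ σ :=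
  (exists_least_chart p).choose_spec σ

lemma exists_toX_suppCone (p : Δ.X) : ∃ x : Chart (suppCone p).1, Δ.toX (suppCone p) x = p :=
  mem_range_toX_iff.2 le_rfl

lemma isOpen_suppCone_le (σ : Δ.Cone) : IsOpen {p : Δ.X | suppCone p ≤ σ} := by
  simp only [← mem_range_toX_iff]
  exact (isOpenMap_toX σ).isOpen_range

lemma isClosed_le_suppCone (τ : Δ.Cone) : IsClosed {p : Δ.X | τ ≤ suppCone p} := by
  have e : {p : Δ.X | τ ≤ suppCone p}ᶜ = ⋃ (σ : Δ.Cone) (_ : ¬ τ ≤ σ), {p | suppCone p ≤ σ} := by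
    ext p
    simp only [Set.mem_compl_iff, Set.mem_ofPred_eq, Set.mem_iUnion]
    exact ⟨fun h => ⟨_, h, le_rfl⟩, fun ⟨σ, h, h'⟩ h'' => h (h''.trans h')⟩
  rw [← isOpen_compl_iff, e]
  exact isOpen_iUnion fun σ => isOpen_iUnion fun _ => isOpen_suppCone_le σ

section

variable {ι : Type*} [Fintype ι] {b : Module.Basis ι ℤ N} {s s' : Set ι}

lemma suppCone_toX_le_iff (hσ : coneOf (b '' s) ∈ Δ.cones) (hτ : coneOf (b '' s') ∈ Δ.cones)
    (h : s' ⊆ s) (x : Chart (coneOf (b '' s))) :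
    suppCone (Δ.toX ⟨_, hσ⟩ x) ≤ ⟨_, hτ⟩ ↔ ∀ i ∉ s', x.coord b i ≠ 0 := by
  have hle : coneOf (b '' s') ≤ coneOf (b '' s) := (coneOf_le_iff b).2 h
  rw [← mem_range_toX_iff, ← Chart.mem_range_res b hle]
  constructor
  · rintro ⟨y, hy⟩
    rw [← toX_res (σ := ⟨_, hσ⟩) hle] at hy
    exact ⟨y, toX_injective _ hy⟩
  · rintro ⟨y, rfl⟩
    exact ⟨y, (toX_res (τ := ⟨_, hτ⟩) (σ := ⟨_, hσ⟩) hle y).symm⟩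

lemma suppCone_toX_eq_iff (hσ : coneOf (b '' s) ∈ Δ.cones) (x : Chart (coneOf (b '' s))) :
    suppCone (Δ.toX ⟨_, hσ⟩ x) = ⟨_, hσ⟩ ↔ ∀ i ∈ s, x.coord b i = 0 := by
  have hle : suppCone (Δ.toX ⟨_, hσ⟩ x) ≤ ⟨_, hσ⟩ := mem_range_toX_iff.1 ⟨x, rfl⟩
  constructor
  · intro h i hi
    by_contra h0
    have hτ : coneOf (b '' (s \ {i})) ∈ Δ.cones :=
      Δ.face_mem _ hσ _ (isFace_basis b Set.sdiff_subset)
    have h1 := (suppCone_toX_le_iff hσ hτ Set.sdiff_subset x).2 fun j hj => by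
      by_cases hjs : j ∈ s
      · have : j = i := by
          by_contra hji
          exact hj ⟨hjs, hji⟩
        rwa [this]
      · exact x.coord_ne_zero b hjs
    rw [h] at h1
    exact ((coneOf_le_iff b).1 h1 hi).2 rfl
  · intro h
    obtain ⟨s', hs', e⟩ := exists_subset_of_le hσ (suppCone (Δ.toX ⟨_, hσ⟩ x)).2 hle
    have hτ : coneOf (b '' s') ∈ Δ.cones := e ▸ (suppCone (Δ.toX ⟨_, hσ⟩ x)).2
    have e' : suppCone (Δ.toX ⟨_, hσ⟩ x) = ⟨_, hτ⟩ := Subtype.ext e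
    have h1 := (suppCone_toX_le_iff hσ hτ hs' x).1 e'.le
    refine le_antisymm hle ?_
    rw [e']
    refine (coneOf_le_iff b).2 fun i hi => ?_
    by_contra hi'
    exact h1 i hi' (h i hi)

end

/-! ### The nonnegative part -/

lemma toX_mem_XPos_iff {σ : Δ.Cone} {x : Chart σ.1} : Δ.toX σ x ∈ Δ.XPos ↔ ∀ u, 0 ≤ x.1 u := by
  constructor
  · rintro ⟨σ', x', hx', h⟩
    obtain ⟨τ, h, h', y, rfl, rfl⟩ := toX_eq_iff.1 h
    obtain ⟨σ', hσ'⟩ := σ'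
    obtain ⟨τ, hτ⟩ := τ
    obtain ⟨b, s, rfl⟩ := Δ.smooth σ' hσ'
    obtain ⟨s₁, hs₁, rfl⟩ := exists_subset_of_le hσ' hτ h'
    rw [Chart.nonneg_iff b] at hx'
    exact fun u => (Chart.nonneg_iff b y).2 hx' _
  · exact fun h => ⟨σ, x, h, rfl⟩

lemma isClosed_XPos : IsClosed Δ.XPos := by
  refine isClosed_X_iff.2 fun σ => ?_
  have e : Δ.toX σ ⁻¹' Δ.XPos = ⋂ u, {x : Chart σ.1 | 0 ≤ x.1 u} := by
    ext x
    simp [toX_mem_XPos_iff]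
  rw [e]
  exact isClosed_iInter fun u => isClosed_le continuous_const
    ((continuous_apply u).comp continuous_subtype_val)

/-! ### The actions of the tori -/

lemma smul_toX (t : T2 N) (σ : Δ.Cone) (x : Chart σ.1) : t • Δ.toX σ x = Δ.toX σ (t • x) := rfl

lemma TR_smul_toX (t : TR N) (σ : Δ.Cone) (x : Chart σ.1) : t • Δ.toX σ x = Δ.toX σ (t • x) := rfl

lemma T2_smul_apply (t : T2 N) {σ : PointedCone ℝ (NR N)} (x : Chart σ) (u : dualSemigroup σ) :
    (t • x).1 u = ((t (Multiplicative.ofAdd u.1) : ℤ) : ℝ) * x.1 u := rfl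

lemma suppCone_TR_smul (t : TR N) (p : Δ.X) : suppCone (t • p) = suppCone p := by
  have key : ∀ (t : TR N) (p : Δ.X), suppCone (t • p) ≤ suppCone p := by
    intro t p
    rw [← mem_range_toX_iff]
    obtain ⟨x, hx⟩ := exists_toX_suppCone p
    exact ⟨t • x, by rw [← TR_smul_toX, hx]⟩
  refine le_antisymm (key t p) ?_
  have h := key t⁻¹ (t • p)
  have e : t⁻¹ • t • p = p := inv_smul_smul t p
  rwa [e] at h

instance : ContinuousConstSMul (T2 N) Δ.X where
  continuous_const_smul t := by
    refine continuous_X_iff.2 fun σ => ?_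
    refine (continuous_toX σ).comp (f := fun x : Chart σ.1 => t • x) ?_
    refine continuous_induced_rng.2 (continuous_pi fun u => ?_)
    exact continuous_const.mul ((continuous_apply u).comp continuous_subtype_val)

/-- A point of `X₊` is the only point of `X₊` in its `T₂`-orbit. -/
lemma smul_eq_of_mem_XPos {t : T2 N} {p : Δ.X} (hp : p ∈ Δ.XPos) (htp : t • p ∈ Δ.XPos) :
    t • p = p := by
  obtain ⟨σ, x, rfl⟩ := exists_toX p
  rw [smul_toX, toX_mem_XPos_iff] at htp
  rw [toX_mem_XPos_iff] at hp
  rw [smul_toX]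
  congr 1
  refine Subtype.ext (funext fun u => ?_)
  have h1 := htp u
  have h2 := hp u
  rw [T2_smul_apply] at h1 ⊢
  rcases Int.units_eq_one_or (t (Multiplicative.ofAdd u.1)) with h | h
  · simp [h]
  · simp only [h, Units.val_neg, Units.val_one, Int.cast_neg, Int.cast_one, neg_mul, one_mul]
      at h1 ⊢
    linarith

/-- The stabilizer in `T₂` of a point of `O_τ` is the local group `G_τ`. -/
lemma smul_eq_self_iff (t : T2 N) (p : Δ.X) :
    t • p = p ↔ t ∈ (Δ.phi.hom (suppCone p)).range := by
  obtain ⟨x, hx⟩ := exists_toX_suppCone p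
  have hr : (Δ.phi.hom (suppCone p)).range =
      MulAction.stabilizer (T2 N) (distinguished (suppCone p).1) := Subgroup.range_subtype _
  rw [hr, mem_stabilizer_distinguished]
  have hx' : ∀ u, x.1 u ≠ 0 ↔ ∀ v ∈ (suppCone p).1, pair u.1 v = 0 := by
    generalize hσ : suppCone p = σ at x
    subst hx
    obtain ⟨σ, hσ'⟩ := σ
    obtain ⟨b, s, rfl⟩ := Δ.smooth σ hσ'
    exact x.apply_of_coord_eq_zero b ((suppCone_toX_eq_iff hσ' x).1 hσ)
  have h1 : t • p = p ↔ t • x = x := by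
    conv_lhs => rw [← hx]
    rw [smul_toX, (toX_injective _).eq_iff]
  rw [h1]
  constructor
  · intro h u hu
    have h2 := congrArg (fun y => y.1 ⟨u, fun v hv => (hu v hv).ge⟩) h
    simp only [T2_smul_apply] at h2
    have h3 := mul_eq_right₀ ((hx' ⟨u, fun v hv => (hu v hv).ge⟩).2 hu) |>.1 h2
    exact Units.ext (Int.cast_injective (α := ℝ) (by rw [h3]; simp))
  · intro h
    refine Subtype.ext (funext fun u => ?_)
    rw [T2_smul_apply]
    by_cases hu : x.1 u = 0
    · rw [hu, mul_zero]
    · rw [h u.1 ((hx' u).1 hu)]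
      simp

/-- Every chart point is a sign change of a nonnegative one. -/
lemma exists_smul_nonneg {σ : Δ.Cone} (x : Chart σ.1) :
    ∃ (t : T2 N) (y : Chart σ.1), x = t • y ∧ (∀ u, 0 ≤ y.1 u) ∧
      ((∀ u : dualSemigroup σ.1, (∀ v ∈ σ.1, pair u.1 v = 0) → 0 < x.1 u) →
        t ∈ MulAction.stabilizer (T2 N) (distinguished σ.1)) := by
  obtain ⟨σ, hσ⟩ := σ
  obtain ⟨b, s, rfl⟩ := Δ.smooth σ hσ
  dsimp only at x ⊢
  refine ⟨homOfCoord b fun i => if x.coord b i < 0 then -1 else 1,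
    Chart.ofCoord b (fun i => |x.coord b i|) fun i hi => abs_ne_zero.2 (x.coord_ne_zero b hi),
    Chart.ext_coord b fun i => ?_, (Chart.nonneg_iff b _).2 fun i => by simp, ?_⟩
  · change x.coord b i = ((homOfCoord b _ (Multiplicative.ofAdd (b.coord i)) : ℤˣ) : ℤ) * _
    change _ = _ * (Chart.ofCoord b _ _).coord b i
    rw [homOfCoord_coord, Chart.coord_ofCoord]
    split_ifs with h
    · simp [abs_of_neg h]
    · simp [abs_of_nonneg (not_lt.1 h)]
  · intro h
    rw [Chart.pos_iff] at h
    rw [mem_stabilizer_distinguished]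
    intro u hu
    rw [pair_eq_zero_iff] at hu
    rw [homOfCoord_apply]
    refine Finset.prod_eq_one fun i _ => ?_
    by_cases hi : i ∈ s
    · rw [hu i hi, zpow_zero]
    · rw [if_neg (h i hi).le.not_gt, one_zpow]

lemma exists_smul_mem_XPos (p : Δ.X) : ∃ (t : T2 N) (y : Δ.XPos), p = t • (y : Δ.X) := by
  obtain ⟨σ, x, rfl⟩ := exists_toX p
  obtain ⟨t, y, rfl, hy, -⟩ := exists_smul_nonneg x
  exact ⟨t, ⟨_, toX_mem_XPos_iff.2 hy⟩, rfl⟩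

/-! ### Orbits and strata of the nonnegative part -/

lemma distinguished_nonneg (σ : PointedCone ℝ (NR N)) (u) : 0 ≤ (distinguished σ).1 u := by
  classical
  change (0 : ℝ) ≤ if _ then 1 else 0
  split_ifs <;> simp

lemma distinguished_coord {ι : Type*} [Fintype ι] (b : Module.Basis ι ℤ N) (s : Set ι) {i : ι}
    (hi : i ∈ s) : (distinguished (coneOf (b '' s))).coord b i = 0 := by
  refine if_neg fun h => ?_
  have := (pair_eq_zero_iff b _).1 h i hi
  simp at this

lemma suppCone_distinguished (τ : Δ.Cone) : suppCone (Δ.toX τ (distinguished τ.1)) = τ := by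
  obtain ⟨τ, hτ⟩ := τ
  obtain ⟨b, s, rfl⟩ := Δ.smooth τ hτ
  exact (suppCone_toX_eq_iff hτ _).2 fun i hi => distinguished_coord b s hi

/-- The distinguished point `x_τ`, as a point of `X₊`. -/
def distPoint (τ : Δ.Cone) : Δ.XPos :=
  ⟨Δ.toX τ (distinguished _), toX_mem_XPos_iff.2 (distinguished_nonneg _)⟩

lemma suppCone_distPoint (τ : Δ.Cone) : suppCone (distPoint τ : Δ.X) = τ :=
  suppCone_distinguished τ

lemma mem_orbitPos_iff {τ : Δ.Cone} {p : Δ.X} :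
    p ∈ Δ.orbitPos τ ↔ p ∈ Δ.XPos ∧ suppCone p = τ := by
  constructor
  · rintro ⟨t, rfl⟩
    refine ⟨?_, (suppCone_TR_smul t.1 _).trans (suppCone_distinguished τ)⟩
    change Δ.toX τ ((t : TR N) • distinguished τ.1) ∈ Δ.XPos
    rw [toX_mem_XPos_iff]
    intro u
    exact mul_nonneg (t.2 _).le (distinguished_nonneg _ _)
  · rintro ⟨hp, rfl⟩
    obtain ⟨x, hx⟩ := exists_toX_suppCone p
    generalize hσ : suppCone p = σ at x
    subst hx
    obtain ⟨σ, hσ'⟩ := σ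
    obtain ⟨b, s, rfl⟩ := Δ.smooth σ hσ'
    rw [suppCone_toX_eq_iff] at hσ
    rw [toX_mem_XPos_iff, Chart.nonneg_iff b] at hp
    have hpos : ∀ i ∉ s, 0 < x.coord b i := fun i hi =>
      (hp i).lt_of_ne (x.coord_ne_zero b hi).symm
    classical
    have hg : ∀ i, 0 < if i ∈ s then 1 else x.coord b i := by
      intro i
      split_ifs with h
      · exact one_pos
      · exact hpos i h
    refine ⟨⟨homOfCoord b fun i => Units.mk0 _ (hg i).ne', fun u => ?_⟩, ?_⟩
    · change 0 < ((∏ i, _ : ℝˣ) : ℝ)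
      rw [Units.coe_prod]
      refine Finset.prod_pos fun i _ => ?_
      rw [Units.val_zpow_eq_zpow_val]
      exact zpow_pos (hg i) _
    · change Δ.toX ⟨_, hσ'⟩ (homOfCoord b (fun i => Units.mk0 _ (hg i).ne') •
        distinguished (coneOf (b '' s))) = _
      congr 1
      refine Chart.ext_coord b fun i => ?_
      rw [Chart.coord_smul, homOfCoord_coord, Units.val_mk0]
      by_cases hi : i ∈ s
      · rw [distinguished_coord b s hi, mul_zero, hσ i hi]
      · rw [if_neg hi]
        have : (distinguished (coneOf (b '' s))).coord b i = 1 := by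
          refine if_pos ((pair_eq_zero_iff b _).2 fun j hj => ?_)
          have hij : j ≠ i := by rintro rfl; exact hi hj
          simp [hij]
        rw [this, mul_one]

lemma mem_closure_orbitPos {τ : Δ.Cone} {p : Δ.X} (hp : p ∈ Δ.XPos) (h : τ ≤ suppCone p) :
    p ∈ closure (Δ.orbitPos τ) := by
  obtain ⟨x, hx⟩ := exists_toX_suppCone p
  generalize hσ : suppCone p = σ at x h
  subst hx
  obtain ⟨σ, hσ'⟩ := σ
  obtain ⟨τ, hτ⟩ := τ
  obtain ⟨b, s, rfl⟩ := Δ.smooth σ hσ'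
  obtain ⟨s', hs', rfl⟩ := exists_subset_of_le hσ' hτ h
  rw [suppCone_toX_eq_iff] at hσ
  rw [toX_mem_XPos_iff, Chart.nonneg_iff b] at hp
  classical
  -- the coordinates outside `s'` that vanish at `p` are moved away from zero
  let z : ℝ → Fin (Module.finrank ℤ N) → ℝ := fun ε i =>
    x.coord b i + if i ∈ s \ s' then ε else 0
  have hz : ∀ ε, ∀ i ∉ s, z ε i ≠ 0 := fun ε i hi => by
    simpa [z, hi] using x.coord_ne_zero b hi
  have hc : Continuous fun ε => Δ.toX ⟨_, hσ'⟩ (Chart.ofCoord b (z ε) (hz ε)) := by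
    refine (continuous_toX _).comp ((chartHomeo b s).symm.continuous.comp
      (Continuous.subtype_mk (continuous_pi fun i => continuous_const.add ?_) (hz ·)))
    split_ifs
    · exact continuous_id
    · exact continuous_const
  have h0 : Δ.toX ⟨_, hσ'⟩ x = Δ.toX ⟨_, hσ'⟩ (Chart.ofCoord b (z 0) (hz 0)) := by
    congr 1
    exact Chart.ext_coord b fun i => by simp [z]
  rw [h0]
  refine mem_closure_of_tendsto ((hc.tendsto 0).mono_left nhdsWithin_le_nhds)
    (Filter.eventually_of_mem (self_mem_nhdsWithin (s := Set.Ioi (0 : ℝ))) fun ε hε => ?_)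
  have hε : 0 < ε := hε
  have hz' : ∀ i ∉ s', z ε i ≠ 0 := fun i hi => by
    by_cases his : i ∈ s
    · simpa [z, hi, his, hσ i his] using hε.ne'
    · exact hz ε i his
  have e : Chart.ofCoord b (z ε) (hz ε) = Chart.res h (Chart.ofCoord b (z ε) hz') :=
    Chart.ext_coord b fun i => by rw [Chart.coord_res]; simp
  have e' := toX_res (τ := ⟨_, hτ⟩) (σ := ⟨_, hσ'⟩) h (Chart.ofCoord b (z ε) hz')
  rw [e, e', mem_orbitPos_iff, toX_mem_XPos_iff, Chart.nonneg_iff b, suppCone_toX_eq_iff]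
  refine ⟨fun i => ?_, fun i hi => ?_⟩
  · rw [Chart.coord_ofCoord]
    exact add_nonneg (hp i) (by split_ifs <;> simp [hε.le])
  · rw [Chart.coord_ofCoord]
    simp [z, hi, hσ i (hs' hi)]

lemma mem_VPos_iff {τ : Δ.Cone} {p : Δ.XPos} : p ∈ Δ.VPos τ ↔ τ ≤ suppCone (p : Δ.X) := by
  constructor
  · intro h
    refine (closure_minimal ?_ (isClosed_le_suppCone τ)) h
    intro q hq
    exact (mem_orbitPos_iff.1 hq).2.ge
  · exact mem_closure_orbitPos p.2

end SmoothFan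

/-! ### The spaces `G × X₊/∼` and the maps between them -/

namespace SmoothFan

variable {Δ : SmoothFan N}

namespace Glue

section

variable {G : Type*} [Group G] {β : SimpleMorphism Δ.cplx G}

lemma mk_eq_mk_iff {g g' : G} {x x' : Δ.XPos} :
    Glue.mk Δ β g x = Glue.mk Δ β g' x' ↔
      x = x' ∧ g⁻¹ * g' ∈ (β.hom (suppCone (x : Δ.X))).range := by
  refine (Quotient.eq (r := Δ.glueSetoid β)).trans ⟨?_, ?_⟩
  · rintro ⟨h, h'⟩
    exact ⟨h, h' _ (mem_orbitPos_iff.2 ⟨x.2, rfl⟩)⟩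
  · rintro ⟨h, h'⟩
    refine ⟨h, fun τ hτ => ?_⟩
    rw [← (mem_orbitPos_iff.1 hτ).2]
    exact h'

lemma exists_mk (z : Δ.Glue β) : ∃ (g : G) (x : Δ.XPos), z = Glue.mk Δ β g x := by
  obtain ⟨g, x⟩ := z
  exact ⟨g, x, rfl⟩

lemma continuous_mk (g : G) : Continuous (Glue.mk Δ β g) := by
  let _ : TopologicalSpace G := ⊥
  exact continuous_quot_mk.comp (Continuous.prodMk_right g)

lemma isOpen_iff {A : Set (Δ.Glue β)} : IsOpen A ↔ ∀ g, IsOpen (Glue.mk Δ β g ⁻¹' A) := by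
  refine ⟨fun h g => h.preimage (continuous_mk g), fun h => ?_⟩
  let _ : TopologicalSpace G := ⊥
  have : DiscreteTopology G := ⟨rfl⟩
  refine isOpen_coinduced.2 ?_
  have e : (Quotient.mk (Δ.glueSetoid β)) ⁻¹' A =
      ⋃ g : G, ({g} : Set G) ×ˢ (Glue.mk Δ β g ⁻¹' A) := by
    ext ⟨g, x⟩
    simp only [Set.mem_iUnion, Set.mem_prod, Set.mem_singleton_iff, exists_eq_left']
    exact Iff.rfl
  refine e ▸ isOpen_iUnion fun g => (isOpen_discrete _).prod (h g)

lemma continuous_iff {Z : Type*} [TopologicalSpace Z] {f : Δ.Glue β → Z} :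
    Continuous f ↔ ∀ g, Continuous (f ∘ Glue.mk Δ β g) :=
  ⟨fun h g => h.comp (continuous_mk g), fun h => ⟨fun _ hA => isOpen_iff.2 fun g =>
    hA.preimage (h g)⟩⟩

/-- The action `g • [g', x] = [g g', x]`. -/
instance : MulAction G (Δ.Glue β) where
  smul g := Quotient.map (fun a => (g * a.1, a.2)) (by
    rintro ⟨g₁, y⟩ ⟨g₂, y'⟩ ⟨h, hq⟩
    exact ⟨h, fun q hs => by simpa [mul_assoc] using hq q hs⟩)
  one_smul := by
    rintro ⟨g, y⟩
    exact congrArg (Quotient.mk (Δ.glueSetoid β)) (by simp)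
  mul_smul := by
    rintro g g' ⟨g₁, y⟩
    exact congrArg (Quotient.mk (Δ.glueSetoid β)) (by simp [mul_assoc])

lemma smul_mk (g g' : G) (x : Δ.XPos) : g • Glue.mk Δ β g' x = Glue.mk Δ β (g * g') x := rfl

instance : ContinuousConstSMul G (Δ.Glue β) where
  continuous_const_smul g := continuous_iff.2 fun g' => continuous_mk (g * g')

variable (β) in
/-- The open set `G_σ (U_σ)₊`, the neighbourhood of `(U_σ)₊` in `G × X₊/∼`. -/
def star (σ : Δ.Cone) : Set (Δ.Glue β) :=
  {z | ∃ g ∈ (β.hom σ).range, ∃ x : Δ.XPos, suppCone (x : Δ.X) ≤ σ ∧ z = Glue.mk Δ β g x}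

lemma range_mono (β : SimpleMorphism Δ.cplx G) {τ σ : Δ.Cone} (h : τ ≤ σ) :
    (β.hom τ).range ≤ (β.hom σ).range := by
  rintro _ ⟨c, rfl⟩
  exact ⟨Δ.cplx.map h c, β.compat h c⟩

lemma mk_mem_star_iff {σ : Δ.Cone} {g : G} {x : Δ.XPos} :
    Glue.mk Δ β g x ∈ star β σ ↔ g ∈ (β.hom σ).range ∧ suppCone (x : Δ.X) ≤ σ := by
  constructor
  · rintro ⟨g', hg', x', hx', h⟩
    obtain ⟨rfl, h₂⟩ := mk_eq_mk_iff.1 h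
    refine ⟨?_, hx'⟩
    have h' := range_mono β hx' h₂
    rw [← inv_mem_iff, ← mul_mem_cancel_right hg']
    exact h'
  · rintro ⟨hg, hx⟩
    exact ⟨g, hg, x, hx, rfl⟩

lemma isOpen_star (σ : Δ.Cone) : IsOpen (star β σ) := by
  refine isOpen_iff.2 fun g => ?_
  by_cases hg : g ∈ (β.hom σ).range
  · convert (isOpen_suppCone_le σ).preimage (continuous_subtype_val (p := (· ∈ Δ.XPos))) using 1
    ext x
    simp [mk_mem_star_iff, hg]
  · convert isOpen_empty using 1
    ext x
    simp [mk_mem_star_iff, hg]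

lemma star_mono {τ σ : Δ.Cone} (h : τ ≤ σ) : star β τ ⊆ star β σ := by
  rintro _ ⟨g, hg, x, hx, rfl⟩
  exact ⟨g, range_mono β h hg, x, hx.trans h, rfl⟩

lemma smul_mem_star {σ : Δ.Cone} {g : G} (hg : g ∈ (β.hom σ).range) {z : Δ.Glue β}
    (hz : z ∈ star β σ) : g • z ∈ star β σ := by
  obtain ⟨g', hg', x, hx, rfl⟩ := hz
  exact ⟨g * g', mul_mem hg hg', x, hx, rfl⟩

lemma exists_mem_smul_star (z : Δ.Glue β) : ∃ (g : G) (σ : Δ.Cone), g⁻¹ • z ∈ star β σ := by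
  obtain ⟨g, x, rfl⟩ := exists_mk z
  refine ⟨g, suppCone (x : Δ.X), ?_⟩
  rw [smul_mk, mk_mem_star_iff, inv_mul_cancel]
  exact ⟨one_mem _, le_rfl⟩

end

section Map

variable {G K : Type*} [Group G] [Group K] {β : SimpleMorphism Δ.cplx G}
  {β' : SimpleMorphism Δ.cplx K} (f : G →* K) (hf : ∀ τ c, f (β.hom τ c) = β'.hom τ c)

/-- The map `[g, x] ↦ [f g, x]` induced by a homomorphism that carries `β` to `β'`. -/
def map : Δ.Glue β → Δ.Glue β' :=
  Quotient.map (fun a => (f a.1, a.2)) (by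
    rintro ⟨g, y⟩ ⟨g', y'⟩ ⟨h, hq⟩
    refine ⟨h, fun q hs => ?_⟩
    obtain ⟨c, hc⟩ := hq q hs
    refine ⟨c, ?_⟩
    dsimp only at hc ⊢
    rw [← hf, hc, map_mul, map_inv])

lemma map_mk (g : G) (x : Δ.XPos) : map f hf (Glue.mk Δ β g x) = Glue.mk Δ β' (f g) x := rfl

lemma map_smul (g : G) (z : Δ.Glue β) : map f hf (g • z) = f g • map f hf z := by
  obtain ⟨g', x, rfl⟩ := exists_mk z
  rw [smul_mk, map_mk, map_mk, smul_mk, map_mul]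

lemma continuous_map : Continuous (map f hf) :=
  continuous_iff.2 fun g => continuous_mk (f g)

lemma isOpenMap_map : IsOpenMap (map f hf) := by
  intro V hV
  refine isOpen_iff.2 fun k => ?_
  have e : Glue.mk Δ β' k ⁻¹' (map f hf '' V) =
      ⋃ (g : G) (_ : f g = k), Glue.mk Δ β g ⁻¹' V := by
    ext x
    simp only [Set.mem_preimage, Set.mem_image, Set.mem_iUnion]
    constructor
    · rintro ⟨z, hz, h⟩
      obtain ⟨g, y, rfl⟩ := exists_mk z
      rw [map_mk] at h
      obtain ⟨rfl, c, hc⟩ := mk_eq_mk_iff.1 h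
      refine ⟨g * β.hom _ c, ?_, ?_⟩
      · rw [map_mul, hf, hc, mul_inv_cancel_left]
      · have : Glue.mk Δ β g y = Glue.mk Δ β (g * β.hom _ c) y :=
          mk_eq_mk_iff.2 ⟨rfl, c, by simp⟩
        rwa [← this]
    · rintro ⟨g, rfl, hg⟩
      exact ⟨_, hg, rfl⟩
  rw [e]
  exact isOpen_iUnion fun g => isOpen_iUnion fun _ => hV.preimage (continuous_mk g)

/-- The fibres of the induced map are the orbits of the kernel. -/
lemma map_eq_map_iff {z z' : Δ.Glue β} :
    map f hf z = map f hf z' ↔ z ∈ MulAction.orbit f.ker z' := by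
  constructor
  · intro h
    obtain ⟨g, x, rfl⟩ := exists_mk z
    obtain ⟨g', x', rfl⟩ := exists_mk z'
    rw [map_mk, map_mk] at h
    obtain ⟨rfl, c, hc⟩ := mk_eq_mk_iff.1 h
    rw [← hf] at hc
    refine ⟨⟨g * β.hom _ c * g'⁻¹, ?_⟩, ?_⟩
    · rw [MonoidHom.mem_ker, map_mul, map_mul, hc, map_inv]
      simp
    · change Glue.mk Δ β (g * β.hom _ c * g'⁻¹ * g') x = _
      rw [inv_mul_cancel_right]
      exact (mk_eq_mk_iff.2 ⟨rfl, c, by simp⟩).symm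
  · rintro ⟨⟨k, hk⟩, rfl⟩
    change map f hf (k • z') = _
    rw [map_smul, MonoidHom.mem_ker.1 hk, one_smul]

lemma mk_mem_range_map_iff (k : K) (x : Δ.XPos) :
    Glue.mk Δ β' k x ∈ Set.range (map f hf) ↔ k ∈ f.range := by
  constructor
  · rintro ⟨z, hz⟩
    obtain ⟨g, y, rfl⟩ := exists_mk z
    rw [map_mk] at hz
    obtain ⟨rfl, c, hc⟩ := mk_eq_mk_iff.1 hz
    rw [← hf] at hc
    refine ⟨g * β.hom _ c, ?_⟩
    rw [map_mul, hc, mul_inv_cancel_left]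
  · rintro ⟨g, rfl⟩
    exact ⟨Glue.mk Δ β g x, rfl⟩

lemma isClopen_range_map : IsClopen (Set.range (map f hf)) := by
  refine ⟨isOpen_compl_iff.1 (isOpen_iff.2 fun k => ?_), (isOpenMap_map f hf).isOpen_range⟩
  by_cases hk : k ∈ f.range
  · convert isOpen_empty using 1
    ext x
    simp only [Set.mem_preimage, Set.mem_compl_iff, mk_mem_range_map_iff, hk, not_true,
      Set.mem_empty_iff_false]
  · convert isOpen_univ using 1
    ext x
    simp only [Set.mem_preimage, Set.mem_compl_iff, mk_mem_range_map_iff, hk, not_false_eq_true,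
      Set.mem_univ]

variable (hβ' : β'.IsInjective)

include hf hβ'

/-- On `G_σ (U_σ)₊` the induced map is injective, because `β'` is injective on `G_σ`. -/
lemma map_injOn_star (σ : Δ.Cone) : Set.InjOn (map f hf) (star β σ) := by
  rintro _ ⟨_, ⟨c, rfl⟩, x, hx, rfl⟩ _ ⟨_, ⟨c', rfl⟩, x', hx', rfl⟩ h
  rw [map_mk, map_mk] at h
  obtain ⟨rfl, a, ha⟩ := mk_eq_mk_iff.1 h
  refine mk_eq_mk_iff.2 ⟨rfl, a, ?_⟩
  rw [hf, hf, ← map_inv, ← map_mul, ← β'.compat hx] at ha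
  have := hβ' _ ha
  rw [← β.compat hx, this, map_mul, map_inv]

/-- The kernel of `f` moves every `g G_σ (U_σ)₊` off itself: an element that does not would be
conjugate to an element of `β(G_σ)`, on which `f` is injective. -/
lemma eq_one_of_mem_ker {g k : G} (hk : k ∈ f.ker) {σ : Δ.Cone} {z z' : Δ.Glue β}
    (hz : g⁻¹ • z ∈ star β σ) (hz' : g⁻¹ • z' ∈ star β σ) (h : k • z = z') : k = 1 := by
  obtain ⟨a, x, rfl⟩ := exists_mk z
  subst h
  rw [smul_mk, smul_mk, mk_mem_star_iff] at hz'
  rw [smul_mk, mk_mem_star_iff] at hz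
  have h1 : g⁻¹ * k * g ∈ (β.hom σ).range := by
    have := mul_mem hz'.1 (inv_mem hz.1)
    simpa [mul_assoc] using this
  obtain ⟨c, hc⟩ := h1
  have h2 := congrArg f hc
  rw [hf, map_mul, map_mul, MonoidHom.mem_ker.1 hk, mul_one, map_inv, inv_mul_cancel,
    ← map_one (β'.hom σ)] at h2
  rw [hβ' _ h2, map_one] at hc
  have h3 := hc.symm
  rw [mul_assoc, inv_mul_eq_one] at h3
  exact (mul_eq_right.1 h3.symm)

/-- The induced map of developments is the quotient by a free, properly discontinuous action of
the kernel, onto its image. -/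
theorem isQuotientCoveringMap_map :
    IsQuotientCoveringMap (Set.rangeFactorization (map f hf)) f.ker := by
  have hc : Continuous (Set.rangeFactorization (map f hf)) :=
    (continuous_map f hf).subtype_mk _
  have ho : IsOpenMap (Set.rangeFactorization (map f hf)) :=
    (isOpenMap_map f hf).subtype_mk _
  refine (isQuotientCoveringMap_iff ..).2
    ⟨ho.isQuotientMap hc Set.rangeFactorization_surjective, ?_, ?_, ?_⟩
  · exact ⟨fun k => continuous_const_smul (k : G)⟩
  · intro z z'
    rw [← map_eq_map_iff f hf]
    exact Subtype.ext_iff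
  · intro z
    obtain ⟨g, σ, hz⟩ := exists_mem_smul_star z
    refine ⟨(g⁻¹ • ·) ⁻¹' star β σ, ((isOpen_star σ).preimage
      (continuous_const_smul g⁻¹)).mem_nhds hz, ?_⟩
    rintro ⟨k, hk⟩ ⟨_, ⟨y, hy, rfl⟩, hy'⟩
    exact Subtype.ext (eq_one_of_mem_ker f hf hβ' hk hy hy' rfl)

/-- The image of the induced map is open and closed, so that it is a covering map with empty fibres
outside its image. -/
theorem isCoveringMap_map : IsCoveringMap (map f hf) := by
  intro z
  by_cases hz : z ∈ Set.range (map f hf)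
  · exact IsCoveringMapOn.of_isCoveringMap_subtype (isOpenMap_map f hf).isOpen_range
      (fun z => ⟨z, rfl⟩) (isQuotientCoveringMap_map f hf hβ').isCoveringMap z hz
  · have : IsEmpty (map f hf ⁻¹' {z}) := ⟨fun w => hz ⟨w.1, w.2⟩⟩
    refine IsEvenlyCovered.of_preimage_eq_empty _
      ((isClopen_range_map f hf).compl.isOpen.mem_nhds hz) ?_
    ext w
    simp

end Map

end Glue

/-! ### The real toric variety as a development -/

lemma phi_isInjective : Δ.phi.IsInjective := fun _ => Subtype.val_injective

/-- The map `T₂ × X₊/∼ → X`, `[t, x] ↦ t • x`. -/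
def gluePhiFun : Δ.Glue Δ.phi → Δ.X :=
  Quotient.lift (fun a => a.1 • (a.2 : Δ.X)) (by
    rintro ⟨t, x⟩ ⟨t', x'⟩ ⟨h, h'⟩
    dsimp only at h h' ⊢
    subst h
    have h2 := h' _ (mem_orbitPos_iff.2 ⟨x.2, rfl⟩)
    rw [← smul_eq_self_iff, mul_smul, inv_smul_eq_iff] at h2
    exact h2.symm)

lemma gluePhiFun_mk (t : T2 N) (x : Δ.XPos) :
    gluePhiFun (Glue.mk Δ Δ.phi t x) = t • (x : Δ.X) := rfl

lemma gluePhiFun_bijective : Function.Bijective (gluePhiFun (Δ := Δ)) := by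
  constructor
  · intro z z' h
    obtain ⟨t, x, rfl⟩ := Glue.exists_mk z
    obtain ⟨t', x', rfl⟩ := Glue.exists_mk z'
    rw [gluePhiFun_mk, gluePhiFun_mk, ← inv_smul_eq_iff, ← mul_smul] at h
    have h1 := smul_eq_of_mem_XPos x.2 (h ▸ x'.2)
    have h2 : x = x' := Subtype.ext (h1.symm.trans h)
    subst h2
    refine Glue.mk_eq_mk_iff.2 ⟨rfl, ?_⟩
    rw [smul_eq_self_iff, ← inv_mem_iff] at h1
    simpa using h1
  · intro p
    obtain ⟨t, y, rfl⟩ := exists_smul_mem_XPos p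
    exact ⟨Glue.mk Δ Δ.phi t y, rfl⟩

/-- The map is closed because `X₊` is closed in `X` and `T₂` is finite. -/
lemma isHomeomorph_gluePhiFun : IsHomeomorph (gluePhiFun (Δ := Δ)) := by
  refine isHomeomorph_iff_continuous_isClosedMap_bijective.2 ⟨?_, ?_, gluePhiFun_bijective⟩
  · exact Glue.continuous_iff.2 fun t => continuous_subtype_val.const_smul t
  · intro A hA
    have e : gluePhiFun '' A =
        ⋃ t : T2 N, (t • ·) '' (Subtype.val '' (Glue.mk Δ Δ.phi t ⁻¹' A)) := by
      ext p
      simp only [Set.mem_iUnion, Set.mem_image, exists_exists_and_eq_and]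
      constructor
      · rintro ⟨z, hz, rfl⟩
        obtain ⟨t, x, rfl⟩ := Glue.exists_mk z
        exact ⟨t, x, hz, rfl⟩
      · rintro ⟨t, x, hx, rfl⟩
        exact ⟨_, hx, rfl⟩
    rw [e]
    obtain ⟨σ, hσ⟩ := Δ.nonempty
    obtain ⟨b, -⟩ := Δ.smooth σ hσ
    have : Finite (T2 N) := .of_injective _ (T2.coordEquiv b).injective
    refine isClosed_iUnion_of_finite fun t => ?_
    exact (Homeomorph.smul t).isClosedMap _
      (isClosed_XPos.isClosedMap_subtype_val _ (hA.preimage (Glue.continuous_mk t)))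

/-- The homeomorphism `T₂ × X₊/∼ ≅ X`. -/
def gluePhi : Δ.Glue Δ.phi ≃ₜ Δ.X := isHomeomorph_gluePhiFun.homeomorph

lemma gluePhi_mk (t : T2 N) (x : Δ.XPos) : gluePhi (Glue.mk Δ Δ.phi t x) = t • (x : Δ.X) := rfl

/-! ### The sets `G_σ (U_σ)₊` in the real toric variety -/

/-- In coordinates, `G_σ (U_σ)₊ ⊆ U_σ` is the convex set where the coordinates outside `σ` are
positive. -/
lemma isSimplyConnected_image_star_phi (σ : Δ.Cone) :
    IsSimplyConnected (gluePhi '' Glue.star Δ.phi σ) := by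
  have e : gluePhi '' Glue.star Δ.phi σ = Δ.toX σ '' {x : Chart σ.1 | ∀ u : dualSemigroup σ.1,
      (∀ v ∈ σ.1, pair u.1 v = 0) → 0 < x.1 u} := by
    have hr : (Δ.phi.hom σ).range =
      MulAction.stabilizer (T2 N) (distinguished σ.1) := Subgroup.range_subtype _
    ext p
    constructor
    · rintro ⟨_, ⟨t, ht, ⟨x, hx⟩, hxσ, rfl⟩, rfl⟩
      rw [gluePhi_mk]
      obtain ⟨y, rfl⟩ := mem_range_toX_iff.2 hxσ
      refine ⟨t • y, fun u hu => ?_, rfl⟩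
      rw [hr, mem_stabilizer_distinguished] at ht
      rw [T2_smul_apply, ht u.1 hu]
      rw [toX_mem_XPos_iff] at hx
      have hneg : -u.1 ∈ dualSemigroup σ.1 := fun v hv => by
        have : pair (-u.1) v = -pair u.1 v := by simp [pair, LinearMap.baseChange_neg]
        rw [this, hu v hv, neg_zero]
      have h1 := right_ne_zero_of_mul_eq_one (y.map_neg_mul u.2 hneg)
      simpa using (hx u).lt_of_ne h1.symm
    · rintro ⟨x, hx, rfl⟩
      obtain ⟨t, y, rfl, hy, ht⟩ := exists_smul_nonneg x
      refine ⟨Glue.mk Δ Δ.phi t ⟨Δ.toX σ y, toX_mem_XPos_iff.2 hy⟩, ?_, rfl⟩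
      rw [Glue.mk_mem_star_iff, hr]
      exact ⟨ht hx, mem_range_toX_iff.1 ⟨y, rfl⟩⟩
  rw [e, (isOpenEmbedding_toX σ).isEmbedding.isSimplyConnected_image]
  obtain ⟨σ, hσ⟩ := σ
  obtain ⟨b, s, rfl⟩ := Δ.smooth σ hσ
  rw [← (chartHomeo b s).isSimplyConnected_image,
    ← IsEmbedding.subtypeVal.isSimplyConnected_image]
  have e2 : Subtype.val '' ((chartHomeo b s) '' {x : Chart (coneOf (b '' s)) |
      ∀ u : dualSemigroup (coneOf (b '' s)), (∀ v ∈ coneOf (b '' s), pair u.1 v = 0) → 0 < x.1 u})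
      = {z | ∀ i ∉ s, 0 < z i} := by
    ext z
    constructor
    · rintro ⟨_, ⟨x, hx, rfl⟩, rfl⟩
      exact (x.pos_iff b).1 hx
    · intro hz
      refine ⟨⟨z, fun i hi => (hz i hi).ne'⟩, ⟨(chartHomeo b s).symm ⟨z, fun i hi => (hz i hi).ne'⟩,
        (Chart.pos_iff b _).2 fun i hi => ?_, (chartHomeo b s).apply_symm_apply _⟩, rfl⟩
      rw [← chartHomeo_apply, Homeomorph.apply_symm_apply]
      exact hz i hi
  rw [e2]
  have hconv : Convex ℝ {z : Fin (Module.finrank ℤ N) → ℝ | ∀ i ∉ s, 0 < z i} := by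
    simp only [Set.ofPred_forall]
    exact convex_iInter fun i => convex_iInter fun _ =>
      convex_halfSpace_gt (LinearMap.proj (R := ℝ) i).isLinear 0
  have := hconv.contractibleSpace ⟨fun _ => 1, fun _ _ => one_pos⟩
  exact SimplyConnectedSpace.ofContractible _

end SmoothFan

/-! ### A criterion for simple connectedness -/

section PathClasses

open unitInterval

variable {E : Type*} [TopologicalSpace E]

lemma homotopic_of_isSimplyConnected {A : Set E} (hA : IsSimplyConnected A) {x y : E}
    (γ γ' : Path x y) (h : ∀ t, γ t ∈ A) (h' : ∀ t, γ' t ∈ A) : γ.Homotopic γ' := by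
  have := hA.simplyConnectedSpace
  let lift (γ : Path x y) (h : ∀ t, γ t ∈ A) :
      Path (⟨x, by simpa using h 0⟩ : A) ⟨y, by simpa using h 1⟩ :=
    { toFun := fun t => ⟨γ t, h t⟩
      source' := by simp
      target' := by simp }
  exact (SimplyConnectedSpace.paths_homotopic (lift γ h) (lift γ' h')).map
    ⟨_, continuous_subtype_val⟩

/-- The homotopy classes of paths that start at `e`. -/
abbrev PathsFrom (e : E) : Type _ := Σ x, Path.Homotopic.Quotient e x

namespace PathsFrom

variable {e : E}

/-- `q` is `p` followed by the path `f`. -/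
def Follows (p q : PathsFrom e) (f : I → E) : Prop :=
  ∃ γ : Path p.1 q.1, ⇑γ = f ∧ q.2 = p.2.trans (.mk γ)

/-- A map `φ` and a path `ε` from `e` to `φ e` act on classes of paths by `c ↦ ε · φ(c)`. -/
def push (φ : C(E, E)) (ε : Path e (φ e)) (p : PathsFrom e) : PathsFrom e :=
  ⟨φ p.1, (Path.Homotopic.Quotient.mk ε).trans (p.2.map φ)⟩

lemma Follows.push {p q : PathsFrom e} {f : I → E} (h : Follows p q f) (φ : C(E, E))
    (ε : Path e (φ e)) : Follows (p.push φ ε) (q.push φ ε) (φ ∘ f) := by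
  obtain ⟨γ, rfl, h⟩ := h
  refine ⟨γ.map φ.continuous, rfl, ?_⟩
  obtain ⟨x, c⟩ := p
  obtain ⟨y, d⟩ := q
  dsimp only at h γ
  subst h
  induction c with | mk c =>
  simp only [PathsFrom.push, ← Path.Homotopic.Quotient.mk_trans, ← Path.Homotopic.Quotient.mk_map]
  rw [Path.map_trans]
  simp only [Path.Homotopic.Quotient.mk_trans, Path.Homotopic.Quotient.trans_assoc]

lemma push_congr {φ φ' : C(E, E)} {ε : Path e (φ e)} {ε' : Path e (φ' e)} (h : φ = φ')
    (hε : ε.Homotopic (ε'.cast rfl (by rw [h]))) (p : PathsFrom e) :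
    p.push φ ε = p.push φ' ε' := by
  subst h
  have h1 : Path.Homotopic.Quotient.mk ε = .mk ε' := Path.Homotopic.Quotient.eq.2 hε
  simp only [push, h1]

lemma push_push (φ ψ : C(E, E)) (ε : Path e (φ e)) (δ : Path e (ψ e)) (p : PathsFrom e) :
    (p.push ψ δ).push φ ε =
      p.push (φ.comp ψ) (ε.trans (δ.map φ.continuous) : Path e (φ (ψ e))) := by
  obtain ⟨x, c⟩ := p
  induction c with | mk c =>
  simp only [push]
  refine congrArg (Sigma.mk (φ (ψ x))) ?_
  simp only [← Path.Homotopic.Quotient.mk_trans, ← Path.Homotopic.Quotient.mk_map]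
  rw [Path.map_trans]
  simp only [Path.Homotopic.Quotient.mk_trans]
  exact (Path.Homotopic.Quotient.trans_assoc _ _ _).symm

lemma push_id (p : PathsFrom e) : p.push (ContinuousMap.id E) (Path.refl e) = p := by
  obtain ⟨x, c⟩ := p
  induction c with | mk c =>
  simp only [push]
  refine congrArg (Sigma.mk x) ?_
  exact Path.Homotopic.Quotient.refl_trans _

lemma follows_subpath_trans {p q r : PathsFrom e} {x y : E} (γ : Path x y) {t₀ t₁ t₂ : I}
    (h : Follows p q (γ.subpath t₀ t₁)) (h' : Follows q r (γ.subpath t₁ t₂)) :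
    Follows p r (γ.subpath t₀ t₂) := by
  obtain ⟨p, c⟩ := p
  obtain ⟨q, d⟩ := q
  obtain ⟨r, f⟩ := r
  obtain ⟨δ, hδ, h⟩ := h
  obtain ⟨δ', hδ', h'⟩ := h'
  dsimp only at δ δ' h h'
  have hp : p = γ t₀ := by simpa using congrFun hδ 0
  have hq : q = γ t₁ := by simpa using congrFun hδ 1
  have hr : r = γ t₂ := by simpa using congrFun hδ' 1
  subst hp hq hr
  have e₁ : δ = γ.subpath t₀ t₁ := Path.ext hδ
  have e₂ : δ' = γ.subpath t₁ t₂ := Path.ext hδ'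
  subst e₁ e₂
  refine ⟨γ.subpath t₀ t₂, rfl, ?_⟩
  dsimp only
  have h3 : Path.Homotopic.Quotient.mk (γ.subpath t₀ t₂) =
      (Path.Homotopic.Quotient.mk (γ.subpath t₀ t₁)).trans (.mk (γ.subpath t₁ t₂)) := by
    rw [← Path.Homotopic.Quotient.mk_trans]
    exact (Path.Homotopic.Quotient.eq.2 ⟨Path.Homotopy.subpathTransSubpath γ t₀ t₁ t₂⟩).symm
  rw [h', h, h3, Path.Homotopic.Quotient.trans_assoc]

lemma follows_refl (p : PathsFrom e) (f : I → E) (h : ∀ t, f t = p.1) : Follows p p f :=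
  ⟨Path.refl p.1, funext fun t => (h t).symm, (Path.Homotopic.Quotient.trans_refl _).symm⟩

end PathsFrom

/-- A space is simply connected if there is a choice of a class `a x` of paths from `e` to every
point `x` that is compatible with all short paths: after subdivision, `a x` followed by any path `γ`
from `x` to `y` is `a y`, which determines the class of `γ`. -/
theorem simplyConnectedSpace_of_section {e : E} (a : E → PathsFrom e) (ha : ∀ x, (a x).1 = x)
    (hloc : ∀ x, ∃ U : Set E, IsOpen U ∧ x ∈ U ∧ ∀ f : C(I, E), (∀ t, f t ∈ U) →
      PathsFrom.Follows (a (f 0)) (a (f 1)) f) : SimplyConnectedSpace E := by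
  choose U hU hxU hfU using hloc
  have key : ∀ {x y : E} (γ : Path x y), PathsFrom.Follows (a x) (a y) γ := by
    intro x y γ
    obtain ⟨t, h0, hmono, ⟨n, hn⟩, ht⟩ := exists_monotone_Icc_subset_open_cover_unitInterval
      (c := fun z : E => γ ⁻¹' U z) (fun z => (hU z).preimage γ.continuous)
      (fun s _ => Set.mem_iUnion.2 ⟨γ s, hxU _⟩)
    have step : ∀ m, PathsFrom.Follows (a (γ 0)) (a (γ (t m))) (γ.subpath 0 (t m)) := by
      intro m
      induction m with
      | zero =>
        rw [h0]
        exact PathsFrom.follows_refl _ _ fun s => by simp [ha]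
      | succ m ih =>
        refine PathsFrom.follows_subpath_trans γ ih ?_
        obtain ⟨z, hz⟩ := ht m
        have h1 := hfU z (γ.subpath (t m) (t (m + 1))).toContinuousMap (fun s => by
          have : γ.subpath (t m) (t (m + 1)) s ∈ γ '' Set.Icc (t m) (t (m + 1)) := by
            rw [← Path.range_subpath_of_le γ _ _ (hmono m.le_succ)]
            exact ⟨s, rfl⟩
          obtain ⟨r, hr, hrs⟩ := this
          change γ.subpath (t m) (t (m + 1)) s ∈ U z
          rw [← hrs]
          exact hz hr)
        simpa using h1
    have h1 := step n
    rw [hn n le_rfl] at h1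
    simpa using h1
  refine simply_connected_iff_paths_homotopic'.2 ⟨?_, ?_⟩
  · have hj : ∀ x, Joined e x := fun x => by
      have := (a x).2
      rw [ha] at this
      induction this with | mk γ => exact ⟨γ⟩
    exact ⟨⟨e⟩, fun x y => (hj x).symm.trans (hj y)⟩
  · intro x y γ γ'
    obtain ⟨δ, hδ, h⟩ := key γ
    obtain ⟨δ', hδ', h'⟩ := key γ'
    have hx := ha x
    have hy := ha y
    generalize a x = p at *
    generalize a y = q at *
    subst hx hy
    have e₁ : δ = γ := Path.ext hδ
    have e₂ : δ' = γ' := Path.ext hδ'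
    subst e₁ e₂
    rw [h] at h'
    have h2 := congrArg (Path.Homotopic.Quotient.trans p.2.symm) h'
    rw [← Path.Homotopic.Quotient.trans_assoc, ← Path.Homotopic.Quotient.trans_assoc,
      Path.Homotopic.Quotient.symm_trans, Path.Homotopic.Quotient.refl_trans,
      Path.Homotopic.Quotient.refl_trans] at h2
    exact Path.Homotopic.Quotient.exact h2

end PathClasses

/-! ### Fundamental groups and unions of components -/

section ClopenEmbedding

variable {A X : Type*} [TopologicalSpace A] [TopologicalSpace X]

lemma exists_lift_of_isClopen_range {i : A → X} (hi : IsEmbedding i) (hr : IsClopen (Set.range i))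
    {Z : Type*} [TopologicalSpace Z] [PreconnectedSpace Z] {f : Z → X} (hf : Continuous f) {z₀ : Z}
    (h₀ : f z₀ ∈ Set.range i) : ∃ g : Z → A, Continuous g ∧ ∀ z, i (g z) = f z := by
  have h : ∀ z, f z ∈ Set.range i := by
    have := (hr.preimage hf).eq_univ ⟨z₀, h₀⟩
    exact fun z => (Set.eq_univ_iff_forall.1 this) z
  choose g hg using h
  refine ⟨g, hi.continuous_iff.2 ?_, hg⟩
  convert hf using 1
  exact funext hg

/-- An embedding with open and closed image induces isomorphisms of fundamental groups. -/
theorem nonempty_fundamentalGroup_mulEquiv_of_isClopen_range {i : A → X} (hi : IsEmbedding i)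
    (hr : IsClopen (Set.range i)) (a : A) :
    Nonempty (FundamentalGroup A a ≃* FundamentalGroup X (i a)) := by
  let j : C(A, X) := ⟨i, hi.continuous⟩
  refine ⟨MulEquiv.ofBijective (FundamentalGroup.map j a) ⟨?_, ?_⟩⟩
  · intro c d h
    change Path.Homotopic.Quotient a a at c d
    induction c with | mk γ =>
    induction d with | mk γ' =>
    have h : Path.Homotopic.Quotient.mk (γ.map hi.continuous) = .mk (γ'.map hi.continuous) := h
    obtain ⟨F⟩ := Path.Homotopic.Quotient.exact h
    obtain ⟨g, hg, hgF⟩ := exists_lift_of_isClopen_range hi hr F.continuous (z₀ := (0, 0))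
      ⟨a, by simp⟩
    refine Path.Homotopic.Quotient.eq.2 ⟨⟨⟨⟨g, hg⟩, ?_, ?_⟩, ?_⟩⟩
    · exact fun t => hi.injective (by simp [hgF])
    · exact fun t => hi.injective (by simp [hgF])
    · intro t x hx
      refine hi.injective ?_
      change i (g (t, x)) = i (γ x)
      rw [hgF]
      rcases hx with rfl | rfl <;> simp
  · intro c
    change Path.Homotopic.Quotient (i a) (i a) at c
    induction c with | mk γ =>
    obtain ⟨g, hg, hgγ⟩ := exists_lift_of_isClopen_range hi hr γ.continuous (z₀ := 0) ⟨a, by simp⟩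
    refine ⟨Path.Homotopic.Quotient.mk ⟨⟨g, hg⟩, hi.injective (by simp [hgγ]),
      hi.injective (by simp [hgγ])⟩, ?_⟩
    change Path.Homotopic.Quotient.mk _ = _
    congr 1
    ext t
    exact hgγ t

end ClopenEmbedding

namespace SmoothFan

variable {Δ : SmoothFan N}

/-! ### Generators of the local groups -/

/-- The edge of the fan spanned by a generator of a cone. -/
def edgeOf {ι : Type*} [Finite ι] (b : Module.Basis ι ℤ N) {s : Set ι}
    (hσ : coneOf (b '' s) ∈ Δ.cones) (i : s) : Δ.Edge :=
  ⟨b i, isPrimitive_basis b i, Δ.face_mem _ hσ _ (by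
    have := isFace_basis b (s' := {i.1}) (s := s) (by simp)
    rwa [Set.image_singleton] at this)⟩

lemma edgeOf_mem {ι : Type*} [Finite ι] (b : Module.Basis ι ℤ N) {s : Set ι}
    (hσ : coneOf (b '' s) ∈ Δ.cones) (i : s) :
    (1 : ℝ) ⊗ₜ[ℤ] (edgeOf b hσ i).1 ∈ coneOf (b '' s) := basis_mem b s i

/-- Homomorphisms on a local group are determined by their values on the `t_v`. -/
lemma localHom_ext {G : Type*} [Group G] {σ : Δ.Cone} {f f' : Δ.cplx.grp σ →* G}
    (h : ∀ (v : Δ.Edge) (hv : (1 : ℝ) ⊗ₜ[ℤ] v.1 ∈ σ.1),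
      f (Δ.tLoc σ v.1 hv) = f' (Δ.tLoc σ v.1 hv)) : f = f' := by
  obtain ⟨σ, hσ⟩ := σ
  obtain ⟨b, s, rfl⟩ := Δ.smooth σ hσ
  exact stabHom_ext b s fun i => h (edgeOf b hσ i) (edgeOf_mem b hσ i)

/-- The ray of the fan along an edge. -/
def ray (v : Δ.Edge) : Δ.Cone := ⟨coneOf {v.1}, v.2.2⟩

lemma mem_ray (v : Δ.Edge) : (1 : ℝ) ⊗ₜ[ℤ] v.1 ∈ (ray v).1 := Submodule.subset_span ⟨v.1, rfl, rfl⟩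

lemma ray_le {v : Δ.Edge} {σ : Δ.Cone} (hv : (1 : ℝ) ⊗ₜ[ℤ] v.1 ∈ σ.1) : ray v ≤ σ := by
  refine Submodule.span_le.2 ?_
  rintro _ ⟨w, rfl, rfl⟩
  exact hv

lemma hat_s {G : Type*} [Group G] (β : SimpleMorphism Δ.cplx G) (v : Δ.Edge) :
    Δ.hat β (Δ.s v) = β.hom (ray v) (Δ.tLoc (ray v) v.1 (mem_ray v)) :=
  PresentedGroup.toGroup.of _

lemma hom_tLoc {G : Type*} [Group G] (β : SimpleMorphism Δ.cplx G) {σ : Δ.Cone} (v : Δ.Edge)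
    (hv : (1 : ℝ) ⊗ₜ[ℤ] v.1 ∈ σ.1) : β.hom σ (Δ.tLoc σ v.1 hv) = Δ.hat β (Δ.s v) := by
  rw [hat_s, ← β.compat (ray_le hv)]
  rfl

lemma iota_tLoc {σ : Δ.Cone} (v : Δ.Edge) (hv : (1 : ℝ) ⊗ₜ[ℤ] v.1 ∈ σ.1) :
    Δ.iota.hom σ (Δ.tLoc σ v.1 hv) = Δ.s v :=
  (Δ.existsUnique_iota σ).choose_spec.1 v hv

/-- Every simple morphism factors through `ι`. -/
lemma hat_iota {G : Type*} [Group G] (β : SimpleMorphism Δ.cplx G) (σ : Δ.Cone)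
    (c : Δ.cplx.grp σ) : Δ.hat β (Δ.iota.hom σ c) = β.hom σ c := by
  have : (Δ.hat β).comp (Δ.iota.hom σ) = β.hom σ := localHom_ext fun v hv => by
    rw [MonoidHom.comp_apply, iota_tLoc, hom_tLoc]
  exact DFunLike.congr_fun this c

/-- A simple morphism through which an injective one factors is injective on the local groups. -/
lemma isInjective_of_comp {G K : Type*} [Group G] [Group K] {β : SimpleMorphism Δ.cplx G}
    {β' : SimpleMorphism Δ.cplx K} {f : G →* K} (hf : ∀ τ c, f (β.hom τ c) = β'.hom τ c)
    (h : β'.IsInjective) : β.IsInjective := by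
  intro τ c c' hc
  refine h τ ?_
  rw [← hf, hc, hf]

lemma iota_isInjective : Δ.iota.IsInjective := isInjective_of_comp (hat_iota Δ.phi) phi_isInjective

lemma s_inv (v : Δ.Edge) : (Δ.s v)⁻¹ = Δ.s v := inv_eq_of_mul_eq_one_left (Δ.s_sq v)

/-- The special subgroup `W_σ` is generated by the `s_v` for the edges `v` of `σ`. -/
lemma range_iota_le (σ : Δ.Cone) : (Δ.iota.hom σ).range ≤
    Subgroup.closure {w | ∃ v : Δ.Edge, (1 : ℝ) ⊗ₜ[ℤ] v.1 ∈ σ.1 ∧ w = Δ.s v} := by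
  obtain ⟨σ, hσ⟩ := σ
  obtain ⟨b, s, rfl⟩ := Δ.smooth σ hσ
  set C := Subgroup.closure {w | ∃ v : Δ.Edge, (1 : ℝ) ⊗ₜ[ℤ] v.1 ∈ coneOf (b '' s) ∧ w = Δ.s v}
  have hmem : ∀ i : s, Δ.s (edgeOf b hσ i) ∈ C := fun i =>
    Subgroup.subset_closure ⟨_, edgeOf_mem b hσ i, rfl⟩
  have hpair : ∀ i j : s, coneOf {b i, b j} ∈ Δ.cones := fun i j => by
    refine Δ.face_mem _ hσ _ ?_
    have := isFace_basis b (s' := {i.1, j.1}) (s := s) (by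
      rintro k (rfl | rfl)
      · exact i.2
      · exact j.2)
    rwa [Set.image_pair] at this
  obtain ⟨f, hf⟩ := exists_stabHom b s (G := C) (fun i => ⟨Δ.s (edgeOf b hσ i), hmem i⟩)
    (fun i => Subtype.ext (Δ.s_sq _))
    (fun i j => Subtype.ext (Δ.s_comm (v := edgeOf b hσ i) (w := edgeOf b hσ j) (hpair i j)))
  have e : Δ.iota.hom ⟨_, hσ⟩ = C.subtype.comp f := stabHom_ext b s fun i => by
    rw [MonoidHom.comp_apply, hf]
    exact iota_tLoc (edgeOf b hσ i) (edgeOf_mem b hσ i)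
  rw [e]
  rintro _ ⟨c, rfl⟩
  exact (f c).2

lemma closure_induction_s {A : Set Δ.Edge} {P : Δ.W → Prop} (one : P 1)
    (mul : ∀ v ∈ A, ∀ w, P w → P (Δ.s v * w)) {w : Δ.W}
    (hw : w ∈ Subgroup.closure (Δ.s '' A)) : P w := by
  induction hw using Subgroup.closure_induction_left with
  | one => exact one
  | mul_left x hx y _ ih =>
    obtain ⟨v, hv, rfl⟩ := hx
    exact mul v hv y ih
  | inv_mul_cancel x hx y _ ih =>
    obtain ⟨v, hv, rfl⟩ := hx
    rw [s_inv]
    exact mul v hv y ih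

lemma W_induction {P : Δ.W → Prop} (one : P 1) (mul : ∀ v w, P w → P (Δ.s v * w)) (w : Δ.W) :
    P w := by
  refine closure_induction_s (A := Set.univ) one (fun v _ => mul v) ?_
  rw [Set.image_univ]
  exact (PresentedGroup.closure_range_of _).symm ▸ Subgroup.mem_top w

lemma range_iota_induction {σ : Δ.Cone} {P : Δ.W → Prop} (one : P 1)
    (mul : ∀ v : Δ.Edge, (1 : ℝ) ⊗ₜ[ℤ] v.1 ∈ σ.1 → ∀ w, P w → P (Δ.s v * w)) {w : Δ.W}
    (hw : w ∈ (Δ.iota.hom σ).range) : P w := by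
  refine closure_induction_s (A := {v | (1 : ℝ) ⊗ₜ[ℤ] v.1 ∈ σ.1}) one mul ?_
  refine Subgroup.closure_mono ?_ (range_iota_le σ hw)
  rintro _ ⟨v, hv, rfl⟩
  exact ⟨v, hv, rfl⟩

lemma s_mem_range_iota {σ : Δ.Cone} {v : Δ.Edge} (hv : (1 : ℝ) ⊗ₜ[ℤ] v.1 ∈ σ.1) :
    Δ.s v ∈ (Δ.iota.hom σ).range := ⟨_, iota_tLoc v hv⟩

/-! ### The universal cover is simply connected -/

/-- The set `W_σ (U_σ)₊` in `X̃` is mapped homeomorphically onto `G_σ (U_σ)₊` in `X`. -/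
lemma isSimplyConnected_star (σ : Δ.Cone) : IsSimplyConnected (Glue.star Δ.iota σ) := by
  set f := Glue.map (Δ.hat Δ.phi) (hat_iota Δ.phi) with hfdef
  have himage : f '' Glue.star Δ.iota σ = Glue.star Δ.phi σ := by
    ext z
    constructor
    · rintro ⟨_, ⟨_, ⟨c, rfl⟩, x, hx, rfl⟩, rfl⟩
      exact ⟨_, ⟨c, rfl⟩, x, hx, by rw [← hat_iota Δ.phi]; rfl⟩
    · rintro ⟨_, ⟨c, rfl⟩, x, hx, rfl⟩
      exact ⟨_, ⟨_, ⟨c, rfl⟩, x, hx, rfl⟩, by rw [← hat_iota Δ.phi]; rfl⟩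
  have hemb : IsEmbedding ((Glue.star Δ.iota σ).domRestrict (gluePhi ∘ f)) := by
    refine (IsOpenEmbedding.of_continuous_injective_isOpenMap ?_ ?_ ?_).isEmbedding
    · exact (gluePhi.continuous.comp (Glue.continuous_map _ _)).comp continuous_subtype_val
    · refine Set.injOn_iff_injective.1 ?_
      exact gluePhi.injective.comp_injOn
        (Glue.map_injOn_star _ (hat_iota Δ.phi) phi_isInjective σ)
    · exact (gluePhi.isOpenMap.comp (Glue.isOpenMap_map _ _)).domRestrict (Glue.isOpen_star σ)
  have h := isSimplyConnected_image_star_phi (Δ := Δ) σ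
  rw [← himage, ← Set.image_comp, ← Set.range_domRestrict] at h
  exact hemb.toHomeomorph.toHomotopyEquiv.simplyConnectedSpace_iff.2 h

variable (Δ) in
/-- The cone `{0}`. -/
def zeroCone : Δ.Cone := ⟨coneOf ∅, exists_coneOf_empty_mem Δ⟩

variable (Δ) in
/-- The unit of the torus, as a point of `X₊`. -/
def unitPoint : Δ.XPos := distPoint (zeroCone Δ)

lemma suppCone_unitPoint_le (σ : Δ.Cone) : suppCone (unitPoint Δ : Δ.X) ≤ σ := by
  rw [unitPoint, suppCone_distPoint]
  exact coneOf_empty_le σ.1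

variable (Δ) in
/-- The base point of the universal cover. -/
def base : Δ.XTilde := Glue.mk Δ Δ.iota 1 (unitPoint Δ)

lemma base_mem_star (σ : Δ.Cone) : base Δ ∈ Glue.star Δ.iota σ :=
  Glue.mk_mem_star_iff.2 ⟨one_mem _, suppCone_unitPoint_le σ⟩

lemma exists_path_star {σ : Δ.Cone} {x y : Δ.XTilde} (hx : x ∈ Glue.star Δ.iota σ)
    (hy : y ∈ Glue.star Δ.iota σ) : ∃ γ : Path x y, ∀ t, γ t ∈ Glue.star Δ.iota σ :=
  (isSimplyConnected_star σ).isPathConnected.joinedIn x hx y hy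

/-- Left multiplication by `w` on the universal cover. -/
def smulMap (w : Δ.W) : C(Δ.XTilde, Δ.XTilde) := ⟨(w • ·), continuous_const_smul w⟩

lemma smulMap_comp (w w' : Δ.W) : (smulMap w).comp (smulMap w') = smulMap (w * w') :=
  ContinuousMap.ext fun z => (mul_smul w w' z).symm

/-- A path from the base point to its image under `s_v`, inside `W_σ (U_σ)₊` for the ray `σ`
of `v`. -/
def edgePath (v : Δ.Edge) : Path (base Δ) (smulMap (Δ.s v) (base Δ)) :=
  (exists_path_star (base_mem_star (ray v))
    (Glue.smul_mem_star (s_mem_range_iota (mem_ray v)) (base_mem_star (ray v)))).choose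

lemma edgePath_mem {v : Δ.Edge} {σ : Δ.Cone} (hv : (1 : ℝ) ⊗ₜ[ℤ] v.1 ∈ σ.1) (t : unitInterval) :
    edgePath v t ∈ Glue.star Δ.iota σ :=
  Glue.star_mono (ray_le hv) ((exists_path_star (base_mem_star (ray v))
    (Glue.smul_mem_star (s_mem_range_iota (mem_ray v)) (base_mem_star (ray v)))).choose_spec t)

/-- A path from the base point to `[1, x]`, inside `W_σ (U_σ)₊` for the cone `σ` with
`x ∈ (O_σ)₊`. -/
def radialPath (x : Δ.XPos) : Path (base Δ) (Glue.mk Δ Δ.iota 1 x) :=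
  (exists_path_star (base_mem_star (suppCone (x : Δ.X)))
    (Glue.mk_mem_star_iff.2 ⟨one_mem _, le_rfl⟩)).choose

lemma radialPath_mem {x : Δ.XPos} {σ : Δ.Cone} (hx : suppCone (x : Δ.X) ≤ σ) (t : unitInterval) :
    radialPath x t ∈ Glue.star Δ.iota σ :=
  Glue.star_mono hx ((exists_path_star (base_mem_star (suppCone (x : Δ.X)))
    (Glue.mk_mem_star_iff.2 ⟨one_mem _, le_rfl⟩)).choose_spec t)

/-- The action of a generator on the classes of paths from the base point. -/
def pushEdge (v : Δ.Edge) : PathsFrom (base Δ) → PathsFrom (base Δ) :=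
  PathsFrom.push (smulMap (Δ.s v)) (edgePath v)

lemma edgePath_trans_mem {v : Δ.Edge} {σ : Δ.Cone} (hv : (1 : ℝ) ⊗ₜ[ℤ] v.1 ∈ σ.1)
    {x : Δ.XTilde} (γ : Path (base Δ) x) (hγ : ∀ t, γ t ∈ Glue.star Δ.iota σ) (t : unitInterval) :
    (edgePath v).trans (γ.map (smulMap (Δ.s v)).continuous) t ∈
      Glue.star Δ.iota σ := by
  have h : Set.range ((edgePath v).trans
      (γ.map (smulMap (Δ.s v)).continuous)) ⊆ Glue.star Δ.iota σ := by
    rw [Path.trans_range, Set.union_subset_iff]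
    constructor
    · rintro _ ⟨t, rfl⟩
      exact edgePath_mem hv t
    · rintro _ ⟨t, rfl⟩
      exact Glue.smul_mem_star (s_mem_range_iota hv) (hγ t)
  exact h ⟨t, rfl⟩

lemma pushEdge_involutive (v : Δ.Edge) : Function.Involutive (pushEdge v) := by
  intro p
  rw [pushEdge, PathsFrom.push_push]
  refine (PathsFrom.push_congr ?_ ?_ p).trans (PathsFrom.push_id p)
  · rw [smulMap_comp, s_sq]
    exact ContinuousMap.ext fun z => one_smul _ z
  · exact homotopic_of_isSimplyConnected (isSimplyConnected_star (ray v)) _ _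
      (edgePath_trans_mem (mem_ray v) (edgePath v) (edgePath_mem (mem_ray v)))
      fun _ => base_mem_star _

lemma pushEdge_comm {v w : Δ.Edge} (h : coneOf {v.1, w.1} ∈ Δ.cones) (p : PathsFrom (base Δ)) :
    pushEdge v (pushEdge w p) = pushEdge w (pushEdge v p) := by
  rw [pushEdge, pushEdge, PathsFrom.push_push, PathsFrom.push_push]
  have hv : (1 : ℝ) ⊗ₜ[ℤ] v.1 ∈ coneOf {v.1, w.1} := Submodule.subset_span ⟨v.1, by simp, rfl⟩
  have hw : (1 : ℝ) ⊗ₜ[ℤ] w.1 ∈ coneOf {v.1, w.1} := Submodule.subset_span ⟨w.1, by simp, rfl⟩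
  refine PathsFrom.push_congr ?_ ?_ p
  · rw [smulMap_comp, smulMap_comp, (Δ.s_comm h).eq]
  · exact homotopic_of_isSimplyConnected (isSimplyConnected_star ⟨_, h⟩) _ _
      (edgePath_trans_mem (σ := ⟨_, h⟩) hv (edgePath w) (edgePath_mem (σ := ⟨_, h⟩) hw))
      (edgePath_trans_mem (σ := ⟨_, h⟩) hw (edgePath v) (edgePath_mem (σ := ⟨_, h⟩) hv))

variable (Δ) in
/-- The action of `W` on the classes of paths from the base point. The relations of `W` hold
because the loops they give lie in the simply connected sets `W_σ (U_σ)₊`, with `σ` a ray or the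
cone spanned by two commuting generators. -/
def pathAction : Δ.W →* Equiv.Perm (PathsFrom (base Δ)) :=
  PresentedGroup.toGroup (f := fun v => (pushEdge_involutive v).toPerm) (by
    have hsq : ∀ v : Δ.Edge, (pushEdge_involutive v).toPerm * (pushEdge_involutive v).toPerm = 1 :=
      fun v => Equiv.ext (pushEdge_involutive v)
    rintro r (⟨v, rfl⟩ | ⟨v, w, hvw, rfl⟩)
    · rw [map_pow, FreeGroup.lift_apply_of, sq, hsq]
    · rw [map_pow, map_mul, FreeGroup.lift_apply_of, FreeGroup.lift_apply_of, sq]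
      have hc : Commute (pushEdge_involutive v).toPerm (pushEdge_involutive w).toPerm :=
        Equiv.ext (pushEdge_comm hvw)
      rw [← sq, hc.mul_pow, sq, sq, hsq, hsq, one_mul])

lemma pathAction_s (v : Δ.Edge) (p : PathsFrom (base Δ)) :
    pathAction Δ (Δ.s v) p = pushEdge v p :=
  DFunLike.congr_fun (PresentedGroup.toGroup.of (f := fun v => (pushEdge_involutive v).toPerm) _) p

lemma pathAction_fst (w : Δ.W) (p : PathsFrom (base Δ)) : (pathAction Δ w p).1 = w • p.1 := by
  induction w using W_induction with
  | one => simp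
  | mul v w ih =>
    rw [map_mul, Equiv.Perm.mul_apply, pathAction_s, mul_smul, ← ih]
    rfl

lemma follows_pathAction (w : Δ.W) {p q : PathsFrom (base Δ)} {f : unitInterval → Δ.XTilde}
    (h : PathsFrom.Follows p q f) :
    PathsFrom.Follows (pathAction Δ w p) (pathAction Δ w q) (fun t => w • f t) := by
  induction w using W_induction with
  | one => simpa using h
  | mul v w ih =>
    rw [map_mul, Equiv.Perm.mul_apply, Equiv.Perm.mul_apply, pathAction_s, pathAction_s]
    have e : (fun t => (Δ.s v * w) • f t) = smulMap (Δ.s v) ∘ fun t => w • f t :=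
      funext fun t => mul_smul _ _ _
    rw [e]
    exact ih.push (smulMap (Δ.s v)) (edgePath v)

/-- The class of the radial path to `[1, x]`. -/
def radialClass (x : Δ.XPos) : PathsFrom (base Δ) := ⟨Glue.mk Δ Δ.iota 1 x, .mk (radialPath x)⟩

/-- The special subgroup `W_σ` keeps classes of paths inside `W_σ (U_σ)₊`. -/
lemma exists_path_pathAction {σ : Δ.Cone} {w : Δ.W} (hw : w ∈ (Δ.iota.hom σ).range) {x : Δ.XPos}
    (hx : suppCone (x : Δ.X) ≤ σ) :
    ∃ (z : Δ.XTilde) (γ : Path (base Δ) z), (∀ t, γ t ∈ Glue.star Δ.iota σ) ∧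
      pathAction Δ w (radialClass x) = ⟨z, .mk γ⟩ := by
  refine range_iota_induction (σ := σ) (P := fun w => ∃ (z : Δ.XTilde) (γ : Path (base Δ) z),
    (∀ t, γ t ∈ Glue.star Δ.iota σ) ∧ pathAction Δ w (radialClass x) = ⟨z, .mk γ⟩) ?_ ?_ hw
  · exact ⟨_, radialPath x, radialPath_mem hx, by rw [map_one]; rfl⟩
  · rintro v hv w ⟨z, γ, hγ, h⟩
    refine ⟨_, _, edgePath_trans_mem hv γ hγ, ?_⟩
    rw [map_mul, Equiv.Perm.mul_apply, h, pathAction_s]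
    rfl

lemma pathAction_radialClass_eq {w w' : Δ.W} {x : Δ.XPos}
    (h : w⁻¹ * w' ∈ (Δ.iota.hom (suppCone (x : Δ.X))).range) :
    pathAction Δ w (radialClass x) = pathAction Δ w' (radialClass x) := by
  obtain ⟨z, γ, hγ, h1⟩ := exists_path_pathAction h le_rfl
  rw [map_mul, map_inv, Equiv.Perm.mul_apply, Equiv.Perm.inv_eq_iff_eq] at h1
  rw [h1]
  congr 1
  have hz : z = Glue.mk Δ Δ.iota 1 x := by
    have h2 := congrArg Sigma.fst h1
    rw [pathAction_fst, pathAction_fst, ← inv_smul_eq_iff, ← mul_smul] at h2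
    refine h2.symm.trans ?_
    change Glue.mk Δ Δ.iota (w⁻¹ * w' * 1) x = _
    refine Glue.mk_eq_mk_iff.2 ⟨rfl, ?_⟩
    simpa using inv_mem h
  subst hz
  have : Path.Homotopic.Quotient.mk γ = .mk (radialPath x) :=
    Path.Homotopic.Quotient.eq.2 (homotopic_of_isSimplyConnected
      (isSimplyConnected_star _) _ _ hγ (radialPath_mem le_rfl))
  rw [this]
  rfl

/-- The choice of the class `w • (radial path to x)` of paths from the base point to `[w, x]`. -/
def pathSection : Δ.XTilde → PathsFrom (base Δ) :=
  Quotient.lift (fun a => pathAction Δ a.1 (radialClass a.2)) (by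
    rintro ⟨w, x⟩ ⟨w', x'⟩ ⟨h, h'⟩
    dsimp only at h h' ⊢
    subst h
    exact pathAction_radialClass_eq (h' _ (mem_orbitPos_iff.2 ⟨x.2, rfl⟩)))

lemma pathSection_mk (w : Δ.W) (x : Δ.XPos) :
    pathSection (Glue.mk Δ Δ.iota w x) = pathAction Δ w (radialClass x) := rfl

instance simplyConnectedSpace_XTilde : SimplyConnectedSpace Δ.XTilde := by
  refine simplyConnectedSpace_of_section pathSection (fun z => ?_) fun z => ?_
  · obtain ⟨w, x, rfl⟩ := Glue.exists_mk z
    rw [pathSection_mk, pathAction_fst]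
    change Glue.mk Δ Δ.iota (w * 1) x = _
    rw [mul_one]
  -- a path inside `w W_σ (U_σ)₊` is translated by `w⁻¹` into the simply connected `W_σ (U_σ)₊`,
  -- which contains the base point and the chosen paths to its points
  · obtain ⟨w, σ, hw⟩ := Glue.exists_mem_smul_star z
    refine ⟨(w⁻¹ • ·) ⁻¹' Glue.star Δ.iota σ, (Glue.isOpen_star σ).preimage
      (continuous_const_smul _), hw, fun f hf => ?_⟩
    obtain ⟨g, hg, x, hx, hgx⟩ := hf 0
    obtain ⟨g', hg', x', hx', hgx'⟩ := hf 1
    dsimp only at hgx hgx'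
    have e : pathSection (f 0) = pathAction Δ w (pathAction Δ g (radialClass x)) := by
      rw [inv_smul_eq_iff.1 hgx, Glue.smul_mk, pathSection_mk, map_mul, Equiv.Perm.mul_apply]
    have e' : pathSection (f 1) = pathAction Δ w (pathAction Δ g' (radialClass x')) := by
      rw [inv_smul_eq_iff.1 hgx', Glue.smul_mk, pathSection_mk, map_mul, Equiv.Perm.mul_apply]
    rw [e, e']
    have e'' : ⇑f = fun t => w • (w⁻¹ • f t) := by
      funext t
      rw [smul_inv_smul]
    rw [e'']
    refine follows_pathAction w ?_
    have hfst : (pathAction Δ g (radialClass x)).1 = w⁻¹ • f 0 := by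
      rw [pathAction_fst, hgx]
      change Glue.mk Δ Δ.iota (g * 1) x = _
      rw [mul_one]
    have hfst' : (pathAction Δ g' (radialClass x')).1 = w⁻¹ • f 1 := by
      rw [pathAction_fst, hgx']
      change Glue.mk Δ Δ.iota (g' * 1) x' = _
      rw [mul_one]
    obtain ⟨y, γ, hγ, h1⟩ := exists_path_pathAction hg hx
    obtain ⟨y', γ', hγ', h1'⟩ := exists_path_pathAction hg' hx'
    rw [h1] at hfst ⊢
    rw [h1'] at hfst' ⊢
    dsimp only at hfst hfst'
    let δ : Path y y' := ⟨⟨fun t => w⁻¹ • f t, (continuous_const_smul _).comp f.continuous⟩,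
      hfst.symm, hfst'.symm⟩
    refine ⟨δ, rfl, ?_⟩
    rw [← Path.Homotopic.Quotient.mk_trans]
    refine Path.Homotopic.Quotient.eq.2 (homotopic_of_isSimplyConnected
      (isSimplyConnected_star σ) _ _ hγ' fun t => ?_)
    have hr : Set.range (γ.trans δ) ⊆ Glue.star Δ.iota σ := by
      rw [Path.trans_range, Set.union_subset_iff]
      constructor
      · rintro _ ⟨t, rfl⟩
        exact hγ t
      · rintro _ ⟨t, rfl⟩
        exact hf t
    exact hr ⟨t, rfl⟩

end SmoothFan

namespace SmoothFan

variable {Δ : SmoothFan N}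

/-! ### The stratification of the developments -/

/-- `V(τ)₊` is the smallest stratum containing `x` iff `x` lies on the orbit of `τ`. -/
lemma VPos_eq_iInter_iff (x : Δ.XPos) (τ : Δ.Cone) :
    (Δ.VPos τ = ⋂ ρ ∈ {ρ | x ∈ Δ.VPos ρ}, Δ.VPos ρ) ↔ τ = suppCone (x : Δ.X) := by
  have e : ⋂ ρ ∈ {ρ | x ∈ Δ.VPos ρ}, Δ.VPos ρ = Δ.VPos (suppCone (x : Δ.X)) := by
    ext y
    simp only [Set.mem_iInter, Set.mem_ofPred_eq, mem_VPos_iff]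
    exact ⟨fun h => h _ le_rfl, fun h ρ hρ => hρ.trans h⟩
  rw [e]
  refine ⟨fun h => ?_, fun h => by rw [h]⟩
  have h1 : distPoint τ ∈ Δ.VPos τ := mem_VPos_iff.2 (suppCone_distPoint τ).ge
  have h2 : distPoint (suppCone (x : Δ.X)) ∈ Δ.VPos (suppCone (x : Δ.X)) :=
    mem_VPos_iff.2 (suppCone_distPoint _).ge
  rw [h, mem_VPos_iff, suppCone_distPoint] at h1
  rw [← h, mem_VPos_iff, suppCone_distPoint] at h2
  exact le_antisymm h2 h1

variable {G : Type*} [Group G] {β : SimpleMorphism Δ.cplx G}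

namespace Development

lemma setoid_iff {a b : G × Δ.XPos} :
    developmentSetoid Δ.VPos β a b ↔ Δ.glueSetoid β a b := by
  refine and_congr_right fun _ => forall_congr' fun τ => ?_
  rw [VPos_eq_iInter_iff, mem_orbitPos_iff, eq_comm]
  exact ⟨fun h h' => h h'.2, fun h h' => h ⟨a.2.2, h'⟩⟩

variable (β) in
/-- The canonical bijection from the development to `G × X₊/∼`. -/
def equivGlue : Δ.D β ≃ Δ.Glue β := Quotient.congrRight fun _ _ => setoid_iff

lemma continuous_mk (g : G) : Continuous (Development.mk Δ.VPos β g) := by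
  have h : Continuous fun y : Δ.VPos (zeroCone Δ) => Development.mk Δ.VPos β g (y : Δ.XPos) := by
    refine continuous_iff_coinduced_le.2 ?_
    exact (le_iSup (fun τ => TopologicalSpace.coinduced
      (fun y : Δ.VPos τ => Development.mk Δ.VPos β g (y : Δ.XPos)) inferInstance)
      (zeroCone Δ)).trans (le_iSup (fun g => ⨆ τ, TopologicalSpace.coinduced
      (fun y : Δ.VPos τ => Development.mk Δ.VPos β g (y : Δ.XPos)) inferInstance) g)
  have hmem : ∀ x : Δ.XPos, x ∈ Δ.VPos (zeroCone Δ) := fun x =>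
    mem_VPos_iff.2 (coneOf_empty_le _)
  exact h.comp (continuous_id.subtype_mk hmem)

variable (β) in
/-- The development of `X₊` is `G × X₊/∼`. The stratum of the cone `{0}` is all of `X₊`, so that
the weak topology is the quotient topology. -/
def homeoGlue : Δ.D β ≃ₜ Δ.Glue β where
  toEquiv := equivGlue β
  continuous_toFun := by
    refine continuous_iSup_dom.2 fun g => continuous_iSup_dom.2 fun τ => ?_
    exact continuous_coinduced_dom.2 ((Glue.continuous_mk g).comp continuous_subtype_val)
  continuous_invFun := Glue.continuous_iff.2 fun g => continuous_mk g

lemma homeoGlue_mk (g : G) (x : Δ.XPos) :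
    homeoGlue β (Development.mk Δ.VPos β g x) = Glue.mk Δ β g x := rfl

lemma homeoGlue_smul (g : G) (z : Δ.D β) : homeoGlue β (g • z) = g • homeoGlue β z := by
  obtain ⟨g', x⟩ := z
  rfl

lemma smul_mk (g g' : G) (x : Δ.XPos) :
    g • Development.mk Δ.VPos β g' x = Development.mk Δ.VPos β (g * g') x := rfl

instance : ContinuousConstSMul G (Δ.D β) where
  continuous_const_smul g := by
    have e : (fun z : Δ.D β => g • z) = (homeoGlue β).symm ∘ (g • ·) ∘ homeoGlue β := by
      funext z
      simp [← homeoGlue_smul]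
    rw [e]
    exact (homeoGlue β).symm.continuous.comp
      ((continuous_const_smul g).comp (homeoGlue β).continuous)

lemma isClosed_iff {A : Set (Δ.D β)} :
    IsClosed A ↔ ∀ g, IsClosed (Development.mk Δ.VPos β g ⁻¹' A) := by
  refine ⟨fun h g => h.preimage (continuous_mk g), fun h => ?_⟩
  rw [← (homeoGlue β).symm.isClosed_preimage, ← isOpen_compl_iff, Glue.isOpen_iff]
  exact fun g => (h g).isOpen_compl

lemma exists_mk (z : Δ.D β) : ∃ (g : G) (x : Δ.XPos), z = Development.mk Δ.VPos β g x := by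
  obtain ⟨g, x⟩ := z
  exact ⟨g, x, rfl⟩

lemma mk_eq_mk_iff {g g' : G} {x x' : Δ.XPos} :
    Development.mk Δ.VPos β g x = Development.mk Δ.VPos β g' x' ↔
      x = x' ∧ g⁻¹ * g' ∈ (β.hom (suppCone (x : Δ.X))).range := by
  rw [← Glue.mk_eq_mk_iff, ← homeoGlue_mk, ← homeoGlue_mk, (homeoGlue β).injective.eq_iff]

lemma mk_mem_stratum_iff {g h : G} {x : Δ.XPos} {τ : Δ.Cone} :
    Development.mk Δ.VPos β g x ∈ Development.stratum Δ.VPos β ⟨τ, (h : G ⧸ (β.hom τ).range)⟩ ↔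
      τ ≤ suppCone (x : Δ.X) ∧ h⁻¹ * g ∈ (β.hom (suppCone (x : Δ.X))).range := by
  constructor
  · rintro ⟨g', y, hg', hy, e⟩
    obtain ⟨rfl, h1⟩ := mk_eq_mk_iff.1 e
    rw [mem_VPos_iff] at hy
    refine ⟨hy, ?_⟩
    have h2 := Glue.range_mono β hy (QuotientGroup.eq.1 hg'.symm)
    simpa [mul_assoc] using mul_mem h2 (inv_mem h1)
  · rintro ⟨hx, h1⟩
    refine ⟨h, x, rfl, mem_VPos_iff.2 hx, mk_eq_mk_iff.2 ⟨rfl, ?_⟩⟩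
    simpa using inv_mem h1

lemma stratum_subset_iff {h h' : G} {τ σ : Δ.Cone} :
    Development.stratum Δ.VPos β ⟨σ, (h : G ⧸ (β.hom σ).range)⟩ ⊆
      Development.stratum Δ.VPos β ⟨τ, (h' : G ⧸ (β.hom τ).range)⟩ ↔
      τ ≤ σ ∧ h'⁻¹ * h ∈ (β.hom σ).range := by
  constructor
  · intro hs
    have h1 : Development.mk Δ.VPos β h (distPoint σ) ∈
        Development.stratum Δ.VPos β ⟨σ, (h : G ⧸ (β.hom σ).range)⟩ :=
      mk_mem_stratum_iff.2 ⟨(suppCone_distPoint σ).ge, by simp⟩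
    have h2 := mk_mem_stratum_iff.1 (hs h1)
    rwa [suppCone_distPoint] at h2
  · rintro ⟨hle, hm⟩ z hz
    obtain ⟨g, x, rfl⟩ := exists_mk z
    rw [mk_mem_stratum_iff] at hz ⊢
    refine ⟨hle.trans hz.1, ?_⟩
    simpa [mul_assoc] using mul_mem (Glue.range_mono β hz.1 hm) hz.2

lemma stratum_injective : Function.Injective (Development.stratum Δ.VPos β) := by
  rintro ⟨σ, c⟩ ⟨τ, c'⟩ e
  obtain ⟨h, rfl⟩ := QuotientGroup.mk_surjective c
  obtain ⟨h', rfl⟩ := QuotientGroup.mk_surjective c'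
  obtain ⟨h1, h2⟩ := stratum_subset_iff.1 e.le
  obtain ⟨h3, -⟩ := stratum_subset_iff.1 e.ge
  obtain rfl := le_antisymm h3 h1
  rw [QuotientGroup.eq.2 h2]

variable (β) in
theorem isStratification : IsStratification (Development.stratum Δ.VPos β) where
  isClosed := by
    rintro ⟨τ, c⟩
    obtain ⟨h, rfl⟩ := QuotientGroup.mk_surjective c
    refine isClosed_iff.2 fun g => ?_
    have e : Development.mk Δ.VPos β g ⁻¹' Development.stratum Δ.VPos β
          ⟨τ, (h : G ⧸ (β.hom τ).range)⟩ =
        Subtype.val ⁻¹' {p : Δ.X | τ ≤ suppCone p} ∩ ⋃ (σ : Δ.Cone)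
          (_ : h⁻¹ * g ∈ (β.hom σ).range), Subtype.val ⁻¹' {p : Δ.X | σ ≤ suppCone p} := by
      ext x
      simp only [Set.mem_preimage, mk_mem_stratum_iff, Set.mem_inter_iff, Set.mem_ofPred_eq,
        Set.mem_iUnion]
      refine and_congr_right fun _ => ⟨fun hx => ⟨_, hx, le_rfl⟩, ?_⟩
      rintro ⟨σ, hσ, hle⟩
      exact Glue.range_mono β hle hσ
    rw [e]
    exact ((isClosed_le_suppCone τ).preimage continuous_subtype_val).inter
      (isClosed_iUnion_of_finite fun σ => isClosed_iUnion_of_finite fun _ =>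
        (isClosed_le_suppCone σ).preimage continuous_subtype_val)
  cover := by
    refine Set.eq_univ_of_forall fun z => ?_
    obtain ⟨g, x, rfl⟩ := exists_mk z
    exact Set.mem_iUnion.2 ⟨⟨_, (g : G ⧸ (β.hom (suppCone (x : Δ.X))).range)⟩,
      mk_mem_stratum_iff.2 ⟨le_rfl, by simp⟩⟩
  injective := stratum_injective
  inter := by
    rintro ⟨σ, c⟩ ⟨τ, c'⟩ z ⟨hz, hz'⟩
    obtain ⟨h, rfl⟩ := QuotientGroup.mk_surjective c
    obtain ⟨h', rfl⟩ := QuotientGroup.mk_surjective c'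
    obtain ⟨g, x, rfl⟩ := exists_mk z
    refine ⟨⟨_, (g : G ⧸ (β.hom (suppCone (x : Δ.X))).range)⟩,
      mk_mem_stratum_iff.2 ⟨le_rfl, by simp⟩, Set.subset_inter ?_ ?_⟩
    · exact stratum_subset_iff.2 (mk_mem_stratum_iff.1 hz)
    · exact stratum_subset_iff.2 (mk_mem_stratum_iff.1 hz')
  support := by
    intro z
    obtain ⟨g, x, rfl⟩ := exists_mk z
    refine existsUnique_of_exists_of_unique
      ⟨⟨_, (g : G ⧸ (β.hom (suppCone (x : Δ.X))).range)⟩, ?_⟩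
      fun p q hp hq => stratum_injective (hp.trans hq.symm)
    refine Set.Subset.antisymm (Set.subset_iInter₂ ?_) (Set.biInter_subset_of_mem ?_)
    · rintro ⟨τ, c⟩ hz
      obtain ⟨h, rfl⟩ := QuotientGroup.mk_surjective c
      exact stratum_subset_iff.2 (mk_mem_stratum_iff.1 hz)
    · exact mk_mem_stratum_iff.2 ⟨le_rfl, by simp⟩
  coherent := by
    intro A hA
    refine isClosed_iff.2 fun g => ?_
    have h1 := (hA ⟨zeroCone Δ, (g : G ⧸ (β.hom (zeroCone Δ)).range)⟩).preimage (continuous_mk g)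
    convert h1 using 1
    ext x
    simp only [Set.mem_preimage, Set.mem_inter_iff, mk_mem_stratum_iff]
    exact ⟨fun hx => ⟨hx, coneOf_empty_le _, by simp⟩, fun hx => hx.1⟩

lemma image_smul_stratum (g h : G) (τ : Δ.Cone) :
    (fun z : Δ.D β => g • z) '' Development.stratum Δ.VPos β ⟨τ, (h : G ⧸ (β.hom τ).range)⟩ =
      Development.stratum Δ.VPos β ⟨τ, ((g * h : G) : G ⧸ (β.hom τ).range)⟩ := by
  ext z
  obtain ⟨k, x, rfl⟩ := exists_mk z
  rw [mk_mem_stratum_iff, Set.mem_image]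
  constructor
  · rintro ⟨y, hy, e⟩
    rw [← inv_smul_eq_iff.2 e.symm, smul_mk, mk_mem_stratum_iff] at hy
    simpa [mul_assoc] using hy
  · intro hx
    refine ⟨Development.mk Δ.VPos β (g⁻¹ * k) x, mk_mem_stratum_iff.2 ?_, ?_⟩
    · simpa [mul_assoc] using hx
    · simp [smul_mk]

variable (β) in
theorem isStrataPreserving : IsStrataPreserving G (Development.stratum Δ.VPos β) where
  continuous_smul g := continuous_const_smul g
  image_stratum := by
    rintro g ⟨τ, c⟩
    obtain ⟨h, rfl⟩ := QuotientGroup.mk_surjective c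
    exact ⟨_, image_smul_stratum g h τ⟩

variable (β) in
theorem isStrictFundamentalDomain :
    IsStrictFundamentalDomain G (Development.stratum Δ.VPos β)
      (Set.range (Development.mk Δ.VPos β 1)) where
  exists_unique_point z := by
    obtain ⟨g, x, rfl⟩ := exists_mk z
    refine ⟨Development.mk Δ.VPos β 1 x, ⟨⟨x, rfl⟩, g⁻¹, ?_⟩, ?_⟩
    · simp [smul_mk]
    · rintro _ ⟨⟨y, rfl⟩, k, hk⟩
      dsimp only at hk
      rw [smul_mk] at hk
      obtain ⟨rfl, -⟩ := mk_eq_mk_iff.1 hk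
      rfl
  exists_unique_stratum := by
    rintro ⟨τ, c⟩
    obtain ⟨h, rfl⟩ := QuotientGroup.mk_surjective c
    refine ⟨⟨τ, ((1 : G) : G ⧸ (β.hom τ).range)⟩, ⟨?_, h⁻¹, ?_⟩, ?_⟩
    · intro z hz
      obtain ⟨g, x, rfl⟩ := exists_mk z
      rw [mk_mem_stratum_iff] at hz
      exact ⟨x, mk_eq_mk_iff.2 ⟨rfl, hz.2⟩⟩
    · rw [image_smul_stratum, inv_mul_cancel]
    · rintro ⟨σ, c'⟩ ⟨hsub, k, hk⟩
      obtain ⟨h', rfl⟩ := QuotientGroup.mk_surjective c'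
      rw [image_smul_stratum] at hk
      have e := stratum_injective hk
      obtain rfl : τ = σ := congrArg Sigma.fst e
      have h1 : Development.mk Δ.VPos β h' (distPoint τ) ∈
          Development.stratum Δ.VPos β ⟨τ, (h' : G ⧸ (β.hom τ).range)⟩ :=
        mk_mem_stratum_iff.2 ⟨(suppCone_distPoint τ).ge, by simp⟩
      obtain ⟨y, hy⟩ := hsub h1
      obtain ⟨rfl, h2⟩ := mk_eq_mk_iff.1 hy
      rw [suppCone_distPoint] at h2
      rw [QuotientGroup.eq.2 h2]

end Development

end SmoothFan

/-! ### Deck transformations -/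

section Deck

variable {E B Γ : Type*} [TopologicalSpace E] [TopologicalSpace B] [Group Γ] [MulAction Γ E]
  [ContinuousConstSMul Γ E] {p : E → B}

/-- If the fibres of a covering map with connected total space are the orbits of a free action of
a group, then this group is the group of deck transformations: a deck transformation is
determined by its value at one point. -/
theorem nonempty_mulEquiv_deckGroup [ConnectedSpace E] (hp : IsCoveringMap p)
    (hfib : ∀ e e', p e = p e' ↔ e ∈ MulAction.orbit Γ e')
    (hfree : ∀ (γ : Γ) (e : E), γ • e = e → γ = 1) : Nonempty (deckGroup p ≃* Γ) := by
  let F : Γ →* deckGroup p :=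
    { toFun γ := ⟨Homeomorph.smul γ, fun e => (hfib _ _).2 ⟨γ, rfl⟩⟩
      map_one' := Subtype.ext (Homeomorph.ext fun e => one_smul _ e)
      map_mul' γ γ' := Subtype.ext (Homeomorph.ext fun e => mul_smul γ γ' e) }
  have e₀ : E := Classical.arbitrary E
  refine ⟨(MulEquiv.ofBijective F ⟨?_, ?_⟩).symm⟩
  · refine (injective_iff_map_eq_one F).2 fun γ hγ => hfree γ e₀ ?_
    exact DFunLike.congr_fun (congrArg Subtype.val hγ) e₀
  · rintro ⟨f, hf⟩
    obtain ⟨γ, hγ⟩ := (hfib _ _).1 (hf e₀)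
    refine ⟨γ, Subtype.ext (Homeomorph.ext fun e => ?_)⟩
    refine congrFun (hp.eq_of_comp_eq (continuous_const_smul γ) f.continuous ?_ e₀ hγ) e
    funext e
    exact ((hfib _ _).2 ⟨γ, rfl⟩).trans (hf e).symm

omit [TopologicalSpace B] in
lemma exists_mem_deckGroup (hfib : ∀ e e', p e = p e' ↔ e ∈ MulAction.orbit Γ e') {e e' : E}
    (h : p e = p e') : ∃ f ∈ deckGroup p, f e = e' := by
  obtain ⟨γ, hγ⟩ := (hfib _ _).1 h.symm
  exact ⟨Homeomorph.smul γ, fun e => (hfib _ _).2 ⟨γ, rfl⟩, hγ⟩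

end Deck

/-! ### Elementary abelian 2-groups -/

/-- Finite groups of exponent dividing `2` are vector spaces over `ℤ₂`, so that the order determines
them. -/
lemma nonempty_mulEquiv_of_card_eq {A B : Type*} [CommGroup A] [CommGroup B] [Finite A] [Finite B]
    (hA : ∀ a : A, a * a = 1) (hB : ∀ b : B, b * b = 1) (h : Nat.card A = Nat.card B) :
    Nonempty (A ≃* B) := by
  let _ : Module (ZMod 2) (Additive A) := AddCommGroup.zmodModule fun a => by
    rw [two_nsmul]; exact hA a
  let _ : Module (ZMod 2) (Additive B) := AddCommGroup.zmodModule fun b => by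
    rw [two_nsmul]; exact hB b
  have h1 : Module.finrank (ZMod 2) (Additive A) = Module.finrank (ZMod 2) (Additive B) := by
    have h2 : Nat.card (Additive A) = Nat.card (Additive B) := h
    rw [Module.natCard_eq_pow_finrank (K := ZMod 2),
      Module.natCard_eq_pow_finrank (K := ZMod 2) (V := Additive B), Nat.card_zmod] at h2
    exact Nat.pow_right_injective le_rfl h2
  exact ⟨AddEquiv.toMultiplicative (LinearEquiv.ofFinrankEq _ _ h1).toAddEquiv⟩

section ProdHom

variable {ι A : Type*} [CommGroup A] (a : ι → A) (ha : ∀ i, a i * a i = 1)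

/-- The homomorphism `{±1}^ι → A` that sends the `i`-th basis vector to the involution `a i`. -/
def prodInvolution [Fintype ι] : (ι → ℤˣ) →* A :=
  ∏ i, (involutionHom (a i) (ha i)).comp (Pi.evalMonoidHom _ i)

lemma prodInvolution_mulSingle [Fintype ι] [DecidableEq ι] (i : ι) :
    prodInvolution a ha (Pi.mulSingle i (-1)) = a i := by
  rw [prodInvolution, MonoidHom.finsetProd_apply, Finset.prod_eq_single i]
  · simp [involutionHom_neg_one]
  · intro j _ hj
    simp [hj]
  · simp

end ProdHom

/-! ### The group `T₂` and the lattice modulo 2 -/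

section T2

variable {ι : Type*} [Fintype ι] (b : Module.Basis ι ℤ N)

lemma T2.coordEquiv_tElt (v : N) (i : ι) : T2.coordEquiv b (tElt v) i = (-1) ^ b.repr v i := rfl

/-- The homomorphism `N ⊗ ℤ₂ → T₂` that sends `v ⊗ 1` to `t_v`. It is an isomorphism. -/
def T2.ofModTwo : Multiplicative (ZMod 2 ⊗[ℤ] N) →* T2 N :=
  (T2.coordEquiv b).symm.toMonoidHom.comp
    { toFun x i := (-1) ^ (b.baseChange (ZMod 2)).repr x.toAdd i
      map_one' := by
        funext i
        simp
      map_mul' x y := by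
        funext i
        simp [uzpow_add] }

lemma T2.coordEquiv_ofModTwo (x : ZMod 2 ⊗[ℤ] N) (i : ι) :
    T2.coordEquiv b (T2.ofModTwo b (Multiplicative.ofAdd x)) i =
      (-1) ^ (b.baseChange (ZMod 2)).repr x i :=
  congrFun ((T2.coordEquiv b).apply_symm_apply _) i

lemma T2.ofModTwo_tmul (v : N) : T2.ofModTwo b (Multiplicative.ofAdd (1 ⊗ₜ v)) = tElt v := by
  apply (T2.coordEquiv b).injective
  funext i
  rw [T2.coordEquiv_ofModTwo, T2.coordEquiv_tElt, Module.Basis.baseChange_repr_tmul]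
  rw [zsmul_one, uzpow_intCast]

lemma neg_one_uzpow_eq_one_iff (z : ZMod 2) : (-1 : ℤˣ) ^ z = 1 ↔ z = 0 := by
  revert z
  decide

lemma T2.ofModTwo_injective : Function.Injective (T2.ofModTwo b) := by
  refine (injective_iff_map_eq_one _).2 fun x hx => ?_
  obtain ⟨x, rfl⟩ := Multiplicative.ofAdd.surjective x
  have h0 : x = 0 := by
    apply (b.baseChange (ZMod 2)).repr.injective
    ext i
    have h1 := T2.coordEquiv_ofModTwo b x i
    rw [hx, map_one, Pi.one_apply, eq_comm, neg_one_uzpow_eq_one_iff] at h1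
    rw [h1, map_zero, Finsupp.zero_apply]
  rw [h0, ofAdd_zero]

lemma T2.ofModTwo_surjective : Function.Surjective (T2.ofModTwo b) := by
  intro t
  refine ⟨Multiplicative.ofAdd (∑ i, (if t (Multiplicative.ofAdd (b.coord i)) = 1 then (0 : ZMod 2)
    else 1) • (b.baseChange (ZMod 2)) i), (T2.coordEquiv b).injective (funext fun i => ?_)⟩
  rw [T2.coordEquiv_ofModTwo, Module.Basis.repr_sum_self]
  change _ = t (Multiplicative.ofAdd (b.coord i))
  rcases Int.units_eq_one_or (t (Multiplicative.ofAdd (b.coord i))) with h | h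
  · rw [h, if_pos rfl, uzpow_zero]
  · rw [h, if_neg (by decide), uzpow_one]

lemma tElt_mul_self (v : N) : tElt v * tElt v = 1 := MonoidHom.ext fun _ => Int.units_mul_self _

end T2

namespace SmoothFan

variable {Δ : SmoothFan N}

/-! ### Components and fundamental groups of developments -/

section

variable {G : Type*} [Group G] {β : SimpleMorphism Δ.cplx G}

/-- The image of the connected space `X̃` in the development is open and closed. -/
lemma Glue.connectedSpace_iff : ConnectedSpace (Δ.Glue β) ↔ Function.Surjective (Δ.hat β) := by
  constructor
  · intro _ g
    have h := (Glue.isClopen_range_map (Δ.hat β) (hat_iota β)).eq_univ ⟨_, base Δ, rfl⟩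
    exact (Glue.mk_mem_range_map_iff (Δ.hat β) (hat_iota β) g (unitPoint Δ)).1
      (h ▸ Set.mem_univ _)
  · intro h
    refine Function.Surjective.connectedSpace (f := Glue.map (Δ.hat β) (hat_iota β)) ?_
      (Glue.continuous_map _ _)
    intro z
    obtain ⟨g, x, rfl⟩ := Glue.exists_mk z
    obtain ⟨w, rfl⟩ := h g
    exact ⟨Glue.mk Δ Δ.iota w x, rfl⟩

/-- The image of `X̃` in the development is a union of components, and `X̃` is its simply connected
quotient covering with group `ker β̂`. The translates of this image cover the development. -/
theorem Glue.nonempty_fundamentalGroup_mulEquiv (hβ : β.IsInjective) (z : Δ.Glue β) :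
    Nonempty (FundamentalGroup (Δ.Glue β) z ≃* (Δ.hat β).ker) := by
  obtain ⟨g, x, rfl⟩ := Glue.exists_mk z
  have hq := Glue.isQuotientCoveringMap_map (Δ.hat β) (hat_iota β) hβ
  let z' : Set.range (Glue.map (Δ.hat β) (hat_iota β)) :=
    Set.rangeFactorization _ (Glue.mk Δ Δ.iota 1 x)
  have h1 : Nonempty (FundamentalGroup _ z' ≃* (Δ.hat β).ker) :=
    ⟨(hq.fundamentalGroupEquiv ⟨Glue.mk Δ Δ.iota 1 x, rfl⟩).trans (MulEquiv.inv' _).symm⟩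
  have h2 := nonempty_fundamentalGroup_mulEquiv_of_isClopen_range IsEmbedding.subtypeVal
    (by rw [Subtype.range_coe]; exact Glue.isClopen_range_map (Δ.hat β) (hat_iota β)) z'
  have h3 := nonempty_fundamentalGroup_mulEquiv_of_isClopen_range
    (Homeomorph.smul g).isEmbedding
    (by rw [(Homeomorph.smul g).surjective.range_eq]; exact isClopen_univ) (z' : Δ.Glue β)
  have e : Homeomorph.smul g (z' : Δ.Glue β) = Glue.mk Δ β g x := by
    change Glue.mk Δ β (g * Δ.hat β 1) x = _
    rw [map_one, mul_one]
  rw [e] at h3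
  obtain ⟨e1⟩ := h1
  obtain ⟨e2⟩ := h2
  obtain ⟨e3⟩ := h3
  exact ⟨e3.symm.trans (e2.symm.trans e1)⟩

lemma nonempty_fundamentalGroup_mulEquiv_of_homeomorph {Y : Type*} [TopologicalSpace Y]
    (hβ : β.IsInjective) (e : Y ≃ₜ Δ.Glue β) (y : Y) :
    Nonempty (FundamentalGroup Y y ≃* (Δ.hat β).ker) := by
  obtain ⟨e1⟩ := nonempty_fundamentalGroup_mulEquiv_of_isClopen_range e.isEmbedding
    (by rw [e.surjective.range_eq]; exact isClopen_univ) y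
  obtain ⟨e2⟩ := Glue.nonempty_fundamentalGroup_mulEquiv hβ (e y)
  exact ⟨e1.trans e2⟩

end

lemma nonempty_basis (Δ : SmoothFan N) :
    Nonempty (Module.Basis (Fin (Module.finrank ℤ N)) ℤ N) := by
  obtain ⟨σ, hσ⟩ := Δ.nonempty
  obtain ⟨b, -⟩ := Δ.smooth σ hσ
  exact ⟨b⟩

lemma hat_phi_s (v : Δ.Edge) : Δ.hat Δ.phi (Δ.s v) = tElt v.1 := hat_s Δ.phi v

/-! ### Connectedness of the real toric variety -/

variable (Δ) in
/-- Under `T₂ ≅ N ⊗ ℤ₂` the image of `φ̂` becomes the span of the `v ⊗ 1`. -/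
lemma hat_phi_surjective_iff : Function.Surjective (Δ.hat Δ.phi) ↔
    Submodule.span (ZMod 2) (Set.range fun v : Δ.Edge => (1 : ZMod 2) ⊗ₜ[ℤ] v.1) = ⊤ := by
  obtain ⟨b⟩ := Δ.nonempty_basis
  constructor
  · intro h
    refine Submodule.eq_top_iff'.2 fun x => ?_
    obtain ⟨w, hw⟩ := h (T2.ofModTwo b (Multiplicative.ofAdd x))
    induction w using W_induction generalizing x with
    | one =>
      rw [map_one, eq_comm, ← map_one (T2.ofModTwo b)] at hw
      have h0 : x = 0 := T2.ofModTwo_injective b hw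
      rw [h0]
      exact zero_mem _
    | mul v w ih =>
      have hv := Submodule.subset_span (R := ZMod 2) (Set.mem_range_self
        (f := fun v : Δ.Edge => (1 : ZMod 2) ⊗ₜ[ℤ] v.1) v)
      refine (Submodule.add_mem_iff_right _ hv).1 (ih _ ?_)
      rw [ofAdd_add, map_mul, ← hw, T2.ofModTwo_tmul, map_mul, hat_phi_s, ← mul_assoc,
        tElt_mul_self, one_mul]
  · intro h t
    obtain ⟨x, rfl⟩ := T2.ofModTwo_surjective b t
    obtain ⟨x, rfl⟩ := Multiplicative.ofAdd.surjective x
    have hx : x ∈ Submodule.span (ZMod 2)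
      (Set.range fun v : Δ.Edge => (1 : ZMod 2) ⊗ₜ[ℤ] v.1) := h ▸ Submodule.mem_top
    induction hx using Submodule.span_induction with
    | mem x hx =>
      obtain ⟨v, rfl⟩ := hx
      exact ⟨Δ.s v, by rw [hat_phi_s, T2.ofModTwo_tmul]⟩
    | zero => exact ⟨1, by rw [map_one, ofAdd_zero, map_one]⟩
    | add x y _ _ hx hy =>
      obtain ⟨w, hw⟩ := hx
      obtain ⟨w', hw'⟩ := hy
      exact ⟨w * w', by rw [map_mul, hw, hw', ofAdd_add, map_mul]⟩
    | smul a x _ hx =>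
      obtain ⟨w, hw⟩ := hx
      fin_cases a
      · refine ⟨1, ?_⟩
        have : (0 : ZMod 2) • x = 0 := zero_smul _ x
        change _ = T2.ofModTwo b (Multiplicative.ofAdd ((0 : ZMod 2) • x))
        rw [this, map_one, ofAdd_zero, map_one]
      · refine ⟨w, ?_⟩
        have : (1 : ZMod 2) • x = x := one_smul _ x
        change _ = T2.ofModTwo b (Multiplicative.ofAdd ((1 : ZMod 2) • x))
        rw [this, hw]

lemma connectedSpace_X_iff : ConnectedSpace Δ.X ↔ Function.Surjective (Δ.hat Δ.phi) := by
  rw [← Glue.connectedSpace_iff]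
  exact ⟨fun _ => gluePhi.symm.surjective.connectedSpace gluePhi.symm.continuous,
    fun _ => gluePhi.surjective.connectedSpace gluePhi.continuous⟩

lemma span_eq_top_of_basis {ι : Type*} (b : Module.Basis ι ℤ N) (h : ∀ i, ∃ v : Δ.Edge, v.1 = b i) :
    Submodule.span (ZMod 2) (Set.range fun v : Δ.Edge => (1 : ZMod 2) ⊗ₜ[ℤ] v.1) = ⊤ := by
  rw [eq_top_iff, ← (b.baseChange (ZMod 2)).span_eq]
  refine Submodule.span_mono ?_
  rintro _ ⟨i, rfl⟩
  obtain ⟨v, hv⟩ := h i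
  rw [Module.Basis.baseChange_apply, ← hv]
  exact ⟨v, rfl⟩

/-! ### The abelianisation of `W` -/

lemma ray_injective : Function.Injective (ray (Δ := Δ)) := by
  intro v w h
  have h1 : coneOf {v.1} = coneOf {w.1} := Subtype.ext_iff.1 h
  obtain ⟨b, s, hb⟩ := Δ.smooth _ v.2.2
  have hfv : IsFace (coneOf {v.1}) (coneOf (b '' s)) := by
    rw [hb]
    exact isFace_basis b subset_rfl
  have hfw : IsFace (coneOf {w.1}) (coneOf (b '' s)) := by
    rw [← h1]
    exact hfv
  obtain ⟨i, hi, hv⟩ := exists_eq_basis b v.2.1 hfv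
  obtain ⟨j, hj, hw⟩ := exists_eq_basis b w.2.1 hfw
  have h2 : coneOf (b '' {i}) ≤ coneOf (b '' {j}) := by
    rw [Set.image_singleton, Set.image_singleton, ← hv, ← hw, h1]
  rw [coneOf_le_iff] at h2
  have h3 : i = j := h2 rfl
  exact Subtype.ext (by rw [hv, hw, h3])

instance : Finite Δ.Edge := Finite.of_injective ray ray_injective

open Classical in
lemma h_s (v : Δ.Edge) : Δ.h (Δ.s v) = Pi.mulSingle v (-1) := PresentedGroup.toGroup.of _

lemma hom_W_ext {G : Type*} [Group G] {f f' : Δ.W →* G} (h : ∀ v, f (Δ.s v) = f' (Δ.s v)) :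
    f = f' := PresentedGroup.ext h

/-- Every homomorphism from `W` to an abelian group factors through `h`. -/
lemma exists_comp_h {A : Type*} [CommGroup A] (f : Δ.W →* A) : ∃ f' : (Δ.Edge → ℤˣ) →* A,
    f'.comp Δ.h = f := by
  classical
  have := Fintype.ofFinite Δ.Edge
  refine ⟨prodInvolution (fun v => f (Δ.s v)) fun v => by rw [← map_mul, s_sq, map_one],
    hom_W_ext fun v => ?_⟩
  rw [MonoidHom.comp_apply, h_s, prodInvolution_mulSingle]

lemma h_surjective : Function.Surjective Δ.h := by
  classical
  have := Fintype.ofFinite Δ.Edge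
  intro ε
  rw [← MonoidHom.mem_range, ← Finset.univ_prod_mulSingle ε]
  refine Subgroup.prod_mem _ fun v _ => ?_
  rcases Int.units_eq_one_or (ε v) with hv | hv
  · rw [hv, Pi.mulSingle_one]
    exact one_mem _
  · rw [hv]
    exact ⟨Δ.s v, h_s v⟩

lemma ker_h : Δ.h.ker = commutator Δ.W := by
  refine le_antisymm ?_ (Abelianization.commutator_subset_ker _)
  obtain ⟨f, hf⟩ := exists_comp_h (Abelianization.of (G := Δ.W))
  intro w hw
  rw [← Abelianization.ker_of, MonoidHom.mem_ker, ← hf, MonoidHom.comp_apply,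
    MonoidHom.mem_ker.1 hw, map_one]

lemma hat_alpha : Δ.hat Δ.alpha = Δ.h := hom_W_ext fun v => by
  rw [← hom_tLoc Δ.alpha v (mem_ray v)]
  exact congrArg Δ.h (iota_tLoc v (mem_ray v))

variable (Δ) in
/-- The morphism `φ` factors through `α`, because `T₂` is abelian. -/
lemma exists_alpha_phi : ∃ f : (Δ.Edge → ℤˣ) →* T2 N, f.comp Δ.h = Δ.hat Δ.phi ∧
    ∀ τ c, f (Δ.alpha.hom τ c) = Δ.phi.hom τ c := by
  obtain ⟨f, hf⟩ := exists_comp_h (Δ.hat Δ.phi)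
  exact ⟨f, hf, fun τ c => (DFunLike.congr_fun hf (Δ.iota.hom τ c)).trans (hat_iota Δ.phi τ c)⟩

lemma alpha_isInjective : Δ.alpha.IsInjective := by
  obtain ⟨f, -, hf⟩ := Δ.exists_alpha_phi
  exact isInjective_of_comp hf phi_isInjective

instance : ConnectedSpace (Δ.D Δ.alpha) := by
  have : ConnectedSpace (Δ.Glue Δ.alpha) := by
    rw [Glue.connectedSpace_iff, hat_alpha]
    exact h_surjective
  exact (Development.homeoGlue Δ.alpha).symm.surjective.connectedSpace
    (Development.homeoGlue Δ.alpha).symm.continuous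

/-! ### Deck transformations of the covering by the abelianised development -/

section AlphaCover

variable {f : (Δ.Edge → ℤˣ) →* T2 N} (hf : ∀ τ c, f (Δ.alpha.hom τ c) = Δ.phi.hom τ c)

/-- The covering map `[ε, x] ↦ f ε • x`. -/
def alphaCover : Δ.D Δ.alpha → Δ.X :=
  (gluePhi ∘ Glue.map f hf) ∘ Development.homeoGlue Δ.alpha

lemma alphaCover_mk (ε : Δ.Edge → ℤˣ) (x : Δ.XPos) :
    alphaCover hf (Development.mk Δ.VPos Δ.alpha ε x) = f ε • (x : Δ.X) := rfl

lemma isCoveringMap_alphaCover : IsCoveringMap (alphaCover hf) :=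
  ((Glue.isCoveringMap_map f hf phi_isInjective).homeomorph_comp gluePhi).comp_homeomorph _

lemma alphaCover_eq_iff (z z' : Δ.D Δ.alpha) :
    alphaCover hf z = alphaCover hf z' ↔ z ∈ MulAction.orbit f.ker z' := by
  refine gluePhi.injective.eq_iff.trans ((Glue.map_eq_map_iff f hf).trans ?_)
  constructor
  · rintro ⟨k, hk⟩
    exact ⟨k, (Development.homeoGlue Δ.alpha).injective
      ((Development.homeoGlue_smul (k : Δ.Edge → ℤˣ) z').trans hk)⟩
  · rintro ⟨k, rfl⟩
    exact ⟨k, (Development.homeoGlue_smul (k : Δ.Edge → ℤˣ) z').symm⟩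

instance : ContinuousConstSMul f.ker (Δ.D Δ.alpha) :=
  ⟨fun k => continuous_const_smul (k : Δ.Edge → ℤˣ)⟩

include hf in
lemma eq_one_of_smul_eq (k : f.ker) (z : Δ.D Δ.alpha) (h : k • z = z) : k = 1 := by
  obtain ⟨g, σ, hz⟩ := Glue.exists_mem_smul_star (Development.homeoGlue Δ.alpha z)
  refine Subtype.ext (Glue.eq_one_of_mem_ker f hf phi_isInjective k.2 hz hz ?_)
  rw [← Development.homeoGlue_smul]
  exact congrArg _ h

/-- The group of deck transformations is `ker (f : ℤ₂^d → T₂)`, of order `2^(d - n)`. -/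
lemma nonempty_deckGroup_alphaCover (hs : Function.Surjective f) :
    Module.finrank ℤ N ≤ Nat.card Δ.Edge ∧ Nonempty (deckGroup (alphaCover hf) ≃*
      (Fin (Nat.card Δ.Edge - Module.finrank ℤ N) → ℤˣ)) := by
  obtain ⟨b⟩ := Δ.nonempty_basis
  have hcard : Nat.card f.ker * 2 ^ Module.finrank ℤ N = 2 ^ Nat.card Δ.Edge := by
    have h1 := f.ker.card_mul_index
    have h2 : Nat.card ℤˣ = 2 := by rw [Nat.card_eq_fintype_card]; rfl
    rw [Subgroup.index_ker, MonoidHom.range_eq_top.2 hs, Subgroup.card_top,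
      Nat.card_congr (T2.coordEquiv b).toEquiv, Nat.card_fun, Nat.card_fun, h2,
      Nat.card_eq_fintype_card (α := Fin _), Fintype.card_fin] at h1
    exact h1
  have hle : Module.finrank ℤ N ≤ Nat.card Δ.Edge :=
    (Nat.pow_dvd_pow_iff_le_right (x := 2) (by norm_num)).1 ⟨_, by rw [mul_comm, hcard]⟩
  refine ⟨hle, ?_⟩
  obtain ⟨e⟩ := nonempty_mulEquiv_deckGroup (isCoveringMap_alphaCover hf) (alphaCover_eq_iff hf)
    (eq_one_of_smul_eq hf)
  obtain ⟨e'⟩ : Nonempty (f.ker ≃* (Fin (Nat.card Δ.Edge - Module.finrank ℤ N) → ℤˣ)) := by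
    refine nonempty_mulEquiv_of_card_eq
      (fun k => Subtype.ext (funext fun _ => Int.units_mul_self _))
      (fun _ => funext fun _ => Int.units_mul_self _) ?_
    have h2 : Nat.card ℤˣ = 2 := by rw [Nat.card_eq_fintype_card]; rfl
    rw [Nat.card_fun, h2, Nat.card_eq_fintype_card (α := Fin _), Fintype.card_fin]
    refine Nat.eq_of_mul_eq_mul_right (pow_pos two_pos (Module.finrank ℤ N)) ?_
    rw [hcard, ← pow_add, Nat.sub_add_cancel hle]
  exact ⟨e.trans e'⟩

end AlphaCover

end SmoothFan

end RealToric

end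

theorem theorem2p5 {N : Type*} [AddCommGroup N] [Module.Free ℤ N] [Module.Finite ℤ N]
    (Δ : SmoothFan N) :
    -- (1) the developments with respect to `φ` and `ι`
    (Δ.phi.IsInjective ∧ Δ.iota.IsInjective ∧
      (∃ e : Δ.D Δ.phi ≃ₜ Δ.Glue Δ.phi,
        ∀ t x, e (Development.mk Δ.VPos Δ.phi t x) = SmoothFan.Glue.mk Δ Δ.phi t x) ∧
      (∃ e : Δ.Glue Δ.phi ≃ₜ Δ.X, ∀ t x, e (SmoothFan.Glue.mk Δ Δ.phi t x) = t • (x : Δ.X)) ∧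
      (∃ e : Δ.D Δ.iota ≃ₜ Δ.XTilde,
        ∀ w x, e (Development.mk Δ.VPos Δ.iota w x) = SmoothFan.Glue.mk Δ Δ.iota w x) ∧
      IsStratification (Development.stratum Δ.VPos Δ.iota) ∧
      IsStrataPreserving Δ.W (Development.stratum Δ.VPos Δ.iota) ∧
      IsStrictFundamentalDomain Δ.W (Development.stratum Δ.VPos Δ.iota)
        (Set.range (Development.mk Δ.VPos Δ.iota 1)) ∧
      IsStratification (Development.stratum Δ.VPos Δ.phi) ∧
      IsStrataPreserving (T2 N) (Development.stratum Δ.VPos Δ.phi) ∧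
      IsStrictFundamentalDomain (T2 N) (Development.stratum Δ.VPos Δ.phi)
        (Set.range (Development.mk Δ.VPos Δ.phi 1)))
    ∧
    -- (2) connectedness
    ((ConnectedSpace Δ.X ↔
        Submodule.span (ZMod 2) (Set.range fun v : Δ.Edge => (1 : ZMod 2) ⊗ₜ[ℤ] v.1) = ⊤) ∧
      ((∃ b : Module.Basis (Fin (Module.finrank ℤ N)) ℤ N,
          ∀ i, ∃ v : Δ.Edge, v.1 = b i) → ConnectedSpace Δ.X))
    ∧
    -- (3) the universal cover and the fundamental group
    ((∃ p : Δ.XTilde → Δ.X,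
        (∀ w x, p (SmoothFan.Glue.mk Δ Δ.iota w x) = Δ.hat Δ.phi w • (x : Δ.X)) ∧
        IsCoveringMap p ∧ SimplyConnectedSpace Δ.XTilde ∧
        (ConnectedSpace Δ.X → Function.Surjective p)) ∧
      ∀ x : Δ.X, Nonempty (FundamentalGroup Δ.X x ≃* (Δ.hat Δ.phi).ker))
    ∧
    -- (4) the covering associated with the abelianisation of `W`
    (Function.Surjective Δ.h ∧ Δ.h.ker = commutator Δ.W ∧
      Δ.alpha.IsInjective ∧ Δ.hat Δ.alpha = Δ.h ∧
      (∃ e : Δ.D Δ.alpha ≃ₜ Δ.Glue Δ.alpha,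
        ∀ ε x, e (Development.mk Δ.VPos Δ.alpha ε x) = SmoothFan.Glue.mk Δ Δ.alpha ε x) ∧
      ConnectedSpace (Δ.D Δ.alpha) ∧
      (∀ z : Δ.D Δ.alpha, Nonempty (FundamentalGroup (Δ.D Δ.alpha) z ≃* commutator Δ.W)) ∧
      ∃ q : Δ.D Δ.alpha → Δ.X,
        (∀ w x, q (Development.mk Δ.VPos Δ.alpha (Δ.h w) x) = Δ.hat Δ.phi w • (x : Δ.X)) ∧
        IsCoveringMap q ∧
        (ConnectedSpace Δ.X → Function.Surjective q ∧
          Module.finrank ℤ N ≤ Nat.card Δ.Edge ∧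
          Nonempty (deckGroup q ≃*
            (Fin (Nat.card Δ.Edge - Module.finrank ℤ N) → ℤˣ)) ∧
          ∀ z z', q z = q z' → ∃ f ∈ deckGroup q, f z = z')) := by
  obtain ⟨f, hfh, hf⟩ := Δ.exists_alpha_phi
  have hphi : ∀ w x, SmoothFan.gluePhi (SmoothFan.Glue.map (Δ.hat Δ.phi) (SmoothFan.hat_iota Δ.phi)
      (SmoothFan.Glue.mk Δ Δ.iota w x)) = Δ.hat Δ.phi w • (x : Δ.X) := fun _ _ => rfl
  have hcover := (SmoothFan.Glue.isCoveringMap_map _ (SmoothFan.hat_iota Δ.phi)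
    SmoothFan.phi_isInjective).homeomorph_comp SmoothFan.gluePhi
  refine ⟨⟨SmoothFan.phi_isInjective, SmoothFan.iota_isInjective,
    ⟨SmoothFan.Development.homeoGlue Δ.phi, fun _ _ => rfl⟩, ⟨SmoothFan.gluePhi, fun _ _ => rfl⟩,
    ⟨SmoothFan.Development.homeoGlue Δ.iota, fun _ _ => rfl⟩,
    SmoothFan.Development.isStratification _,
    SmoothFan.Development.isStrataPreserving _, SmoothFan.Development.isStrictFundamentalDomain _,
    SmoothFan.Development.isStratification _, SmoothFan.Development.isStrataPreserving _,
    SmoothFan.Development.isStrictFundamentalDomain _⟩, ⟨?_, ?_⟩,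
    ⟨⟨_, hphi, hcover, inferInstance, ?_⟩, ?_⟩,
    SmoothFan.h_surjective, SmoothFan.ker_h, SmoothFan.alpha_isInjective, SmoothFan.hat_alpha,
    ⟨SmoothFan.Development.homeoGlue Δ.alpha, fun _ _ => rfl⟩, inferInstance, fun z => ?_,
    SmoothFan.alphaCover hf, fun w x => ?_, SmoothFan.isCoveringMap_alphaCover hf, fun hX => ?_⟩
  · exact SmoothFan.connectedSpace_X_iff.trans Δ.hat_phi_surjective_iff
  · rintro ⟨b, hb⟩
    exact SmoothFan.connectedSpace_X_iff.2
      (Δ.hat_phi_surjective_iff.2 (SmoothFan.span_eq_top_of_basis b hb))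
  · intro hX z
    obtain ⟨z, rfl⟩ := SmoothFan.gluePhi.surjective z
    obtain ⟨t, x, rfl⟩ := SmoothFan.Glue.exists_mk z
    obtain ⟨w, rfl⟩ := SmoothFan.connectedSpace_X_iff.1 hX t
    exact ⟨SmoothFan.Glue.mk Δ Δ.iota w x, rfl⟩
  · exact SmoothFan.nonempty_fundamentalGroup_mulEquiv_of_homeomorph SmoothFan.phi_isInjective
      SmoothFan.gluePhi.symm
  · obtain ⟨e⟩ := SmoothFan.nonempty_fundamentalGroup_mulEquiv_of_homeomorph
      SmoothFan.alpha_isInjective (SmoothFan.Development.homeoGlue Δ.alpha) z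
    exact ⟨e.trans (MulEquiv.subgroupCongr (by rw [SmoothFan.hat_alpha, SmoothFan.ker_h]))⟩
  · rw [SmoothFan.alphaCover_mk, ← MonoidHom.comp_apply, hfh]
  · have hs : Function.Surjective f := by
      have h1 := SmoothFan.connectedSpace_X_iff.1 hX
      rw [← hfh, MonoidHom.coe_comp] at h1
      exact h1.of_comp
    obtain ⟨hle, hdeck⟩ := SmoothFan.nonempty_deckGroup_alphaCover hf hs
    refine ⟨?_, hle, hdeck, fun z z' h => exists_mem_deckGroup (SmoothFan.alphaCover_eq_iff hf) h⟩
    intro y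
    obtain ⟨z, rfl⟩ := SmoothFan.gluePhi.surjective y
    obtain ⟨t, x, rfl⟩ := SmoothFan.Glue.exists_mk z
    obtain ⟨ε, rfl⟩ := hs t
    exact ⟨Development.mk Δ.VPos Δ.alpha ε x, rfl⟩
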